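/- Let $\mathbb G$ be the Grushin plane: $\mathbb R^2$ with horizontal vector fields $X_1=\partial/\partial x$ and $X_2=x\,\partial/\partial y$, and let $d_{\mathbb G}(p,q)\in[0,\infty]$ be its Carnot–Carathéodory distance, the infimum of the lengths of the absolutely continuous curves from $p$ to $q$ that are a.e. tangent to the span of $X_1,X_2$, where length is measured with the norm for which $X_1,X_2$ are orthonormal. Let $A=\{x=0\}$ be the singular line and $\Omega=\mathbb G\setminus A$. Distances and diameters of sets are taken with respect to $d_{\mathbb G}$. A map $F$ from a subset $S$ of $\mathbb G$ to $\mathbb R^n$ is called $L$-bi-Lipschitz ($L\ge 1$) if $L^{-1}d_{\mathbb G}(p,q)\le |F(p)-F(q)|\le L\,d_{\mathbb G}(p,q)$ for all $p,q\in S$. For $n,k\in\mathbb Z$ let $Q=[2^{-n},2^{1-n}]\times[k4^{-n},(k+1)4^{-n}]$, or its mirror image $[-2^{1-n},-2^{-n}]\times[k4^{-n},(k+1)4^{-n}]$; these are the boxes of the Whitney decomposition $W$ of $\Omega$. Let $Q^*$ be the union of the boxes touching $Q$, let $Q^{**}$ be the union of the boxes touching $Q^*$, and for boxes $Q,R$ put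 $d_W(Q,R)=\operatorname{dist}(Q,R)/\min(\operatorname{diam}Q,\operatorname{diam}R)$. To $Q$ attach the chart $\hat h_Q(x,y)=\bigl(x,(y-k4^{-n})/\operatorname{diam}Q\bigr)\in\mathbb R^2$. **Theorem 1.** 1. There are $N\in\mathbb N$, $C\ge1$ and a $C$-bi-Lipschitz map $(\mathbb G,d_{\mathbb G})\to\mathbb R^N$. 2. There are $L\ge 1$ and an $L$-bi-Lipschitz map $(A,d_{\mathbb G})\to\mathbb R^3$. 3. There are constants $C_1>0$, $C_2\geq 0$, $C_3\in\mathbb N$, functions $\varphi_Q:\mathbb G\to[0,1]$ $(Q\in W)$ and points $z_Q\in A$ $(Q\in W)$ such that: - $\varphi_Q\ge 1/C_1$ on $Q^*$, and $\varphi_Q=0$ outside $Q^{**}$; - $\varphi_Q$ is Lipschitz with constant $C_2/\operatorname{diam}Q$ with respect to $d_{\mathbb G}$; - at every point of $\Omega$ at most $C_3$ of the $\varphi_Q$ are nonzero, and $\sum_Q\varphi_Q=1$ on $\Omega$; - $\operatorname{dist}(z_Q,Q)=\operatorname{dist}(A,Q)$ for every $Q$; and such that for every $L\ge1$ there are $M\in\mathbb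 N$, a coloring $K:W\to\{1,\dots,M\}$ giving different colors to distinct boxes $Q,R$ with $d_W(Q,R)<2000L^2$, and a constant $C\ge1$ (so $M$, $K$ and $C$ depend only on $L$), such that for every $L$-bi-Lipschitz map $f:(A,d_{\mathbb G})\to\mathbb R^3$ the map $$F=g\times H\times \operatorname{dist}(\cdot,A):\ \mathbb G\to\mathbb R^3\times(\mathbb R^2)^M\times\mathbb R=\mathbb R^{2M+4}$$ is $C$-bi-Lipschitz on $(\mathbb G,d_{\mathbb G})$. Here $g=f$ on $A$ and $g(p)=\sum_Q\varphi_Q(p)f(z_Q)$ for $p\in\Omega$, and $H(p)=\sum_Q \varphi_Q(p)\,\hat h_Q(p)\otimes e_{K(Q)}$, with $e_1,\dots,e_M$ the standard basis of $\mathbb R^M$. -/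

import Mathlib

open scoped NNReal ENNReal

noncomputable section

namespace Grushin

/-- The vector field `∂/∂x` on the plane. -/
def X₁ (_p : ℝ × ℝ) : ℝ × ℝ := (1, 0)

/-- The vector field `x ∂/∂y` on the plane. -/
def X₂ (p : ℝ × ℝ) : ℝ × ℝ := (0, p.1)

/-- The velocity of a plane curve. -/
def velocity (γ : ℝ → ℝ × ℝ) (t : ℝ) : ℝ × ℝ :=
  (deriv (fun s => (γ s).1) t, deriv (fun s => (γ s).2) t)

/-- `γ : [a, b] → ℝ²` is an absolutely continuous curve which at almost every time is tangent to
the distribution spanned by `X₁` and `X₂`. -/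
structure IsHorizontalCurve (γ : ℝ → ℝ × ℝ) (a b : ℝ) : Prop where
  le : a ≤ b
  absCont_fst : AbsolutelyContinuousOnInterval (fun t => (γ t).1) a b
  absCont_snd : AbsolutelyContinuousOnInterval (fun t => (γ t).2) a b
  tangent : ∀ᵐ t ∂(MeasureTheory.volume.restrict (Set.Icc a b)),
    velocity γ t ∈ Submodule.span ℝ {X₁ (γ t), X₂ (γ t)}

/-- The sub-Riemannian norm for which `X₁`, `X₂` are orthonormal: the least Euclidean norm of a
pair of coefficients which represents `v` (and `∞` if `v` is not horizontal). -/
def horizontalNorm (p v : ℝ × ℝ) : ℝ≥0∞ :=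
  ⨅ (u : ℝ × ℝ) (_ : v = u.1 • X₁ p + u.2 • X₂ p), ENNReal.ofReal (√(u.1 ^ 2 + u.2 ^ 2))

/-- The length of a horizontal curve. -/
def length (γ : ℝ → ℝ × ℝ) (a b : ℝ) : ℝ≥0∞ :=
  ∫⁻ t in Set.Icc a b, horizontalNorm (γ t) (velocity γ t)

/-- The Carnot–Carathéodory distance of the Grushin plane: the infimum of the lengths of the
horizontal curves joining `p` to `q`. -/
def ccDist (p q : ℝ × ℝ) : ℝ≥0∞ :=
  ⨅ (γ : ℝ → ℝ × ℝ) (a : ℝ) (b : ℝ) (_ : IsHorizontalCurve γ a b ∧ γ a = p ∧ γ b = q),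
    length γ a b

/-- The distance between two sets with respect to `ccDist`. -/
def setDist (S T : Set (ℝ × ℝ)) : ℝ≥0∞ := ⨅ p ∈ S, ⨅ q ∈ T, ccDist p q

/-- The diameter of a set with respect to `ccDist`. -/
def diam (S : Set (ℝ × ℝ)) : ℝ≥0∞ := ⨆ p ∈ S, ⨆ q ∈ S, ccDist p q

/-- `L ≥ 1` and `F` is `L`-bi-Lipschitz on the subset `S` of the Grushin plane. -/
def IsBiLipschitzOn {n : ℕ} (L : ℝ≥0) (S : Set (ℝ × ℝ)) (F : ℝ × ℝ → EuclideanSpace ℝ (Fin n)) :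
    Prop :=
  1 ≤ L ∧ ∀ p ∈ S, ∀ q ∈ S,
    (L : ℝ≥0∞)⁻¹ * ccDist p q ≤ edist (F p) (F q) ∧ edist (F p) (F q) ≤ L * ccDist p q

/-- The singular line `x = 0`. -/
def singularLine : Set (ℝ × ℝ) := {p | p.1 = 0}

/-- Labels of the boxes of the Whitney decomposition of the complement of the singular line. -/
structure WhitneyBox where
  /-- whether the box lies in the right half-plane -/
  right : Bool
  /-- the scale -/
  n : ℤ
  /-- the vertical position -/
  k : ℤ

namespace WhitneyBox

/-- The box `[2⁻ⁿ, 2¹⁻ⁿ] × [k 4⁻ⁿ, (k + 1) 4⁻ⁿ]`, or its mirror image in the singular line. -/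
def carrier (Q : WhitneyBox) : Set (ℝ × ℝ) :=
  (if Q.right then Set.Icc ((2 : ℝ) ^ (-Q.n)) ((2 : ℝ) ^ (1 - Q.n))
    else Set.Icc (-(2 : ℝ) ^ (1 - Q.n)) (-(2 : ℝ) ^ (-Q.n))) ×ˢ
  Set.Icc ((Q.k : ℝ) * (4 : ℝ) ^ (-Q.n)) (((Q.k : ℝ) + 1) * (4 : ℝ) ^ (-Q.n))

/-- `Q*`, the union of the boxes which touch `Q`. -/
def star (Q : WhitneyBox) : Set (ℝ × ℝ) :=
  ⋃ (R : WhitneyBox) (_ : (R.carrier ∩ Q.carrier).Nonempty), R.carrier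

/-- `Q**`, the union of the boxes which touch `Q*`. -/
def starStar (Q : WhitneyBox) : Set (ℝ × ℝ) :=
  ⋃ (R : WhitneyBox) (_ : (R.carrier ∩ Q.star).Nonempty), R.carrier

/-- The Whitney distance of two boxes. -/
def whitneyDist (Q R : WhitneyBox) : ℝ≥0∞ :=
  setDist Q.carrier R.carrier / min (diam Q.carrier) (diam R.carrier)

/-- The rescaled chart attached to `Q`: the second coordinate is measured from the bottom edge of
`Q` and divided by the diameter of `Q`. -/
def chart (Q : WhitneyBox) (p : ℝ × ℝ) : Fin 2 → ℝ :=
  ![p.1, (p.2 - (Q.k : ℝ) * (4 : ℝ) ^ (-Q.n)) / (diam Q.carrier).toReal]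

end WhitneyBox

/-- `φ` is a Lipschitz partition of unity on the complement of the singular line, subordinate to
the sets `Q**`, with constants `C₁`, `C₂`, `C₃`. -/
structure IsLipschitzPartition (C₁ C₂ : ℝ≥0) (C₃ : ℕ) (φ : WhitneyBox → ℝ × ℝ → ℝ) : Prop where
  pos : 0 < C₁
  nonneg : ∀ Q p, 0 ≤ φ Q p
  le_one : ∀ Q p, φ Q p ≤ 1
  lower : ∀ Q : WhitneyBox, ∀ p ∈ Q.star, (C₁ : ℝ)⁻¹ ≤ φ Q p
  support : ∀ Q : WhitneyBox, ∀ p ∉ Q.starStar, φ Q p = 0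
  lipschitz : ∀ (Q : WhitneyBox) (p q : ℝ × ℝ),
    edist (φ Q p) (φ Q q) ≤ C₂ / diam Q.carrier * ccDist p q
  overlap : ∀ p ∉ singularLine, {Q | φ Q p ≠ 0}.encard ≤ C₃
  sum_eq_one : ∀ p ∉ singularLine, ∑ᶠ Q, φ Q p = 1

/-- `z Q` is a point of the singular line nearest to the box `Q`. -/
def IsNearestPointChoice (z : WhitneyBox → ℝ × ℝ) : Prop :=
  ∀ Q : WhitneyBox, z Q ∈ singularLine ∧
    setDist {z Q} Q.carrier = setDist singularLine Q.carrier

/-- Distinct boxes at Whitney distance less than `2000 L²` have different colors. -/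
def IsColoring (L : ℝ≥0) {M : ℕ} (K : WhitneyBox → Fin M) : Prop :=
  ∀ Q R : WhitneyBox, Q ≠ R → Q.whitneyDist R < 2000 * (L : ℝ≥0∞) ^ 2 → K Q ≠ K R

/-- The Whitney extension of `f` from the singular line to the plane. -/
def whitneyExtension (φ : WhitneyBox → ℝ × ℝ → ℝ) (z : WhitneyBox → ℝ × ℝ)
    (f : ℝ × ℝ → EuclideanSpace ℝ (Fin 3)) (p : ℝ × ℝ) : EuclideanSpace ℝ (Fin 3) :=
  if p.1 = 0 then f p else ∑ᶠ Q, φ Q p • f (z Q)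

/-- The colored sum of the localized charts, a map into `(ℝ²)ᴹ`. -/
def coloredSum (φ : WhitneyBox → ℝ × ℝ → ℝ) {M : ℕ} (K : WhitneyBox → Fin M) (p : ℝ × ℝ) :
    Fin M × Fin 2 → ℝ :=
  fun c => ∑ᶠ Q, if K Q = c.1 then φ Q p * Q.chart p c.2 else 0

/-- The map `g × H × dist(·, A)` into `ℝ³ × ℝ²ᴹ × ℝ`, with the Euclidean norm on the product. -/
def embedding (φ : WhitneyBox → ℝ × ℝ → ℝ) (z : WhitneyBox → ℝ × ℝ) {M : ℕ}
    (K : WhitneyBox → Fin M) (f : ℝ × ℝ → EuclideanSpace ℝ (Fin 3)) (p : ℝ × ℝ) :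
    EuclideanSpace ℝ (Fin (3 + M * 2 + 1)) :=
  WithLp.toLp 2 (Fin.append
    (Fin.append (WithLp.ofLp (whitneyExtension φ z f p))
      (fun j => coloredSum φ K p (finProdFinEquiv.symm j)))
    (fun _ : Fin 1 => (setDist {p} singularLine).toReal))

end Grushin

end

open Grushin

open Grushin

noncomputable section

namespace Grushin

open MeasureTheory Set

/-! Everything rests on two-sided estimates of the distance by explicit functions. If `d = rdist p
q`, then `|p.1 - q.1| ≤ d` and `|p.2 - q.2| ≤ (|p.1| + d) d`. Conversely, three-legged paths give `d
≤ |p.1 - q.1| + |p.2 - q.2| / |p.1|`, which is sharp up to constants far from the singular line, and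
`d ≤ |p.1| + |q.1| + 3 √|p.2 - q.2|`, which is sharp near it. In particular the singular line
carries the metric `√|y - y'|` up to a factor 3.

The upper bound for the embedding is the standard Whitney computation. A difference of cutoffs is at
most a multiple of `d / scale`, the quantity multiplied by it has size at most a multiple of `scale
+ d`, and only boundedly many boxes contribute (`norm_extension_sub_extension_le`,
`abs_coloredSum_sub_le`).

For the lower bound (`rdist_le_lowerConstant_mul`) let `E` bound the difference of the images. If
`|p.1|` is at most a multiple of `E`, the extension at `p` and `q` is within `O(E)` of `f` at their
vertical projections, so the lower bound for `f` controls `√|p.2 - q.2|`, and hence `d`, by `E`.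
Otherwise the same comparison shows that `q` lies within boundedly many Whitney boxes of `p`. The
coloring then ensures that the charts of the color of a box `Q` containing `p` see only `Q` at both
points. The charts weighted by the cutoff of `Q`, together with the distance to the line, determine
the side of the line, the change of the cutoff and the change of the coordinates up to `O(E)`
(`rdist_le_of_close`). The required separation depends only on `L`.

The bi-Lipschitz map of the singular line comes from a self-similar lattice curve. A self-avoiding
path with `196 = 14 ^ 2` edges from the origin to `(14, 0, 0)` is substituted into itself
repeatedly, giving a curve of dimension two on which squared distance is comparable to the number of
steps. Double cones around the edges keep different pieces apart, so the constants survive every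
substitution (`IsSnowflake.subdivide`). Rescaled curves converge along an ultrafilter to a map of
the whole line. The generator itself is checked by computation. The embedding of the plane is then
the extension of this particular map. -/

/-! ### Explicit bounds for the Carnot–Carathéodory distance -/

lemma abs_fst_le_horizontalNorm (p v : ℝ × ℝ) : ENNReal.ofReal |v.1| ≤ horizontalNorm p v := by
  refine le_iInf₂ fun u hu => ENNReal.ofReal_le_ofReal ?_
  have h : v.1 = u.1 := by rw [hu]; simp [X₁, X₂]
  rw [h]
  exact Real.abs_le_sqrt (by nlinarith [sq_nonneg u.2])

lemma abs_snd_le_horizontalNorm {M : ℝ} (hM : 0 < M) {p : ℝ × ℝ} (hp : |p.1| ≤ M) (v : ℝ × ℝ) :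
    ENNReal.ofReal |v.2| ≤ ENNReal.ofReal M * horizontalNorm p v := by
  unfold horizontalNorm
  have h0 : ENNReal.ofReal M ≠ 0 := by simpa using hM
  simp only [ENNReal.mul_iInf_of_ne h0 ENNReal.ofReal_ne_top]
  refine le_iInf₂ fun u hu => ?_
  rw [← ENNReal.ofReal_mul hM.le]
  refine ENNReal.ofReal_le_ofReal ?_
  have h : v.2 = p.1 * u.2 := by rw [hu]; simp [X₁, X₂, mul_comm]
  rw [h, abs_mul]
  exact mul_le_mul hp (Real.abs_le_sqrt (by nlinarith [sq_nonneg u.1])) (abs_nonneg _) hM.le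

lemma horizontalNorm_le (p : ℝ × ℝ) (u : ℝ × ℝ) :
    horizontalNorm p (u.1, u.2 * p.1) ≤ ENNReal.ofReal (√(u.1 ^ 2 + u.2 ^ 2)) :=
  iInf₂_le u (by ext <;> simp [X₁, X₂])

lemma abs_sub_le_lintegral_deriv {f : ℝ → ℝ} {a b : ℝ} (hab : a ≤ b)
    (hf : AbsolutelyContinuousOnInterval f a b) :
    ENNReal.ofReal |f b - f a| ≤ ∫⁻ t in Icc a b, ENNReal.ofReal |deriv f t| := by
  rw [← hf.integral_deriv_eq_sub, intervalIntegral.integral_of_le hab,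
    ← integral_Icc_eq_integral_Ioc]
  have h := enorm_integral_le_lintegral_enorm (μ := volume.restrict (Icc a b)) (deriv f)
  simpa only [Real.enorm_eq_ofReal_abs] using h

lemma abs_fst_sub_le_length {γ : ℝ → ℝ × ℝ} {a b : ℝ} (h : IsHorizontalCurve γ a b) :
    ENNReal.ofReal |(γ b).1 - (γ a).1| ≤ length γ a b :=
  (abs_sub_le_lintegral_deriv h.le h.absCont_fst).trans
    (lintegral_mono fun t => abs_fst_le_horizontalNorm (γ t) (velocity γ t))

lemma abs_fst_sub_le_length_of_mem {γ : ℝ → ℝ × ℝ} {a b t : ℝ} (h : IsHorizontalCurve γ a b)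
    (ht : t ∈ Icc a b) : ENNReal.ofReal |(γ t).1 - (γ a).1| ≤ length γ a b := by
  have h1 : AbsolutelyContinuousOnInterval (fun t => (γ t).1) a t :=
    h.absCont_fst.mono (by rw [uIcc_of_le ht.1, uIcc_of_le h.le]; exact Icc_subset_Icc_right ht.2)
  refine (abs_sub_le_lintegral_deriv ht.1 h1).trans ?_
  refine (lintegral_mono_set (Icc_subset_Icc_right ht.2)).trans ?_
  exact lintegral_mono fun t => abs_fst_le_horizontalNorm (γ t) (velocity γ t)

/-- A curve of length at most `l` stays in the strip `|x| ≤ |(γ a).1| + l`, where its vertical speed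
is at most this bound times its horizontal norm. -/
lemma abs_snd_sub_le_length {γ : ℝ → ℝ × ℝ} {a b l : ℝ} (h : IsHorizontalCurve γ a b)
    (hl0 : 0 < l) (hl : length γ a b ≤ ENNReal.ofReal l) :
    |(γ b).2 - (γ a).2| ≤ (|(γ a).1| + l) * l := by
  set M := |(γ a).1| + l with hM
  have hM0 : 0 < M := by positivity
  have hx : ∀ t ∈ Icc a b, |(γ t).1| ≤ M := by
    intro t ht
    have h1 := (abs_fst_sub_le_length_of_mem h ht).trans hl
    rw [ENNReal.ofReal_le_ofReal_iff hl0.le] at h1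
    have := abs_sub_abs_le_abs_sub (γ t).1 (γ a).1
    linarith
  have h2 : ENNReal.ofReal |(γ b).2 - (γ a).2| ≤ ENNReal.ofReal (M * l) := by
    refine (abs_sub_le_lintegral_deriv h.le h.absCont_snd).trans ?_
    rw [ENNReal.ofReal_mul hM0.le]
    refine le_trans ?_ (mul_le_mul_right hl _)
    unfold length
    rw [← lintegral_const_mul' _ _ ENNReal.ofReal_ne_top]
    refine setLIntegral_mono' measurableSet_Icc fun t ht => ?_
    exact abs_snd_le_horizontalNorm hM0 (hx t ht) (velocity γ t)
  exact (ENNReal.ofReal_le_ofReal_iff (by positivity)).1 h2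

/-- Projection to `[0, 1]`. -/
def unitClamp (t : ℝ) : ℝ := max 0 (min t 1)

lemma unitClamp_of_le {t : ℝ} (h : t ≤ 0) : unitClamp t = 0 := by
  unfold unitClamp; rw [max_eq_left]; exact (min_le_left _ _).trans h

lemma unitClamp_of_ge {t : ℝ} (h : 1 ≤ t) : unitClamp t = 1 := by
  unfold unitClamp; rw [min_eq_right h]; simp

lemma unitClamp_of_mem {t : ℝ} (h0 : 0 ≤ t) (h : t ≤ 1) : unitClamp t = t := by
  unfold unitClamp; rw [min_eq_left h, max_eq_right h0]

lemma unitClamp_nonneg (t : ℝ) : 0 ≤ unitClamp t := le_max_left _ _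

lemma unitClamp_le_one (t : ℝ) : unitClamp t ≤ 1 := by simp [unitClamp]

lemma abs_unitClamp_sub_le (s t : ℝ) : |unitClamp s - unitClamp t| ≤ |s - t| := by
  unfold unitClamp
  refine (abs_max_sub_max_le_max _ _ _ _).trans ?_
  have := abs_min_sub_min_le_max s 1 t 1
  simpa using this

lemma unitClamp_mono {s t : ℝ} (h : s ≤ t) : unitClamp s ≤ unitClamp t := by
  unfold unitClamp; gcongr

/-- The curve which moves from `p` horizontally to the abscissa `w`, then vertically, then
horizontally to `q`. -/
def staircase (p q : ℝ × ℝ) (w : ℝ) (t : ℝ) : ℝ × ℝ :=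
  (p.1 + (w - p.1) * unitClamp t + (q.1 - w) * unitClamp (t - 2),
    p.2 + (q.2 - p.2) * unitClamp (t - 1))

lemma lipschitzWith_const_mul_unitClamp (c d : ℝ) :
    LipschitzWith (Real.toNNReal |c|) (fun t => c * unitClamp (t - d)) := by
  refine LipschitzWith.of_dist_le_mul fun s t => ?_
  rw [Real.dist_eq, Real.dist_eq, ← mul_sub, abs_mul, Real.coe_toNNReal _ (abs_nonneg _)]
  refine mul_le_mul_of_nonneg_left ?_ (abs_nonneg _)
  have := abs_unitClamp_sub_le (s - d) (t - d)
  rwa [sub_sub_sub_cancel_right] at this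

lemma absolutelyContinuous_staircase_fst (p q : ℝ × ℝ) (w : ℝ) :
    AbsolutelyContinuousOnInterval (fun t => (staircase p q w t).1) 0 3 := by
  have h1 := lipschitzWith_const_mul_unitClamp (w - p.1) 0
  have h2 := lipschitzWith_const_mul_unitClamp (q.1 - w) 2
  have h3 := ((LipschitzWith.const p.1).add h1).add h2
  simp only [sub_zero] at h3
  unfold staircase
  exact h3.lipschitzOnWith.absolutelyContinuousOnInterval

lemma absolutelyContinuous_staircase_snd (p q : ℝ × ℝ) (w : ℝ) :
    AbsolutelyContinuousOnInterval (fun t => (staircase p q w t).2) 0 3 := by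
  have h1 := lipschitzWith_const_mul_unitClamp (q.2 - p.2) 1
  have h3 := (LipschitzWith.const p.2).add h1
  exact h3.lipschitzOnWith.absolutelyContinuousOnInterval

lemma hasDerivAt_unitClamp_of_mem {t : ℝ} (h0 : 0 < t) (h1 : t < 1) : HasDerivAt unitClamp 1 t := by
  refine (hasDerivAt_id t).congr_of_eventuallyEq ?_
  filter_upwards [Ioo_mem_nhds h0 h1] with s hs
  exact unitClamp_of_mem hs.1.le hs.2.le

lemma hasDerivAt_unitClamp_of_neg {t : ℝ} (h0 : t < 0) : HasDerivAt unitClamp 0 t := by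
  refine (hasDerivAt_const t 0).congr_of_eventuallyEq ?_
  filter_upwards [Iio_mem_nhds h0] with s hs
  exact unitClamp_of_le (le_of_lt hs)

lemma hasDerivAt_unitClamp_of_gt {t : ℝ} (h0 : 1 < t) : HasDerivAt unitClamp 0 t := by
  refine (hasDerivAt_const t 1).congr_of_eventuallyEq ?_
  filter_upwards [Ioi_mem_nhds h0] with s hs
  exact unitClamp_of_ge (le_of_lt hs)

lemma velocity_staircase (p q : ℝ × ℝ) (w : ℝ) {t c₀ c₁ c₂ : ℝ} (h₀ : HasDerivAt unitClamp c₀ t)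
    (h₁ : HasDerivAt unitClamp c₁ (t - 1)) (h₂ : HasDerivAt unitClamp c₂ (t - 2)) :
    velocity (staircase p q w) t = ((w - p.1) * c₀ + (q.1 - w) * c₂, (q.2 - p.2) * c₁) := by
  have e1 : HasDerivAt (fun s => unitClamp (s - 1)) c₁ t := h₁.comp_sub_const t 1
  have e2 : HasDerivAt (fun s => unitClamp (s - 2)) c₂ t := h₂.comp_sub_const t 2
  have f1 : HasDerivAt (fun s => (staircase p q w s).1) ((w - p.1) * c₀ + (q.1 - w) * c₂) t :=
    ((h₀.const_mul (w - p.1)).const_add p.1).add (e2.const_mul (q.1 - w))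
  have f2 : HasDerivAt (fun s => (staircase p q w s).2) ((q.2 - p.2) * c₁) t :=
    (e1.const_mul (q.2 - p.2)).const_add p.2
  unfold velocity
  rw [f1.deriv, f2.deriv]

/-- The coefficients of the velocity of `staircase` with respect to the frame. -/
lemma exists_coeff_staircase (p q : ℝ × ℝ) {w : ℝ} (hw : w ≠ 0 ∨ p.2 = q.2) {t : ℝ}
    (ht : t ∈ Icc (0 : ℝ) 3) (h0 : t ≠ 0) (h1 : t ≠ 1) (h2 : t ≠ 2) (h3 : t ≠ 3) :
    ∃ u : ℝ × ℝ, velocity (staircase p q w) t = (u.1, u.2 * (staircase p q w t).1) ∧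
      √(u.1 ^ 2 + u.2 ^ 2) = (Icc (0 : ℝ) 1).indicator (fun _ => |p.1 - w|) t +
        (Icc (1 : ℝ) 2).indicator (fun _ => |p.2 - q.2| / |w|) t +
        (Icc (2 : ℝ) 3).indicator (fun _ => |w - q.1|) t := by
  obtain ⟨ht0, ht3⟩ := ht
  rcases lt_or_gt_of_ne h1 with h1 | h1
  · have e0 : 0 < t := lt_of_le_of_ne ht0 h0.symm
    refine ⟨(w - p.1, 0), ?_, ?_⟩
    · rw [velocity_staircase p q w (hasDerivAt_unitClamp_of_mem e0 h1)
        (hasDerivAt_unitClamp_of_neg (by linarith)) (hasDerivAt_unitClamp_of_neg (by linarith))]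
      simp
    · rw [indicator_of_mem (show t ∈ Icc (0 : ℝ) 1 from ⟨ht0, h1.le⟩),
        indicator_of_notMem (by simp; intros; linarith),
        indicator_of_notMem (by simp; intros; linarith)]
      simp [Real.sqrt_sq_eq_abs, abs_sub_comm]
  rcases lt_or_gt_of_ne h2 with h2 | h2
  · refine ⟨(0, (q.2 - p.2) / w), ?_, ?_⟩
    · rw [velocity_staircase p q w (hasDerivAt_unitClamp_of_gt h1)
        (hasDerivAt_unitClamp_of_mem (by linarith) (by linarith))
        (hasDerivAt_unitClamp_of_neg (by linarith))]
      have : (staircase p q w t).1 = w := by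
        unfold staircase
        rw [unitClamp_of_ge h1.le, unitClamp_of_le (by linarith)]; simp
      rw [this]
      rcases hw with hw | hw
      · simp [hw]
      · simp [hw]
    · rw [indicator_of_notMem (by simp; intros; linarith),
        indicator_of_mem (show t ∈ Icc (1 : ℝ) 2 from ⟨h1.le, h2.le⟩),
        indicator_of_notMem (by simp; intros; linarith)]
      simp [Real.sqrt_sq_eq_abs, abs_sub_comm, abs_div]
  · have e3 : t < 3 := lt_of_le_of_ne ht3 h3
    refine ⟨(q.1 - w, 0), ?_, ?_⟩
    · rw [velocity_staircase p q w (hasDerivAt_unitClamp_of_gt h1)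
        (hasDerivAt_unitClamp_of_gt (by linarith))
        (hasDerivAt_unitClamp_of_mem (by linarith) (by linarith))]
      simp
    · rw [indicator_of_notMem (by simp; intros; linarith),
        indicator_of_notMem (by simp; intros; linarith),
        indicator_of_mem (show t ∈ Icc (2 : ℝ) 3 from ⟨h2.le, ht3⟩)]
      simp [Real.sqrt_sq_eq_abs, abs_sub_comm]

lemma ae_ne_corners : ∀ᵐ t ∂(volume.restrict (Icc (0 : ℝ) 3)),
    t ∈ Icc (0 : ℝ) 3 ∧ t ≠ 0 ∧ t ≠ 1 ∧ t ≠ 2 ∧ t ≠ 3 := by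
  refine (ae_restrict_mem measurableSet_Icc).and ?_
  have h (c : ℝ) : ∀ᵐ t ∂(volume.restrict (Icc (0 : ℝ) 3)), t ≠ c :=
    ae_restrict_of_ae (Measure.ae_ne volume c)
  exact (h 0).and ((h 1).and ((h 2).and (h 3)))

lemma isHorizontalCurve_staircase (p q : ℝ × ℝ) {w : ℝ} (hw : w ≠ 0 ∨ p.2 = q.2) :
    IsHorizontalCurve (staircase p q w) 0 3 where
  le := by norm_num
  absCont_fst := absolutelyContinuous_staircase_fst p q w
  absCont_snd := absolutelyContinuous_staircase_snd p q w
  tangent := by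
    filter_upwards [ae_ne_corners] with t ⟨ht, h0, h1, h2, h3⟩
    obtain ⟨u, hu, -⟩ := exists_coeff_staircase p q hw ht h0 h1 h2 h3
    rw [hu, Submodule.mem_span_pair]
    exact ⟨u.1, u.2, by ext <;> simp [X₁, X₂]⟩

/-- The middle leg runs at abscissa `w`, where vertical motion costs `1 / |w|` per unit. For `w = 0`
there is no vertical motion, and the convention `0 / 0 = 0` gives the right cost. -/
lemma ccDist_le_staircase (p q : ℝ × ℝ) {w : ℝ} (hw : w ≠ 0 ∨ p.2 = q.2) :
    ccDist p q ≤ ENNReal.ofReal (|p.1 - w| + |p.2 - q.2| / |w| + |w - q.1|) := by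
  have hs : staircase p q w 0 = p := by
    unfold staircase
    rw [unitClamp_of_le le_rfl, unitClamp_of_le (by norm_num), unitClamp_of_le (by norm_num)]
    simp
  have he : staircase p q w 3 = q := by
    unfold staircase
    rw [unitClamp_of_ge (by norm_num), unitClamp_of_ge (by norm_num),
      unitClamp_of_ge (by norm_num)]
    simp
  refine iInf_le_of_le (staircase p q w) <| iInf_le_of_le 0 <| iInf_le_of_le 3 <|
    iInf_le_of_le ⟨isHorizontalCurve_staircase p q hw, hs, he⟩ ?_
  have key : length (staircase p q w) 0 3 ≤ ∫⁻ t in Icc (0 : ℝ) 3, ENNReal.ofReal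
      ((Icc (0 : ℝ) 1).indicator (fun _ => |p.1 - w|) t +
        (Icc (1 : ℝ) 2).indicator (fun _ => |p.2 - q.2| / |w|) t +
        (Icc (2 : ℝ) 3).indicator (fun _ => |w - q.1|) t) := by
    refine lintegral_mono_ae ?_
    filter_upwards [ae_ne_corners] with t ⟨ht, h0, h1, h2, h3⟩
    obtain ⟨u, hu, hu'⟩ := exists_coeff_staircase p q hw ht h0 h1 h2 h3
    rw [← hu', hu]
    exact horizontalNorm_le _ u
  refine key.trans ?_
  have hi (a : ℝ) (c : ℝ) (hc : 0 ≤ c) (t : ℝ) : ENNReal.ofReal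
      ((Icc a (a + 1)).indicator (fun _ => c) t) =
        (Icc a (a + 1)).indicator (fun _ => ENNReal.ofReal c) t := by
    by_cases h : t ∈ Icc a (a + 1) <;> simp [h]
  have hn (a : ℝ) (c : ℝ) (hc : 0 ≤ c) (t : ℝ) :
      0 ≤ (Icc a (a + 1)).indicator (fun _ => c) t := indicator_nonneg (fun _ _ => hc) t
  have e0 := hi 0 |p.1 - w| (abs_nonneg _)
  have e1 := hi 1 (|p.2 - q.2| / |w|) (by positivity)
  have e2 := hi 2 |w - q.1| (abs_nonneg _)
  have n0 := hn 0 |p.1 - w| (abs_nonneg _)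
  have n1 := hn 1 (|p.2 - q.2| / |w|) (by positivity)
  have n2 := hn 2 |w - q.1| (abs_nonneg _)
  have hint (a b c : ℝ) (ha : 0 ≤ a) (hb : b ≤ 3) (hab : b - a = 1) : ∫⁻ t in Icc (0 : ℝ) 3,
      (Icc a b).indicator (fun _ => ENNReal.ofReal c) t = ENNReal.ofReal c := by
    rw [lintegral_indicator measurableSet_Icc, Measure.restrict_restrict measurableSet_Icc,
      inter_eq_self_of_subset_left (Icc_subset_Icc ha hb)]
    simp [hab]
  norm_num at e0 e1 e2 n0 n1 n2
  rw [ENNReal.ofReal_add (by positivity) (by positivity),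
    ENNReal.ofReal_add (by positivity) (by positivity)]
  have : ∀ t, ENNReal.ofReal
      ((Icc (0 : ℝ) 1).indicator (fun _ => |p.1 - w|) t +
        (Icc (1 : ℝ) 2).indicator (fun _ => |p.2 - q.2| / |w|) t +
        (Icc (2 : ℝ) 3).indicator (fun _ => |w - q.1|) t) =
      (Icc (0 : ℝ) 1).indicator (fun _ => ENNReal.ofReal |p.1 - w|) t +
        (Icc (1 : ℝ) 2).indicator (fun _ => ENNReal.ofReal (|p.2 - q.2| / |w|)) t +
        (Icc (2 : ℝ) 3).indicator (fun _ => ENNReal.ofReal |w - q.1|) t := by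
    intro t
    rw [ENNReal.ofReal_add (add_nonneg (n0 t) (n1 t)) (n2 t), ENNReal.ofReal_add (n0 t) (n1 t),
      e0, e1, e2]
  simp only [this]
  rw [lintegral_add_right _ (measurable_const.indicator measurableSet_Icc),
    lintegral_add_right _ (measurable_const.indicator measurableSet_Icc)]
  rw [hint 0 1 _ (by norm_num) (by norm_num) (by norm_num),
    hint 1 2 _ (by norm_num) (by norm_num) (by norm_num),
    hint 2 3 _ (by norm_num) (by norm_num) (by norm_num)]

/-- The Carnot–Carathéodory distance as a real number. -/
def rdist (p q : ℝ × ℝ) : ℝ := (ccDist p q).toReal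

lemma rdist_nonneg (p q : ℝ × ℝ) : 0 ≤ rdist p q := ENNReal.toReal_nonneg

lemma ccDist_ne_top (p q : ℝ × ℝ) : ccDist p q ≠ ⊤ :=
  ne_top_of_le_ne_top ENNReal.ofReal_ne_top (ccDist_le_staircase p q (w := 1) (by simp))

lemma ccDist_eq (p q : ℝ × ℝ) : ccDist p q = ENNReal.ofReal (rdist p q) :=
  (ENNReal.ofReal_toReal (ccDist_ne_top p q)).symm

lemma rdist_le_staircase (p q : ℝ × ℝ) {w : ℝ} (hw : w ≠ 0 ∨ p.2 = q.2) :
    rdist p q ≤ |p.1 - w| + |p.2 - q.2| / |w| + |w - q.1| :=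
  ENNReal.toReal_le_of_le_ofReal (by positivity) (ccDist_le_staircase p q hw)

lemma abs_fst_sub_le_rdist (p q : ℝ × ℝ) : |p.1 - q.1| ≤ rdist p q := by
  rw [← ENNReal.ofReal_le_ofReal_iff (rdist_nonneg p q), ← ccDist_eq]
  refine le_iInf fun γ => le_iInf fun a => le_iInf fun b => le_iInf ?_
  rintro ⟨h, rfl, rfl⟩
  rw [abs_sub_comm]
  exact abs_fst_sub_le_length h

lemma abs_snd_sub_le_rdist (p q : ℝ × ℝ) :
    |p.2 - q.2| ≤ (|p.1| + rdist p q) * rdist p q := by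
  -- The infimum need not be attained, so the curve estimate is applied to every `l` above the
  -- distance, and then `l` decreases to it.
  have key : ∀ l > rdist p q, |p.2 - q.2| ≤ (|p.1| + l) * l := by
    intro l hl
    have h0 : 0 < l := (rdist_nonneg p q).trans_lt hl
    have h1 : ccDist p q < ENNReal.ofReal l := by
      rw [ccDist_eq]; exact (ENNReal.ofReal_lt_ofReal_iff h0).2 hl
    simp only [ccDist, iInf_lt_iff] at h1
    obtain ⟨γ, a, b, ⟨h, rfl, rfl⟩, h2⟩ := h1
    rw [abs_sub_comm]
    exact abs_snd_sub_le_length h h0 h2.le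
  have hc : Filter.Tendsto (fun l : ℝ => (|p.1| + l) * l) (nhdsWithin (rdist p q) (Ioi (rdist p q)))
      (nhds ((|p.1| + rdist p q) * rdist p q)) :=
    (Continuous.tendsto (by fun_prop) _).mono_left nhdsWithin_le_nhds
  exact ge_of_tendsto hc (by filter_upwards [self_mem_nhdsWithin] with l hl using key l hl)

/-- Moving the base point to `q` by `|p.1| ≤ |q.1| + rdist p q` avoids proving symmetry of the
distance, at the price of the factor 2. -/
lemma abs_snd_sub_le_rdist' (p q : ℝ × ℝ) :
    |p.2 - q.2| ≤ (|q.1| + 2 * rdist p q) * rdist p q := by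
  refine (abs_snd_sub_le_rdist p q).trans ?_
  have h1 := abs_fst_sub_le_rdist p q
  have h2 := abs_sub_abs_le_abs_sub p.1 q.1
  have := rdist_nonneg p q
  gcongr ?_ * _
  linarith

lemma rdist_le_div (p q : ℝ × ℝ) (hp : p.1 ≠ 0) :
    rdist p q ≤ |p.1 - q.1| + |p.2 - q.2| / |p.1| := by
  have := rdist_le_staircase p q (Or.inl hp)
  simp only [sub_self, abs_zero] at this
  linarith

/-- At abscissa `w = √|p.2 - q.2|` the vertical leg costs exactly `w`. The two horizontal legs
account for the other two multiples of `w`. -/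
lemma rdist_le_sqrt (p q : ℝ × ℝ) : rdist p q ≤ |p.1| + |q.1| + 3 * √|p.2 - q.2| := by
  set h := √|p.2 - q.2| with hh
  have h0 : 0 ≤ h := Real.sqrt_nonneg _
  have h2 : |p.2 - q.2| = h * h := (Real.mul_self_sqrt (abs_nonneg _)).symm
  have hw : h ≠ 0 ∨ p.2 = q.2 := by
    by_cases hz : h = 0
    · right
      rw [hz] at h2
      have : p.2 - q.2 = 0 := by simpa using h2
      linarith
    · exact Or.inl hz
  have := rdist_le_staircase p q hw
  rw [h2, abs_of_nonneg h0] at this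
  have e1 : h * h / h = h := by
    by_cases hz : h = 0 <;> simp [hz]
  have e2 : |p.1 - h| ≤ |p.1| + h := by simpa [abs_of_nonneg h0] using abs_sub p.1 h
  have e3 : |h - q.1| ≤ h + |q.1| := by simpa [abs_of_nonneg h0] using abs_sub h q.1
  rw [e1] at this
  linarith

lemma setDist_singleton_singularLine (p : ℝ × ℝ) :
    (setDist {p} singularLine).toReal = |p.1| := by
  have h : setDist {p} singularLine = ENNReal.ofReal |p.1| := by
    refine le_antisymm ?_ ?_
    · refine iInf₂_le_of_le p (mem_singleton p) <|
        iInf₂_le_of_le ((0, p.2) : ℝ × ℝ) (show (0 : ℝ) = 0 from rfl) ?_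
      simpa using ccDist_le_staircase p (0, p.2) (w := 0) (Or.inr rfl)
    · refine le_iInf₂ fun p' hp' => le_iInf₂ fun q hq => ?_
      rw [mem_singleton_iff.1 hp', ccDist_eq]
      have := abs_fst_sub_le_rdist p q
      rw [show q.1 = 0 from hq, sub_zero] at this
      exact ENNReal.ofReal_le_ofReal this
  rw [h, ENNReal.toReal_ofReal (abs_nonneg _)]

end Grushin

/-! ### Whitney boxes: adjacency, counting, diameters and colorings -/

namespace Grushin

open Set

namespace WhitneyBox

/-- The side length `2⁻ⁿ` of a box in the horizontal direction. -/
def scale (Q : WhitneyBox) : ℝ := (2 : ℝ) ^ (-Q.n)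

/-- The ordinate of the bottom edge of a box. -/
def bottom (Q : WhitneyBox) : ℝ := Q.k * Q.scale ^ 2

/-- The sign of the abscissas in a box. -/
def sign (Q : WhitneyBox) : ℝ := if Q.right then 1 else -1

lemma scale_pos (Q : WhitneyBox) : 0 < Q.scale := by unfold scale; positivity

lemma scale_sq (Q : WhitneyBox) : Q.scale ^ 2 = (4 : ℝ) ^ (-Q.n) := by
  unfold scale
  rw [← zpow_natCast, ← zpow_mul, mul_comm, zpow_mul]
  norm_num

lemma ext_iff' {Q R : WhitneyBox} : Q = R ↔ Q.right = R.right ∧ Q.n = R.n ∧ Q.k = R.k := by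
  cases Q; cases R; simp

lemma sign_eq_or (Q : WhitneyBox) : Q.sign = 1 ∨ Q.sign = -1 := by
  unfold sign; split_ifs <;> simp

lemma sign_mul_self (Q : WhitneyBox) : Q.sign * Q.sign = 1 := by
  rcases Q.sign_eq_or with h | h <;> rw [h] <;> norm_num

lemma abs_sign (Q : WhitneyBox) : |Q.sign| = 1 := by
  rcases Q.sign_eq_or with h | h <;> rw [h] <;> norm_num

lemma mem_carrier {Q : WhitneyBox} {p : ℝ × ℝ} : p ∈ Q.carrier ↔
    (Q.scale ≤ Q.sign * p.1 ∧ Q.sign * p.1 ≤ 2 * Q.scale) ∧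
      Q.bottom ≤ p.2 ∧ p.2 ≤ Q.bottom + Q.scale ^ 2 := by
  have h2 : (2 : ℝ) ^ (1 - Q.n) = 2 * Q.scale := by
    rw [scale, sub_eq_add_neg, zpow_add₀ (by norm_num)]; simp
  unfold carrier bottom sign
  rw [h2, scale_sq]
  change _ ∧ _ ↔ _
  rw [add_mul, one_mul]
  refine and_congr ?_ Iff.rfl
  split_ifs
  · rw [mem_Icc, one_mul]; rfl
  · rw [mem_Icc]
    change _ ∧ p.1 ≤ -Q.scale ↔ _
    constructor <;> rintro ⟨_, _⟩ <;> constructor <;> linarith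

lemma abs_fst_bounds {Q : WhitneyBox} {p : ℝ × ℝ} (h : p ∈ Q.carrier) :
    Q.scale ≤ |p.1| ∧ |p.1| ≤ 2 * Q.scale := by
  have h1 := (mem_carrier.1 h).1
  have h2 : |Q.sign * p.1| = |p.1| := by rw [abs_mul, abs_sign, one_mul]
  rw [← h2, abs_of_pos (Q.scale_pos.trans_le h1.1)]
  exact h1

/-- The boxes which touch `Q`. -/
def Touches (R Q : WhitneyBox) : Prop := (R.carrier ∩ Q.carrier).Nonempty

lemma Touches.symm {R Q : WhitneyBox} (h : R.Touches Q) : Q.Touches R := by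
  unfold Touches at *; rwa [inter_comm]

lemma Touches.bounds {R Q : WhitneyBox} (h : R.Touches Q) :
    R.scale ≤ 2 * Q.scale ∧ |R.bottom - Q.bottom| ≤ R.scale ^ 2 + Q.scale ^ 2 := by
  obtain ⟨p, hR, hQ⟩ := h
  have h1 := abs_fst_bounds hR
  have h2 := abs_fst_bounds hQ
  have h3 := (mem_carrier.1 hR).2
  have h4 := (mem_carrier.1 hQ).2
  refine ⟨h1.1.trans h2.2, ?_⟩
  rw [abs_le]
  have := sq_nonneg R.scale
  have := sq_nonneg Q.scale
  constructor <;> linarith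

lemma touches_of_bounds {R Q : WhitneyBox} (h0 : R.right = Q.right) (h1 : R.scale ≤ 2 * Q.scale)
    (h2 : Q.scale ≤ 2 * R.scale) (h3 : R.bottom ≤ Q.bottom + Q.scale ^ 2)
    (h4 : Q.bottom ≤ R.bottom + R.scale ^ 2) : R.Touches Q := by
  have hs : R.sign = Q.sign := by unfold sign; rw [h0]
  have e : Q.sign * (Q.sign * max R.scale Q.scale) = max R.scale Q.scale := by
    rw [← mul_assoc, sign_mul_self, one_mul]
  have := R.scale_pos
  have := Q.scale_pos
  -- Two intervals which meet share the larger of their lower ends. This is applied to the absolute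
  -- abscissas and to the ordinates.
  refine ⟨(Q.sign * max R.scale Q.scale, max R.bottom Q.bottom), mem_carrier.2 ?_,
    mem_carrier.2 ?_⟩
  · rw [hs]
    simp only [e]
    exact ⟨⟨le_max_left _ _, max_le (by linarith) h2⟩, le_max_left _ _,
      max_le (by nlinarith) h4⟩
  · simp only [e]
    exact ⟨⟨le_max_right _ _, max_le h1 (by linarith)⟩, le_max_right _ _,
      max_le h3 (by nlinarith)⟩

lemma touches_self (Q : WhitneyBox) : Q.Touches Q := by
  have := Q.scale_pos
  exact touches_of_bounds rfl (by linarith) (by linarith) (by nlinarith) (by nlinarith)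

lemma mem_star {Q : WhitneyBox} {p : ℝ × ℝ} : p ∈ Q.star ↔ ∃ R : WhitneyBox, R.Touches Q ∧ p ∈ R.carrier := by
  simp [star, Touches]

lemma mem_starStar_of {Q R S : WhitneyBox} (hR : R.Touches Q) (hS : S.Touches R) {p : ℝ × ℝ}
    (hp : p ∈ S.carrier) : p ∈ Q.starStar := by
  simp only [starStar, mem_iUnion]
  obtain ⟨x, hx1, hx2⟩ := hS
  exact ⟨S, ⟨x, hx1, mem_star.2 ⟨R, hR, hx2⟩⟩, hp⟩

lemma exists_of_mem_starStar {Q : WhitneyBox} {p : ℝ × ℝ} (hp : p ∈ Q.starStar) :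
    ∃ R S : WhitneyBox, R.Touches Q ∧ S.Touches R ∧ p ∈ S.carrier := by
  simp only [starStar, mem_iUnion] at hp
  obtain ⟨S, ⟨x, hx1, hx2⟩, hp⟩ := hp
  obtain ⟨R, hR, hR'⟩ := mem_star.1 hx2
  exact ⟨R, S, hR, ⟨x, hx1, hR'⟩, hp⟩

/-- `Q` has the scale of the point `p`, and its vertical position up to bounded factors. -/
def Near (p : ℝ × ℝ) (Q : WhitneyBox) : Prop :=
  |p.1| ≤ 8 * Q.scale ∧ Q.scale ≤ 8 * |p.1| ∧ |p.2 - Q.bottom| ≤ 100 * Q.scale ^ 2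

/-- Each of the two touching steps changes the scale by a factor at most 2 and moves the bottom edge
by at most the sum of the squared scales. The vertical offset is therefore at most `16 + 20 + 5 =
41` squared scales; the constants in `Near` are generous. -/
lemma near_of_mem_starStar {Q : WhitneyBox} {p : ℝ × ℝ} (hp : p ∈ Q.starStar) : Near p Q := by
  obtain ⟨R, S, hR, hS, hp⟩ := exists_of_mem_starStar hp
  have h1 := hR.bounds
  have h2 := hR.symm.bounds
  have h3 := hS.bounds
  have h4 := hS.symm.bounds
  have h5 := abs_fst_bounds hp
  have h6 := (mem_carrier.1 hp).2
  have hQ := Q.scale_pos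
  have hR0 := R.scale_pos
  have hS0 := S.scale_pos
  refine ⟨by linarith, by linarith, ?_⟩
  have e1 : R.scale ^ 2 ≤ 4 * Q.scale ^ 2 := by nlinarith
  have e2 : S.scale ^ 2 ≤ 4 * R.scale ^ 2 := by nlinarith
  have h7 := abs_le.1 h1.2
  have h8 := abs_le.1 h3.2
  rw [abs_le]
  constructor <;> nlinarith

/-- A bound for the number of boxes near a point. -/
def nearBound : ℕ := 2 * (9 * 203)

/-- A box is determined by its side, its scale index relative to the dyadic size of `|p.1|`, and its
vertical index relative to `p.2` in units of its own height. Nearness leaves 2, 9 and 203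
possibilities. -/
lemma near_encard_le (p : ℝ × ℝ) : {Q | Near p Q}.encard ≤ nearBound := by
  rcases eq_or_ne p.1 0 with h0 | h0
  · have : {Q | Near p Q} = ∅ := by
      ext Q
      simp only [mem_ofPred_eq, mem_empty_iff_false, iff_false]
      rintro ⟨-, h, -⟩
      rw [h0] at h
      have := Q.scale_pos
      simp at h; linarith
    rw [this]; simp
  set m := Int.log 2 |p.1|
  have hx : 0 < |p.1| := abs_pos.2 h0
  have hm1 : (2 : ℝ) ^ m ≤ |p.1| := by exact_mod_cast Int.zpow_log_le_self (b := 2) (by norm_num) hx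
  have hm2 : |p.1| < (2 : ℝ) ^ (m + 1) := by
    exact_mod_cast Int.lt_zpow_succ_log_self (b := 2) (by norm_num) |p.1|
  let g : WhitneyBox → Bool × ℤ × ℤ := fun Q => (Q.right, Q.n + m, Q.k - ⌊p.2 / Q.scale ^ 2⌋)
  have hg : Function.Injective g := by
    intro Q R h
    simp only [g, Prod.mk.injEq] at h
    obtain ⟨h1, h2, h3⟩ := h
    have hn : Q.n = R.n := by omega
    have hs : Q.scale = R.scale := by unfold scale; rw [hn]
    rw [hs] at h3
    exact ext_iff'.2 ⟨h1, hn, by omega⟩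
  let F : Finset (Bool × ℤ × ℤ) := Finset.univ ×ˢ Finset.Icc (-4) 4 ×ˢ Finset.Icc (-101) 101
  have hF : g '' {Q | Near p Q} ⊆ F := by
    rintro _ ⟨Q, ⟨h1, h2, h3⟩, rfl⟩
    have hs := Q.scale_pos
    have e1 : (2 : ℝ) ^ m ≤ (2 : ℝ) ^ (3 - Q.n) := by
      rw [sub_eq_add_neg, zpow_add₀ (by norm_num)]
      refine (hm1.trans h1).trans (le_of_eq ?_)
      unfold scale; norm_num
    have e2 : (2 : ℝ) ^ (-Q.n) < (2 : ℝ) ^ (m + 4) := by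
      have : (2 : ℝ) ^ (m + 4) = 8 * 2 ^ (m + 1) := by
        rw [zpow_add₀ (by norm_num), zpow_add₀ (by norm_num)]; norm_num; ring
      rw [this]
      unfold scale at h2; linarith
    have e3 := (zpow_le_zpow_iff_right₀ (by norm_num : (1 : ℝ) < 2)).1 e1
    have e4 := (zpow_lt_zpow_iff_right₀ (by norm_num : (1 : ℝ) < 2)).1 e2
    have e5 : |p.2 / Q.scale ^ 2 - Q.k| ≤ 100 := by
      have : p.2 / Q.scale ^ 2 - Q.k = (p.2 - Q.bottom) / Q.scale ^ 2 := by
        unfold bottom; field_simp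
      rw [this, abs_div, abs_of_pos (by positivity : 0 < Q.scale ^ 2), div_le_iff₀ (by positivity)]
      exact h3
    have e6 := Int.floor_le (p.2 / Q.scale ^ 2)
    have e7 := Int.lt_floor_add_one (p.2 / Q.scale ^ 2)
    rw [abs_le] at e5
    have e8 : (Q.k : ℝ) - ⌊p.2 / Q.scale ^ 2⌋ ≤ 101 := by linarith
    have e9 : (-101 : ℝ) ≤ (Q.k : ℝ) - ⌊p.2 / Q.scale ^ 2⌋ := by linarith
    have e8' : Q.k - ⌊p.2 / Q.scale ^ 2⌋ ≤ 101 := by exact_mod_cast e8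
    have e9' : -101 ≤ Q.k - ⌊p.2 / Q.scale ^ 2⌋ := by exact_mod_cast e9
    simp only [F, g, Finset.coe_product, mem_prod, Finset.mem_coe, Finset.mem_univ, Finset.mem_Icc,
      true_and]
    exact ⟨⟨by omega, by omega⟩, e9', e8'⟩
  calc {Q | Near p Q}.encard = (g '' {Q | Near p Q}).encard := (hg.encard_image _).symm
    _ ≤ (F : Set (Bool × ℤ × ℤ)).encard := encard_le_encard hF
    _ = nearBound := by
      rw [encard_coe_eq_coe_finsetCard]
      simp [F, nearBound]

lemma near_finite (p : ℝ × ℝ) : {Q | Near p Q}.Finite :=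
  finite_of_encard_le_coe (near_encard_le p)

/-- A corner of the box. -/
def corner (Q : WhitneyBox) : ℝ × ℝ := (Q.sign * Q.scale, Q.bottom)

/-- Reduces counting the neighbors of a box to counting the boxes near a point. -/
lemma near_corner_of_touches {R Q : WhitneyBox} (h : R.Touches Q) : Near Q.corner R := by
  have h1 := h.bounds
  have h2 := h.symm.bounds
  have hQ := Q.scale_pos
  have hR := R.scale_pos
  have e : |Q.corner.1| = Q.scale := by
    unfold corner; rw [abs_mul, abs_sign, one_mul, abs_of_pos hQ]
  refine ⟨by rw [e]; linarith, by rw [e]; linarith, ?_⟩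
  have : Q.scale ^ 2 ≤ 4 * R.scale ^ 2 := by nlinarith
  refine h2.2.trans ?_
  nlinarith

lemma touches_finite (Q : WhitneyBox) : {R : WhitneyBox | R.Touches Q}.Finite :=
  (near_finite Q.corner).subset fun _ h => near_corner_of_touches h

/-- The finite set of the boxes which touch `Q`. -/
def neighbors (Q : WhitneyBox) : Finset WhitneyBox := (touches_finite Q).toFinset

lemma mem_neighbors {R Q : WhitneyBox} : R ∈ Q.neighbors ↔ R.Touches Q := by simp [neighbors]

lemma card_neighbors_le (Q : WhitneyBox) : Q.neighbors.card ≤ nearBound := by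
  have h : (Q.neighbors : Set WhitneyBox).encard ≤ nearBound :=
    (encard_le_encard fun R hR => near_corner_of_touches (mem_neighbors.1 hR)).trans
      (near_encard_le Q.corner)
  rw [encard_coe_eq_coe_finsetCard] at h
  exact_mod_cast h

lemma card_neighbors_pos (Q : WhitneyBox) : 0 < Q.neighbors.card :=
  Finset.card_pos.2 ⟨Q, mem_neighbors.2 Q.touches_self⟩

/-- The diameter of a box as a real number. -/
def rdiam (Q : WhitneyBox) : ℝ := (diam Q.carrier).toReal

lemma diam_le (Q : WhitneyBox) : diam Q.carrier ≤ ENNReal.ofReal (2 * Q.scale) := by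
  refine iSup₂_le fun p hp => iSup₂_le fun q hq => ?_
  rw [ccDist_eq]
  refine ENNReal.ofReal_le_ofReal ?_
  have hs := Q.scale_pos
  have hp1 := abs_fst_bounds hp
  have hp2 := mem_carrier.1 hp
  have hq2 := mem_carrier.1 hq
  have h0 : p.1 ≠ 0 := by
    intro h; rw [h] at hp1; simp at hp1; linarith
  refine (rdist_le_div p q h0).trans ?_
  have e1 : |p.1 - q.1| ≤ Q.scale := by
    rw [← one_mul |p.1 - q.1|, ← abs_sign Q, ← abs_mul, abs_le, mul_sub]
    constructor <;> linarith
  have e2 : |p.2 - q.2| / |p.1| ≤ Q.scale := by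
    rw [div_le_iff₀ (abs_pos.2 h0)]
    have : |p.2 - q.2| ≤ Q.scale ^ 2 := by rw [abs_le]; constructor <;> linarith
    nlinarith
  linarith

lemma diam_eq (Q : WhitneyBox) : diam Q.carrier = ENNReal.ofReal Q.rdiam :=
  (ENNReal.ofReal_toReal (ne_top_of_le_ne_top ENNReal.ofReal_ne_top Q.diam_le)).symm

lemma rdiam_le (Q : WhitneyBox) : Q.rdiam ≤ 2 * Q.scale :=
  ENNReal.toReal_le_of_le_ofReal (by have := Q.scale_pos; linarith) Q.diam_le

lemma scale_le_rdiam (Q : WhitneyBox) : Q.scale ≤ Q.rdiam := by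
  have hs := Q.scale_pos
  have h0 : 0 ≤ Q.rdiam := ENNReal.toReal_nonneg
  rw [← ENNReal.ofReal_le_ofReal_iff h0, ← diam_eq]
  have hp : Q.corner ∈ Q.carrier := by
    rw [mem_carrier]; unfold corner
    rw [← mul_assoc, sign_mul_self]
    refine ⟨⟨?_, ?_⟩, le_rfl, ?_⟩ <;> nlinarith
  have hq : ((Q.sign * (2 * Q.scale), Q.bottom) : ℝ × ℝ) ∈ Q.carrier := by
    rw [mem_carrier]
    simp only
    rw [← mul_assoc, sign_mul_self]
    refine ⟨⟨?_, ?_⟩, le_rfl, ?_⟩ <;> nlinarith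
  refine le_iSup₂_of_le _ hp (le_iSup₂_of_le _ hq ?_)
  rw [ccDist_eq]
  refine ENNReal.ofReal_le_ofReal ((abs_fst_sub_le_rdist _ _).trans' ?_)
  unfold corner
  simp only
  rw [← mul_sub, abs_mul, abs_sign, abs_sub_comm, abs_of_nonneg] <;> linarith

lemma rdiam_pos (Q : WhitneyBox) : 0 < Q.rdiam := Q.scale_pos.trans_le Q.scale_le_rdiam

/-- The point of the singular line at the height of the bottom edge of the box. -/
def nearestPoint (Q : WhitneyBox) : ℝ × ℝ := (0, Q.bottom)

lemma isNearestPointChoice_nearestPoint : IsNearestPointChoice nearestPoint := by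
  intro Q
  refine ⟨rfl, le_antisymm ?_ ?_⟩
  · have hs := Q.scale_pos
    refine le_trans (b := ENNReal.ofReal Q.scale) ?_ ?_
    · refine iInf₂_le_of_le Q.nearestPoint rfl ?_
      have hp : Q.corner ∈ Q.carrier := by
        rw [mem_carrier]; unfold corner
        rw [← mul_assoc, sign_mul_self]
        refine ⟨⟨?_, ?_⟩, le_rfl, ?_⟩ <;> nlinarith
      refine iInf₂_le_of_le Q.corner hp ?_
      refine (ccDist_le_staircase Q.nearestPoint Q.corner (w := 0) (Or.inr rfl)).trans ?_
      refine ENNReal.ofReal_le_ofReal ?_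
      simp [nearestPoint, corner, abs_mul, abs_sign, abs_of_pos hs]
    · refine le_iInf₂ fun p hp => le_iInf₂ fun q hq => ?_
      rw [ccDist_eq]
      refine ENNReal.ofReal_le_ofReal ?_
      have := abs_fst_sub_le_rdist p q
      rw [show p.1 = 0 from hp, zero_sub, abs_neg] at this
      exact (abs_fst_bounds hq).1.trans this
  · refine le_iInf₂ fun p hp => ?_
    rw [mem_singleton_iff.1 hp]
    exact iInf₂_le_of_le Q.nearestPoint rfl le_rfl

/-- There are colorings which separate boxes of comparable size and position. -/
lemma exists_separating_coloring (T : ℝ) : ∃ (M : ℕ) (K : WhitneyBox → Fin M),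
    ∀ Q R, K Q = K R → Q.scale ≤ T * R.scale → R.scale ≤ T * Q.scale →
      |Q.bottom - R.bottom| ≤ T * Q.scale ^ 2 → Q = R := by
  obtain ⟨a, ha⟩ := pow_unbounded_of_one_lt T (by norm_num : (1 : ℝ) < 2)
  obtain ⟨b, hb⟩ := exists_nat_gt T
  -- The color is the side together with `n` modulo `a + 1` and `k` modulo `b + 1`. Comparable
  -- scales differ in `n` by less than `a`, so equal residues force equal `n`. Then the indices `k`
  -- differ by at most `T < b`, and again equal residues force equality.
  let e := Fintype.equivFin (Bool × ZMod (a + 1) × ZMod (b + 1))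
  refine ⟨_, fun Q => e (Q.right, (Q.n : ZMod (a + 1)), (Q.k : ZMod (b + 1))), ?_⟩
  · intro Q R h h1 h2 h3
    have h := e.injective h
    simp only [Prod.mk.injEq] at h
    obtain ⟨hr, hn, hk⟩ := h
    have key (Q R : WhitneyBox) (h : Q.scale ≤ T * R.scale) : R.n - Q.n < a := by
      have hR := R.scale_pos
      have h4 : Q.scale < 2 ^ a * R.scale := h.trans_lt (by gcongr)
      unfold scale at h4
      rw [← zpow_natCast, ← zpow_add₀ (by norm_num)] at h4
      have := (zpow_lt_zpow_iff_right₀ (by norm_num : (1 : ℝ) < 2)).1 h4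
      omega
    have k1 := key Q R h1
    have k2 := key R Q h2
    rw [ZMod.intCast_eq_intCast_iff_dvd_sub] at hn hk
    have en : R.n - Q.n = 0 :=
      Int.eq_zero_of_abs_lt_dvd hn (by push_cast; rw [abs_lt]; constructor <;> omega)
    have en' : Q.n = R.n := by omega
    have hs : Q.scale = R.scale := by unfold scale; rw [en']
    have hR := R.scale_pos
    have hk' : |(Q.k : ℝ) - R.k| ≤ T := by
      have : Q.bottom - R.bottom = ((Q.k : ℝ) - R.k) * R.scale ^ 2 := by
        unfold bottom; rw [hs]; ring
      rw [this, abs_mul, abs_of_pos (by positivity : 0 < R.scale ^ 2), hs] at h3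
      exact le_of_mul_le_mul_right h3 (by positivity)
    have hk'' : |Q.k - R.k| < (b : ℤ) := by exact_mod_cast hk'.trans_lt hb
    have ek : R.k - Q.k = 0 := by
      refine Int.eq_zero_of_abs_lt_dvd hk ?_
      rw [abs_sub_comm]; push_cast; omega
    exact ext_iff'.2 ⟨hr, en', by omega⟩

/-- Some points of the two boxes have distance at most `2 c` times either scale. Comparing abscissas
bounds the ratio of the scales by `B = 3 + 2 c`. The vertical estimate then gives an offset of at
most `2 B ^ 2 + 1` squared scales, which `B ^ 3` absorbs because `B ≥ 3`. -/
lemma bounds_of_whitneyDist_lt {Q R : WhitneyBox} {c : ℝ} (hc : 0 ≤ c)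
    (h : Q.whitneyDist R < ENNReal.ofReal c) :
    Q.scale ≤ (3 + 2 * c) ^ 3 * R.scale ∧ R.scale ≤ (3 + 2 * c) ^ 3 * Q.scale ∧
      |Q.bottom - R.bottom| ≤ (3 + 2 * c) ^ 3 * Q.scale ^ 2 := by
  have hQ := Q.scale_pos
  have hR := R.scale_pos
  have hm : min (diam Q.carrier) (diam R.carrier) = ENNReal.ofReal (min Q.rdiam R.rdiam) := by
    rw [diam_eq, diam_eq, ENNReal.ofReal_min]
  have hm0 : 0 < min Q.rdiam R.rdiam := lt_min Q.rdiam_pos R.rdiam_pos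
  unfold whitneyDist at h
  rw [hm, ENNReal.div_lt_iff (Or.inl (by simpa using hm0)) (Or.inl ENNReal.ofReal_ne_top),
    ← ENNReal.ofReal_mul hc] at h
  simp only [setDist, iInf_lt_iff] at h
  obtain ⟨p, hp, q, hq, h⟩ := h
  rw [ccDist_eq, ENNReal.ofReal_lt_ofReal_iff_of_nonneg (rdist_nonneg _ _)] at h
  set D := rdist p q
  have hD0 : 0 ≤ D := rdist_nonneg p q
  have hDQ : D ≤ 2 * c * Q.scale := by
    have : min Q.rdiam R.rdiam ≤ 2 * Q.scale := (min_le_left _ _).trans Q.rdiam_le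
    nlinarith
  have hDR : D ≤ 2 * c * R.scale := by
    have : min Q.rdiam R.rdiam ≤ 2 * R.scale := (min_le_right _ _).trans R.rdiam_le
    nlinarith
  have h1 := abs_fst_bounds hp
  have h2 := abs_fst_bounds hq
  have h3 := abs_fst_sub_le_rdist p q
  have h4 := abs_sub_abs_le_abs_sub p.1 q.1
  have h5 := abs_sub_abs_le_abs_sub q.1 p.1
  rw [abs_sub_comm] at h5
  set B := 3 + 2 * c with hB
  have hB3 : 3 ≤ B := by linarith
  have g1 : Q.scale ≤ B * R.scale := by nlinarith
  have g2 : R.scale ≤ B * Q.scale := by nlinarith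
  have g3 : B ≤ B ^ 3 := by nlinarith [sq_nonneg B]
  refine ⟨g1.trans (by gcongr), g2.trans (by gcongr), ?_⟩
  have h6 := abs_snd_sub_le_rdist p q
  have g4 : (|p.1| + D) * D ≤ (B * Q.scale) * (B * Q.scale) := by
    gcongr <;> nlinarith
  have h7 := (mem_carrier.1 hp).2
  have h8 := (mem_carrier.1 hq).2
  have h9 := abs_le.1 (h6.trans g4)
  have g5 : R.scale ^ 2 ≤ (B * Q.scale) ^ 2 := by gcongr
  have g6 : Q.scale ^ 2 * (2 * B ^ 2 + 1) ≤ Q.scale ^ 2 * B ^ 3 := by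
    gcongr; nlinarith [sq_nonneg B]
  rw [abs_le]
  constructor <;> nlinarith

end WhitneyBox

end Grushin

/-! ### The Lipschitz partition of unity -/

namespace Grushin

open Set

namespace WhitneyBox

/-- A ramp from `0` to `1` around `1`. -/
def rampX (t : ℝ) : ℝ := unitClamp (2 * t - 3 / 2)

/-- A ramp from `0` to `1` around `0`. -/
def rampY (t : ℝ) : ℝ := unitClamp (2 * t + 1 / 2)

/-- A bump function for `[1, 2]`. -/
def bumpX (t : ℝ) : ℝ := rampX t - rampX (t / 2)

/-- A bump function for `[0, 1]`. -/
def bumpY (t : ℝ) : ℝ := rampY t - rampY (t - 1)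

lemma rampX_of_le {t : ℝ} (h : t ≤ 3 / 4) : rampX t = 0 := unitClamp_of_le (by linarith)

lemma rampX_of_ge {t : ℝ} (h : 5 / 4 ≤ t) : rampX t = 1 := unitClamp_of_ge (by linarith)

lemma rampY_of_le {t : ℝ} (h : t ≤ -1 / 4) : rampY t = 0 := unitClamp_of_le (by linarith)

lemma rampY_of_ge {t : ℝ} (h : 1 / 4 ≤ t) : rampY t = 1 := unitClamp_of_ge (by linarith)

lemma bumpX_nonneg (t : ℝ) : 0 ≤ bumpX t := by
  unfold bumpX
  rcases le_total t 0 with h | h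
  · rw [rampX_of_le (by linarith), rampX_of_le (by linarith)]; simp
  · exact sub_nonneg.2 (unitClamp_mono (by linarith))

lemma bumpX_le_one (t : ℝ) : bumpX t ≤ 1 := by
  have h1 : rampX t ≤ 1 := unitClamp_le_one _
  have h2 : 0 ≤ rampX (t / 2) := unitClamp_nonneg _
  unfold bumpX; linarith

lemma bumpY_nonneg (t : ℝ) : 0 ≤ bumpY t := sub_nonneg.2 (unitClamp_mono (by linarith))

lemma bumpY_le_one (t : ℝ) : bumpY t ≤ 1 := by
  have h1 : rampY t ≤ 1 := unitClamp_le_one _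
  have h2 : 0 ≤ rampY (t - 1) := unitClamp_nonneg _
  unfold bumpY; linarith

lemma bumpX_ne_zero {t : ℝ} (h : bumpX t ≠ 0) : 3 / 4 < t ∧ t < 5 / 2 := by
  unfold bumpX at h
  constructor
  · by_contra! h'
    refine h ?_
    rw [rampX_of_le h']
    have h2 : rampX (t / 2) = 0 := by
      rcases le_total t 0 with h0 | h0 <;> exact rampX_of_le (by linarith)
    rw [h2, sub_zero]
  · by_contra! h'
    exact h (by rw [rampX_of_ge (by linarith), rampX_of_ge (by linarith), sub_self])

lemma bumpY_ne_zero {t : ℝ} (h : bumpY t ≠ 0) : -1 / 4 < t ∧ t < 5 / 4 := by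
  unfold bumpY at h
  constructor
  · by_contra! h'
    exact h (by rw [rampY_of_le h', rampY_of_le (by linarith), sub_zero])
  · by_contra! h'
    exact h (by rw [rampY_of_ge (by linarith), rampY_of_ge (by linarith), sub_self])

lemma half_le_bumpX {t : ℝ} (h1 : 1 ≤ t) (h2 : t ≤ 2) : 1 / 2 ≤ bumpX t := by
  unfold bumpX
  have a : rampX 1 = 1 / 2 := by unfold rampX; rw [unitClamp_of_mem] <;> norm_num
  rcases le_total t (5 / 4) with h | h
  · rw [rampX_of_le (by linarith : t / 2 ≤ 3 / 4), ← a, sub_zero]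
    exact unitClamp_mono (by linarith)
  · have b : rampX (t / 2) ≤ rampX 1 := unitClamp_mono (by linarith)
    rw [rampX_of_ge h]
    linarith

lemma half_le_bumpY {t : ℝ} (h1 : 0 ≤ t) (h2 : t ≤ 1) : 1 / 2 ≤ bumpY t := by
  unfold bumpY
  have a : rampY 0 = 1 / 2 := by unfold rampY; rw [unitClamp_of_mem] <;> norm_num
  rcases le_total t (1 / 4) with h | h
  · rw [rampY_of_le (by linarith : t - 1 ≤ -1 / 4), ← a, sub_zero]
    exact unitClamp_mono (by linarith)
  · have b : rampY (t - 1) ≤ rampY 0 := unitClamp_mono (by linarith)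
    rw [rampY_of_ge h]
    linarith

lemma abs_rampX_sub_le (s t : ℝ) : |rampX s - rampX t| ≤ 2 * |s - t| := by
  refine (abs_unitClamp_sub_le _ _).trans (le_of_eq ?_)
  rw [← abs_two (α := ℝ), ← abs_mul, abs_two]; congr 1; ring

lemma abs_rampY_sub_le (s t : ℝ) : |rampY s - rampY t| ≤ 2 * |s - t| := by
  refine (abs_unitClamp_sub_le _ _).trans (le_of_eq ?_)
  rw [← abs_two (α := ℝ), ← abs_mul, abs_two]; congr 1; ring

lemma abs_bumpX_sub_le (s t : ℝ) : |bumpX s - bumpX t| ≤ 3 * |s - t| := by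
  have h1 := abs_rampX_sub_le s t
  have h2 := abs_rampX_sub_le (s / 2) (t / 2)
  rw [← sub_div, abs_div, abs_two] at h2
  have : bumpX s - bumpX t = (rampX s - rampX t) - (rampX (s / 2) - rampX (t / 2)) := by
    unfold bumpX; ring
  rw [this]
  refine (abs_sub _ _).trans ?_
  linarith

lemma abs_bumpY_sub_le (s t : ℝ) : |bumpY s - bumpY t| ≤ 4 * |s - t| := by
  have h1 := abs_rampY_sub_le s t
  have h2 := abs_rampY_sub_le (s - 1) (t - 1)
  rw [sub_sub_sub_cancel_right] at h2
  have : bumpY s - bumpY t = (rampY s - rampY t) - (rampY (s - 1) - rampY (t - 1)) := by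
    unfold bumpY; ring
  rw [this]
  refine (abs_sub _ _).trans ?_
  linarith

/-- A Lipschitz bump function adapted to the box. These functions form a partition of unity. -/
def bump (Q : WhitneyBox) (p : ℝ × ℝ) : ℝ :=
  bumpX (Q.sign * p.1 / Q.scale) * bumpY (p.2 / Q.scale ^ 2 - Q.k)

lemma bump_nonneg (Q : WhitneyBox) (p : ℝ × ℝ) : 0 ≤ Q.bump p :=
  mul_nonneg (bumpX_nonneg _) (bumpY_nonneg _)

lemma bump_le_one (Q : WhitneyBox) (p : ℝ × ℝ) : Q.bump p ≤ 1 :=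
  mul_le_one₀ (bumpX_le_one _) (bumpY_nonneg _) (bumpY_le_one _)

lemma quarter_le_bump {Q : WhitneyBox} {p : ℝ × ℝ} (h : p ∈ Q.carrier) : 1 / 4 ≤ Q.bump p := by
  have hs := Q.scale_pos
  obtain ⟨⟨h1, h2⟩, h3, h4⟩ := mem_carrier.1 h
  have e1 : 1 / 2 ≤ bumpX (Q.sign * p.1 / Q.scale) := by
    refine half_le_bumpX ?_ ?_
    · rwa [le_div_iff₀ hs, one_mul]
    · rwa [div_le_iff₀ hs]
  have e2 : 1 / 2 ≤ bumpY (p.2 / Q.scale ^ 2 - Q.k) := by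
    have : p.2 / Q.scale ^ 2 - Q.k = (p.2 - Q.bottom) / Q.scale ^ 2 := by
      unfold bottom; field_simp
    rw [this]
    refine half_le_bumpY ?_ ?_
    · apply div_nonneg <;> [linarith; positivity]
    · rw [div_le_iff₀ (by positivity)]; linarith
  unfold bump
  nlinarith

lemma bump_ne_zero {Q : WhitneyBox} {p : ℝ × ℝ} (h : Q.bump p ≠ 0) :
    (3 / 4 * Q.scale < Q.sign * p.1 ∧ Q.sign * p.1 < 5 / 2 * Q.scale) ∧
    (Q.k - 1 / 4) * Q.scale ^ 2 < p.2 ∧ p.2 < (Q.k + 5 / 4) * Q.scale ^ 2 := by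
  have hs := Q.scale_pos
  unfold bump at h
  obtain ⟨h1, h2⟩ := bumpX_ne_zero (left_ne_zero_of_mul h)
  obtain ⟨h3, h4⟩ := bumpY_ne_zero (right_ne_zero_of_mul h)
  rw [lt_div_iff₀ hs] at h1
  rw [div_lt_iff₀ hs] at h2
  have h3' : (Q.k - 1 / 4) < p.2 / Q.scale ^ 2 := by linarith
  have h4' : p.2 / Q.scale ^ 2 < Q.k + 5 / 4 := by linarith
  rw [lt_div_iff₀ (by positivity)] at h3'
  rw [div_lt_iff₀ (by positivity)] at h4'
  exact ⟨⟨h1, h2⟩, h3', h4'⟩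

/-- The support of the bump reaches only into the columns of half, equal and double scale. In each
column the box containing the point is found by rounding down its height, and the overhang of a
quarter of the height is small enough for this box to touch `Q`. -/
lemma exists_touches_of_bump_ne_zero {Q : WhitneyBox} {p : ℝ × ℝ} (h : Q.bump p ≠ 0) :
    ∃ R : WhitneyBox, R.Touches Q ∧ p ∈ R.carrier := by
  have hs := Q.scale_pos
  obtain ⟨⟨h1, h2⟩, h3, h4⟩ := bump_ne_zero h
  -- the box of a given scale which contains the point, with the constraints on its position
  have key (m : ℤ) (t : ℝ) (ht : t = (2 : ℝ) ^ (-m)) (ht1 : t ≤ 2 * Q.scale)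
      (ht2 : Q.scale ≤ 2 * t) (h5 : t ≤ Q.sign * p.1) (h6 : Q.sign * p.1 ≤ 2 * t)
      (h7 : (⌊p.2 / t ^ 2⌋ : ℝ) * t ^ 2 ≤ Q.bottom + Q.scale ^ 2)
      (h8 : Q.bottom ≤ (⌊p.2 / t ^ 2⌋ : ℝ) * t ^ 2 + t ^ 2) :
      ∃ R : WhitneyBox, R.Touches Q ∧ p ∈ R.carrier := by
    have ht0 : 0 < t := by linarith
    refine ⟨⟨Q.right, m, ⌊p.2 / t ^ 2⌋⟩, ?_⟩
    set R : WhitneyBox := ⟨Q.right, m, ⌊p.2 / t ^ 2⌋⟩ with hR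
    have e1 : R.scale = t := ht.symm
    have e2 : R.bottom = (⌊p.2 / t ^ 2⌋ : ℝ) * t ^ 2 := by unfold bottom; rw [e1]
    have e3 : R.sign = Q.sign := rfl
    have f1 := Int.floor_le (p.2 / t ^ 2)
    have f2 := Int.lt_floor_add_one (p.2 / t ^ 2)
    rw [le_div_iff₀ (by positivity)] at f1
    rw [div_lt_iff₀ (by positivity)] at f2
    refine ⟨touches_of_bounds rfl (by rw [e1]; exact ht1) (by rw [e1]; exact ht2)
      (by rw [e2]; exact h7) (by rw [e1, e2]; exact h8), mem_carrier.2 ?_⟩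
    rw [e1, e2, e3]
    exact ⟨⟨h5, h6⟩, f1, by linarith⟩
  have hb : Q.bottom = Q.k * Q.scale ^ 2 := rfl
  rcases lt_or_ge (Q.sign * p.1) Q.scale with hx | hx
  · have e : Q.scale / 2 = (2 : ℝ) ^ (-(Q.n + 1)) := by
      unfold scale; rw [neg_add, zpow_add₀ (by norm_num)]; norm_num; ring
    have f1 := Int.floor_le (p.2 / (Q.scale / 2) ^ 2)
    have f2 := Int.lt_floor_add_one (p.2 / (Q.scale / 2) ^ 2)
    -- Boxes of half the scale are a quarter as high, so the overhang is exactly one such box. The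
    -- admissible indices run from `4 k - 1` to `4 k + 4`, and these are the boxes which touch `Q`.
    have g1 : p.2 / (Q.scale / 2) ^ 2 < 4 * Q.k + 5 := by
      rw [div_lt_iff₀ (by positivity)]; linarith
    have g2 : 4 * Q.k - 1 < p.2 / (Q.scale / 2) ^ 2 := by
      rw [lt_div_iff₀ (by positivity)]; linarith
    have i1 : ⌊p.2 / (Q.scale / 2) ^ 2⌋ < 4 * Q.k + 5 := by
      exact_mod_cast f1.trans_lt g1
    have i2 : 4 * Q.k - 1 < ⌊p.2 / (Q.scale / 2) ^ 2⌋ + 1 := by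
      exact_mod_cast g2.trans f2
    have i1' : (⌊p.2 / (Q.scale / 2) ^ 2⌋ : ℝ) ≤ 4 * Q.k + 4 := by
      have : ⌊p.2 / (Q.scale / 2) ^ 2⌋ ≤ 4 * Q.k + 4 := by omega
      exact_mod_cast this
    have i2' : (4 * Q.k : ℝ) ≤ ⌊p.2 / (Q.scale / 2) ^ 2⌋ + 1 := by
      have : 4 * Q.k ≤ ⌊p.2 / (Q.scale / 2) ^ 2⌋ + 1 := by omega
      exact_mod_cast this
    exact key (Q.n + 1) _ e (by linarith) (by linarith) (by linarith) (by linarith)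
      (by rw [hb]; nlinarith [sq_nonneg Q.scale]) (by rw [hb]; nlinarith [sq_nonneg Q.scale])
  rcases le_or_gt (Q.sign * p.1) (2 * Q.scale) with hx' | hx'
  · have f1 := Int.floor_le (p.2 / Q.scale ^ 2)
    have f2 := Int.lt_floor_add_one (p.2 / Q.scale ^ 2)
    have g1 : p.2 / Q.scale ^ 2 < Q.k + 2 := by
      rw [div_lt_iff₀ (by positivity)]; nlinarith [sq_nonneg Q.scale]
    have g2 : Q.k - 1 < p.2 / Q.scale ^ 2 := by
      rw [lt_div_iff₀ (by positivity)]; nlinarith [sq_nonneg Q.scale]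
    have i1 : ⌊p.2 / Q.scale ^ 2⌋ < Q.k + 2 := by
      exact_mod_cast f1.trans_lt g1
    have i2 : Q.k - 1 < ⌊p.2 / Q.scale ^ 2⌋ + 1 := by
      exact_mod_cast g2.trans f2
    have i1' : (⌊p.2 / Q.scale ^ 2⌋ : ℝ) ≤ Q.k + 1 := by
      have : ⌊p.2 / Q.scale ^ 2⌋ ≤ Q.k + 1 := by omega
      exact_mod_cast this
    have i2' : (Q.k : ℝ) ≤ ⌊p.2 / Q.scale ^ 2⌋ + 1 := by
      have : Q.k ≤ ⌊p.2 / Q.scale ^ 2⌋ + 1 := by omega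
      exact_mod_cast this
    exact key Q.n Q.scale rfl (by linarith) (by linarith) hx hx'
      (by rw [hb]; nlinarith [sq_nonneg Q.scale]) (by rw [hb]; nlinarith [sq_nonneg Q.scale])
  · have e : 2 * Q.scale = (2 : ℝ) ^ (-(Q.n - 1)) := by
      unfold scale; rw [neg_sub, sub_eq_add_neg, zpow_add₀ (by norm_num)]; norm_num
    have f1 := Int.floor_le (p.2 / (2 * Q.scale) ^ 2)
    have f2 := Int.lt_floor_add_one (p.2 / (2 * Q.scale) ^ 2)
    have g1 : 4 * (p.2 / (2 * Q.scale) ^ 2) < Q.k + 2 := by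
      rw [mul_pow, ← mul_div_assoc, div_lt_iff₀ (by positivity)]; nlinarith [sq_nonneg Q.scale]
    have g2 : Q.k - 1 < 4 * (p.2 / (2 * Q.scale) ^ 2) := by
      rw [mul_pow, ← mul_div_assoc, lt_div_iff₀ (by positivity)]; nlinarith [sq_nonneg Q.scale]
    set j := ⌊p.2 / (2 * Q.scale) ^ 2⌋ with hj
    have i1 : 4 * j < Q.k + 2 := by
      have : (4 * j : ℝ) < Q.k + 2 := by linarith
      exact_mod_cast this
    have i2 : Q.k - 1 < 4 * (j + 1) := by
      have : (Q.k - 1 : ℝ) < 4 * (j + 1) := by linarith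
      exact_mod_cast this
    have i1' : (4 * j : ℝ) ≤ Q.k + 1 := by
      have : 4 * j ≤ Q.k + 1 := by omega
      exact_mod_cast this
    have i2' : (Q.k : ℝ) ≤ 4 * (j + 1) := by
      have : Q.k ≤ 4 * (j + 1) := by omega
      exact_mod_cast this
    exact key (Q.n - 1) _ e (by linarith) (by linarith) (by linarith) (by linarith)
      (by rw [hb, ← hj]; nlinarith [sq_nonneg Q.scale])
      (by rw [hb, ← hj]; nlinarith [sq_nonneg Q.scale])

/-- At distance at least `scale` the bound is trivial. Otherwise this is the product rule, with the
vertical difference multiplied by the horizontal factor at `q`. It matters only when that factor is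
nonzero, so `|q.1| ≤ 5 / 2 * scale`, and then vertical displacement is at most `9 / 2 * scale` times
the distance. -/
lemma bump_sub_le (Q : WhitneyBox) (p q : ℝ × ℝ) :
    |Q.bump p - Q.bump q| ≤ 21 * (rdist p q / Q.scale) := by
  have hs := Q.scale_pos
  have hD := rdist_nonneg p q
  set D := rdist p q
  rcases le_total Q.scale D with h | h
  · have h1 : |Q.bump p - Q.bump q| ≤ 1 := by
      have := bump_nonneg Q p
      have := bump_nonneg Q q
      have := bump_le_one Q p
      have := bump_le_one Q q
      rw [abs_le]; constructor <;> linarith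
    have h2 : 1 ≤ D / Q.scale := by rwa [le_div_iff₀ hs, one_mul]
    linarith
  set a := bumpX (Q.sign * p.1 / Q.scale) with ha
  set a' := bumpX (Q.sign * q.1 / Q.scale) with ha'
  set b := bumpY (p.2 / Q.scale ^ 2 - Q.k) with hb
  set b' := bumpY (q.2 / Q.scale ^ 2 - Q.k) with hb'
  have e1 : |a - a'| ≤ 3 * (D / Q.scale) := by
    refine (abs_bumpX_sub_le _ _).trans ?_
    rw [← sub_div, ← mul_sub, abs_div, abs_mul, abs_sign, one_mul, abs_of_pos hs]
    have := abs_fst_sub_le_rdist p q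
    gcongr
  have e2 : a' * |b - b'| ≤ 18 * (D / Q.scale) := by
    by_cases h0 : a' = 0
    · rw [h0, zero_mul]; positivity
    have h1 := bumpX_ne_zero h0
    rw [lt_div_iff₀ hs, div_lt_iff₀ hs] at h1
    have h2 : |q.1| ≤ 5 / 2 * Q.scale := by
      have : |q.1| = |Q.sign * q.1| := by rw [abs_mul, abs_sign, one_mul]
      rw [this, abs_of_pos (by linarith)]; exact h1.2.le
    have h3 := abs_snd_sub_le_rdist' p q
    have h4 : |b - b'| ≤ 18 * (D / Q.scale) := by
      refine (abs_bumpY_sub_le _ _).trans ?_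
      rw [sub_sub_sub_cancel_right, ← sub_div, abs_div, abs_of_pos (by positivity : 0 < Q.scale ^ 2)]
      have h5 : |p.2 - q.2| ≤ (9 / 2 * Q.scale) * D := by
        refine h3.trans ?_
        gcongr; linarith
      calc 4 * (|p.2 - q.2| / Q.scale ^ 2) ≤ 4 * ((9 / 2 * Q.scale) * D / Q.scale ^ 2) := by gcongr
        _ = 18 * (D / Q.scale) := by field_simp; ring
    calc a' * |b - b'| ≤ 1 * |b - b'| := by gcongr; exact bumpX_le_one _
      _ ≤ _ := by rw [one_mul]; exact h4
  have : Q.bump p - Q.bump q = (a - a') * b + a' * (b - b') := by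
    unfold bump; rw [← ha, ← ha', ← hb, ← hb']; ring
  rw [this]
  refine (abs_add_le _ _).trans ?_
  rw [abs_mul, abs_mul, abs_of_nonneg (bumpY_nonneg _ : 0 ≤ b), abs_of_nonneg (bumpX_nonneg _ : 0 ≤ a')]
  have : |a - a'| * b ≤ |a - a'| * 1 := by gcongr; exact bumpY_le_one _
  linarith

/-- Both factors are differences of consecutive ramps, so the sums over heights (translations) and
over scales (dilations by 2) telescope. Three scales and three heights per scale contain all boxes
whose bump is nonzero at the point. -/
lemma exists_finset_sum_bump {p : ℝ × ℝ} (hp : p.1 ≠ 0) :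
    ∃ F : Finset WhitneyBox, (∀ Q, Q.bump p ≠ 0 → Q ∈ F) ∧ ∑ Q ∈ F, Q.bump p = 1 := by
  set m := -Int.log 2 |p.1|
  have hx : 0 < |p.1| := abs_pos.2 hp
  have hm : (2 : ℝ) ^ m * 2 ^ (-m) = 1 := by
    rw [← zpow_add₀ (by norm_num)]; simp
  have hm1 : (2 : ℝ) ^ (-m) ≤ |p.1| := by
    rw [neg_neg]
    exact_mod_cast Int.zpow_log_le_self (b := 2) (by norm_num) hx
  have hm2 : |p.1| < 2 * (2 : ℝ) ^ (-m) := by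
    have : |p.1| < (2 : ℝ) ^ (-m + 1) := by
      rw [neg_neg]
      exact_mod_cast Int.lt_zpow_succ_log_self (b := 2) (by norm_num) |p.1|
    rw [zpow_add₀ (by norm_num)] at this
    norm_num at this ⊢; linarith
  set σ : Bool := decide (0 < p.1)
  have hσ (n k : ℤ) : (WhitneyBox.mk σ n k).sign * p.1 = |p.1| := by
    unfold sign
    rcases lt_or_gt_of_ne hp with h | h
    · simp [σ, not_lt.2 h.le, abs_of_neg h]
    · simp [σ, h, abs_of_pos h]
  let Y : ℤ → ℝ := fun n => p.2 / ((2 : ℝ) ^ (-n)) ^ 2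
  let g : ℕ × ℕ → WhitneyBox := fun ij => ⟨σ, m - 1 + ij.1, ⌊Y (m - 1 + ij.1)⌋ - 1 + ij.2⟩
  have hg : Function.Injective g := by
    rintro ⟨i, j⟩ ⟨i', j'⟩ h
    simp only [g, WhitneyBox.mk.injEq, true_and] at h
    have h1 : i = i' := by omega
    subst h1
    have h2 : j = j' := by omega
    rw [h2]
  refine ⟨(Finset.range 3 ×ˢ Finset.range 3).map ⟨g, hg⟩, ?_, ?_⟩
  · rintro ⟨τ, n, k⟩ hQ
    obtain ⟨⟨h1, h2⟩, h3, h4⟩ := bump_ne_zero hQ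
    have hs := scale_pos ⟨τ, n, k⟩
    have hτ : τ = σ := by
      rcases lt_or_gt_of_ne hp with h | h
      · cases τ
        · simp [σ, not_lt.2 h.le]
        · simp [sign] at h1; linarith
      · cases τ
        · simp [sign] at h1; linarith
        · simp [σ, h]
    subst hτ
    rw [hσ] at h1 h2
    change 3 / 4 * (2 : ℝ) ^ (-n) < |p.1| at h1
    change |p.1| < 5 / 2 * (2 : ℝ) ^ (-n) at h2
    change (k - 1 / 4) * ((2 : ℝ) ^ (-n)) ^ 2 < p.2 at h3
    change p.2 < (k + 5 / 4) * ((2 : ℝ) ^ (-n)) ^ 2 at h4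
    have hn1 : m - 2 < n := by
      have : (2 : ℝ) ^ (-n) < 2 ^ (-m + 2) := by
        rw [zpow_add₀ (by norm_num)]; norm_num at h1 hm2 ⊢; linarith
      have := (zpow_lt_zpow_iff_right₀ (by norm_num : (1 : ℝ) < 2)).1 this
      omega
    have hn2 : n < m + 2 := by
      have : (2 : ℝ) ^ (-m) < 2 ^ (-n + 2) := by
        rw [zpow_add₀ (by norm_num)]; norm_num at h2 hm1 ⊢; linarith
      have := (zpow_lt_zpow_iff_right₀ (by norm_num : (1 : ℝ) < 2)).1 this
      omega
    rw [← lt_div_iff₀ (by positivity)] at h3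
    rw [← div_lt_iff₀ (by positivity)] at h4
    have f1 := Int.floor_le (Y n)
    have f2 := Int.lt_floor_add_one (Y n)
    have k1 : k < ⌊Y n⌋ + 2 := by
      have : (k : ℝ) < ⌊Y n⌋ + 2 := by linarith
      exact_mod_cast this
    have k2 : ⌊Y n⌋ < k + 2 := by
      have : (⌊Y n⌋ : ℝ) < k + 2 := by linarith
      exact_mod_cast this
    rw [Finset.mem_map]
    have en : m - 1 + ((n - m + 1).toNat : ℤ) = n := by omega
    refine ⟨((n - m + 1).toNat, (k - ⌊Y n⌋ + 1).toNat), ?_, ?_⟩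
    · simp only [Finset.mem_product, Finset.mem_range]
      constructor <;> omega
    · simp only [Function.Embedding.coeFn_mk, g, en, WhitneyBox.mk.injEq, true_and]
      omega
  · rw [Finset.sum_map, Finset.sum_product]
    have hv (i j : ℕ) : bump (g (i, j)) p = bumpX (|p.1| / 2 ^ (-(m - 1 + i : ℤ))) *
        bumpY (Y (m - 1 + i) - ⌊Y (m - 1 + i)⌋ + 1 - j) := by
      unfold bump
      rw [show (g (i, j)).sign * p.1 = |p.1| from hσ _ _]
      congr 2
      simp only [g]
      push_cast
      simp only [Y, scale]
      ring
    have hY (y : ℝ) : ∑ j ∈ Finset.range 3, bumpY (y - ⌊y⌋ + 1 - j) = 1 := by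
      have f1 := Int.floor_le y
      have f2 := Int.lt_floor_add_one y
      have r1 : rampY (y - ⌊y⌋ + 1) = 1 := rampY_of_ge (by linarith)
      have r2 : rampY (y - ⌊y⌋ + 1 - 1 - 1 - 1) = 0 := rampY_of_le (by linarith)
      have e2 : y - ⌊y⌋ + 1 - 2 = y - ⌊y⌋ + 1 - 1 - 1 := by ring
      simp only [Finset.sum_range_succ, Finset.sum_range_zero, bumpY]
      push_cast
      rw [sub_zero, e2, r1, r2]; ring
    simp only [Function.Embedding.coeFn_mk, hv, ← Finset.mul_sum, hY, mul_one]
    set t := |p.1| / 2 ^ (-m) with ht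
    have ht1 : 1 ≤ t := by rwa [ht, le_div_iff₀ (by positivity), one_mul]
    have ht2 : t < 2 := by rwa [ht, div_lt_iff₀ (by positivity)]
    have e0 : |p.1| / 2 ^ (-(m - 1 + (0 : ℕ) : ℤ)) = t / 2 := by
      rw [show -(m - 1 + (0 : ℕ) : ℤ) = -m + 1 by push_cast; ring, zpow_add₀ (by norm_num), ht,
        zpow_one, div_div]
    have e1 : |p.1| / 2 ^ (-(m - 1 + (1 : ℕ) : ℤ)) = t := by
      rw [show -(m - 1 + (1 : ℕ) : ℤ) = -m by push_cast; ring]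
    have e2 : |p.1| / 2 ^ (-(m - 1 + (2 : ℕ) : ℤ)) = 2 * t := by
      rw [show -(m - 1 + (2 : ℕ) : ℤ) = -m - 1 by push_cast; ring, zpow_sub₀ (by norm_num), ht,
        zpow_one, div_div_eq_mul_div, mul_comm |p.1|, mul_div_assoc]
    have r1 : rampX (2 * t) = 1 := rampX_of_ge (by linarith)
    have r2 : rampX (t / 2 / 2) = 0 := rampX_of_le (by linarith)
    simp only [Finset.sum_range_succ, Finset.sum_range_zero, e0, e1, e2]
    unfold bumpX
    rw [r1, r2, mul_div_cancel_left₀ t (two_ne_zero)]; ring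

lemma bump_eq_zero_of_fst_eq_zero (Q : WhitneyBox) {p : ℝ × ℝ} (hp : p.1 = 0) : Q.bump p = 0 := by
  by_contra h
  have h1 := (bump_ne_zero h).1.1
  have := Q.scale_pos
  rw [hp, mul_zero] at h1
  linarith

/-- The average of the bump functions of the boxes which touch `Q`, each of them being distributed
evenly among its neighbors. -/
def cutoff (Q : WhitneyBox) (p : ℝ × ℝ) : ℝ :=
  ∑ R ∈ Q.neighbors, R.bump p / R.neighbors.card

lemma cutoff_nonneg (Q : WhitneyBox) (p : ℝ × ℝ) : 0 ≤ Q.cutoff p :=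
  Finset.sum_nonneg fun R _ => div_nonneg (R.bump_nonneg p) (Nat.cast_nonneg _)

lemma exists_of_cutoff_ne_zero {Q : WhitneyBox} {p : ℝ × ℝ} (h : Q.cutoff p ≠ 0) :
    ∃ R : WhitneyBox, R.Touches Q ∧ R.bump p ≠ 0 := by
  obtain ⟨R, hR, h⟩ := Finset.exists_ne_zero_of_sum_ne_zero h
  exact ⟨R, mem_neighbors.1 hR, fun h0 => h (by rw [h0, zero_div])⟩

lemma mem_starStar_of_cutoff_ne_zero {Q : WhitneyBox} {p : ℝ × ℝ} (h : Q.cutoff p ≠ 0) :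
    p ∈ Q.starStar := by
  obtain ⟨R, hR, h⟩ := exists_of_cutoff_ne_zero h
  obtain ⟨S, hS, hp⟩ := exists_touches_of_bump_ne_zero h
  exact mem_starStar_of hR hS hp

/-- Exchanging the sums, each bump occurs once for each neighbor of its box with weight one over
their number, so the total is the sum of the bumps. -/
lemma finsum_cutoff {p : ℝ × ℝ} (hp : p.1 ≠ 0) : ∑ᶠ Q, cutoff Q p = 1 := by
  classical
  obtain ⟨F, hF, hs⟩ := exists_finset_sum_bump hp
  have h1 : Function.support (fun Q => cutoff Q p) ⊆ (F.biUnion neighbors : Finset WhitneyBox) := by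
    intro Q hQ
    obtain ⟨R, hR, h⟩ := exists_of_cutoff_ne_zero hQ
    exact Finset.mem_coe.2 (Finset.mem_biUnion.2 ⟨R, hF R h, mem_neighbors.2 hR.symm⟩)
  have h2 (Q : WhitneyBox) :
      cutoff Q p = ∑ R ∈ Q.neighbors with R ∈ F, R.bump p / R.neighbors.card := by
    unfold cutoff
    rw [Finset.sum_filter_of_ne]
    intro R _ hR
    exact hF R fun h0 => hR (by rw [h0, zero_div])
  rw [finsum_eq_sum_of_support_subset _ h1, Finset.sum_congr rfl fun Q _ => h2 Q,
    Finset.sum_comm' (s' := fun R => R.neighbors) (t' := F), ← hs]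
  · refine Finset.sum_congr rfl fun R _ => ?_
    have : (R.neighbors.card : ℝ) ≠ 0 := Nat.cast_ne_zero.2 R.card_neighbors_pos.ne'
    rw [Finset.sum_const, nsmul_eq_mul]
    field_simp
  · intro Q R
    simp only [Finset.mem_biUnion, Finset.mem_filter, mem_neighbors]
    constructor
    · rintro ⟨-, h, hR⟩
      exact ⟨h.symm, hR⟩
    · rintro ⟨h, hR⟩
      exact ⟨⟨R, hR, h⟩, h.symm, hR⟩

lemma support_cutoff_encard_le (p : ℝ × ℝ) : {Q | cutoff Q p ≠ 0}.encard ≤ nearBound :=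
  (encard_le_encard fun _ h => near_of_mem_starStar (mem_starStar_of_cutoff_ne_zero h)).trans
    (near_encard_le p)

lemma cutoff_le_one (Q : WhitneyBox) (p : ℝ × ℝ) : Q.cutoff p ≤ 1 := by
  by_cases hp : p.1 = 0
  · have : Q.cutoff p = 0 := Finset.sum_eq_zero fun R _ => by
      rw [R.bump_eq_zero_of_fst_eq_zero hp, zero_div]
    rw [this]; exact zero_le_one
  · rw [← finsum_cutoff hp]
    exact single_le_finsum Q (finite_of_encard_le_coe (support_cutoff_encard_le p))
      fun R => cutoff_nonneg R p

/-- The point lies in a box `R` touching `Q`, where the bump of `R` is at least `1 / 4` and enters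
with weight at least `1 / nearBound`. This is the purpose of the averaging: the bump of `Q` alone
may vanish on parts of `Q.star`. -/
lemma le_cutoff {Q : WhitneyBox} {p : ℝ × ℝ} (hp : p ∈ Q.star) :
    (4 * nearBound : ℝ)⁻¹ ≤ Q.cutoff p := by
  obtain ⟨R, hR, hp⟩ := mem_star.1 hp
  have h1 : R.bump p / R.neighbors.card ≤ Q.cutoff p :=
    Finset.single_le_sum (f := fun R : WhitneyBox => R.bump p / R.neighbors.card)
      (fun R _ => div_nonneg (R.bump_nonneg p) (Nat.cast_nonneg _)) (mem_neighbors.2 hR)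
  refine le_trans ?_ h1
  have h2 : (R.neighbors.card : ℝ) ≤ nearBound := by exact_mod_cast R.card_neighbors_le
  have h3 : (0 : ℝ) < R.neighbors.card := by exact_mod_cast R.card_neighbors_pos
  rw [mul_inv, div_eq_mul_inv]
  have := quarter_le_bump hp
  gcongr
  linarith

lemma abs_cutoff_sub_le (Q : WhitneyBox) (p q : ℝ × ℝ) :
    |Q.cutoff p - Q.cutoff q| ≤ 42 * nearBound * (rdist p q / Q.scale) := by
  have hD := rdist_nonneg p q
  have hQ := Q.scale_pos
  unfold cutoff
  rw [← Finset.sum_sub_distrib]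
  refine (Finset.abs_sum_le_sum_abs _ _).trans ?_
  have h1 : ∀ R ∈ Q.neighbors, |R.bump p / R.neighbors.card - R.bump q / R.neighbors.card| ≤
      42 * (rdist p q / Q.scale) := by
    intro R hR
    have hR0 := R.scale_pos
    have h3 : (1 : ℝ) ≤ R.neighbors.card := by exact_mod_cast R.card_neighbors_pos
    rw [← sub_div, abs_div, Nat.abs_cast]
    have h4 : |R.bump p - R.bump q| / R.neighbors.card ≤ |R.bump p - R.bump q| :=
      div_le_self (abs_nonneg _) h3
    refine (h4.trans (R.bump_sub_le p q)).trans ?_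
    have h5 : rdist p q / R.scale ≤ 2 * (rdist p q / Q.scale) := by
      rw [div_le_iff₀ hR0, mul_assoc, div_mul_eq_mul_div, ← mul_div_assoc, le_div_iff₀ hQ]
      have := (mem_neighbors.1 hR).symm.bounds.1
      nlinarith
    linarith
  refine (Finset.sum_le_card_nsmul _ _ _ h1).trans ?_
  rw [nsmul_eq_mul]
  have : (Q.neighbors.card : ℝ) ≤ nearBound := by exact_mod_cast Q.card_neighbors_le
  calc (Q.neighbors.card : ℝ) * (42 * (rdist p q / Q.scale))
      ≤ nearBound * (42 * (rdist p q / Q.scale)) := by gcongr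
    _ = _ := by ring

lemma isLipschitzPartition_cutoff :
    IsLipschitzPartition (4 * nearBound) (84 * nearBound) nearBound cutoff where
  pos := by simp [nearBound]
  nonneg := cutoff_nonneg
  le_one := cutoff_le_one
  lower Q p hp := by simpa using le_cutoff hp
  support Q p hp := by
    by_contra h
    exact hp (mem_starStar_of_cutoff_ne_zero h)
  lipschitz Q p q := by
    have hD := rdist_nonneg p q
    have hQ := Q.scale_pos
    have hδ := Q.rdiam_pos
    rw [diam_eq, ccDist_eq, edist_dist, Real.dist_eq,
      ← ENNReal.ofReal_coe_nnreal (p := 84 * nearBound), ← ENNReal.ofReal_div_of_pos hδ,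
      ← ENNReal.ofReal_mul (by positivity)]
    refine ENNReal.ofReal_le_ofReal ((abs_cutoff_sub_le Q p q).trans ?_)
    push_cast
    rw [div_mul_eq_mul_div, le_div_iff₀ hδ, ← mul_div_assoc, div_mul_eq_mul_div, div_le_iff₀ hQ]
    have := Q.rdiam_le
    have : (42 * nearBound * rdist p q) * Q.rdiam ≤ (42 * nearBound * rdist p q) * (2 * Q.scale) := by
      gcongr
    linarith
  overlap p _ := support_cutoff_encard_le p
  sum_eq_one p hp := finsum_cutoff hp

end WhitneyBox

end Grushin

/-! ### The Whitney extension and its Lipschitz bound -/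

namespace Grushin

open Set WhitneyBox

lemma edist_eq_ofReal_norm {n : ℕ} (v w : EuclideanSpace ℝ (Fin n)) :
    edist v w = ENNReal.ofReal ‖v - w‖ := by rw [edist_dist, dist_eq_norm]

lemma isBiLipschitzOn_iff {n : ℕ} {L : ℝ≥0} {S : Set (ℝ × ℝ)}
    {F : ℝ × ℝ → EuclideanSpace ℝ (Fin n)} : IsBiLipschitzOn L S F ↔
      1 ≤ L ∧ ∀ p ∈ S, ∀ q ∈ S, rdist p q ≤ L * ‖F p - F q‖ ∧ ‖F p - F q‖ ≤ L * rdist p q := by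
  unfold IsBiLipschitzOn
  refine and_congr_right fun hL => forall₂_congr fun p _ => forall₂_congr fun q _ => ?_
  have hL0 : (0 : ℝ) < L := lt_of_lt_of_le one_pos (by exact_mod_cast hL)
  have hD := rdist_nonneg p q
  rw [edist_eq_ofReal_norm, ccDist_eq, ← ENNReal.ofReal_coe_nnreal, ← ENNReal.ofReal_mul hL0.le,
    ENNReal.ofReal_le_ofReal_iff (by positivity), ← ENNReal.ofReal_inv_of_pos hL0,
    ← ENNReal.ofReal_mul (by positivity), ENNReal.ofReal_le_ofReal_iff (norm_nonneg _),
    inv_mul_le_iff₀ hL0]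

/-- `f` is a bi-Lipschitz map from the line with the metric `|y - y'|^(1/2)`, with constants `3 L`
and `L`. -/
structure SqrtBiLipschitz {n : ℕ} (L : ℝ) (f : ℝ × ℝ → EuclideanSpace ℝ (Fin n)) : Prop where
  one_le : 1 ≤ L
  upper : ∀ y y' : ℝ, ‖f (0, y) - f (0, y')‖ ≤ 3 * L * √|y - y'|
  lower : ∀ y y' : ℝ, √|y - y'| ≤ L * ‖f (0, y) - f (0, y')‖

lemma rdist_singularLine_le (y y' : ℝ) : rdist (0, y) (0, y') ≤ 3 * √|y - y'| := by
  simpa using rdist_le_sqrt (0, y) (0, y')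

lemma sqrt_le_rdist_singularLine (y y' : ℝ) : √|y - y'| ≤ rdist (0, y) (0, y') := by
  refine Real.sqrt_le_iff.2 ⟨rdist_nonneg _ _, ?_⟩
  have := abs_snd_sub_le_rdist (0, y) (0, y')
  simp only [abs_zero, zero_add] at this
  rwa [sq]

lemma IsBiLipschitzOn.sqrtBiLipschitz {n : ℕ} {L : ℝ≥0} {f : ℝ × ℝ → EuclideanSpace ℝ (Fin n)}
    (h : IsBiLipschitzOn L singularLine f) : SqrtBiLipschitz L f := by
  obtain ⟨hL, h⟩ := isBiLipschitzOn_iff.1 h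
  refine ⟨by exact_mod_cast hL, fun y y' => ?_, fun y y' => ?_⟩
  · refine ((h (0, y) rfl (0, y') rfl).2).trans ?_
    have := rdist_singularLine_le y y'
    calc (L : ℝ) * rdist (0, y) (0, y') ≤ L * (3 * √|y - y'|) := by gcongr
      _ = _ := by ring
  · exact (sqrt_le_rdist_singularLine y y').trans (h (0, y) rfl (0, y') rfl).1

/-- The Whitney extension with respect to the partition `cutoff`. -/
abbrev extension (f : ℝ × ℝ → EuclideanSpace ℝ (Fin 3)) : ℝ × ℝ → EuclideanSpace ℝ (Fin 3) :=
  whitneyExtension cutoff nearestPoint f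

lemma support_cutoff_finite (p : ℝ × ℝ) : {Q | cutoff Q p ≠ 0}.Finite :=
  finite_of_encard_le_coe (support_cutoff_encard_le p)

/-- The finite set of the boxes whose cutoff function does not vanish at `p`. -/
def active (p : ℝ × ℝ) : Finset WhitneyBox := (support_cutoff_finite p).toFinset

lemma mem_active {p : ℝ × ℝ} {Q : WhitneyBox} : Q ∈ active p ↔ cutoff Q p ≠ 0 := by simp [active]

lemma near_of_mem_active {p : ℝ × ℝ} {Q : WhitneyBox} (h : Q ∈ active p) : Near p Q :=
  near_of_mem_starStar (mem_starStar_of_cutoff_ne_zero (mem_active.1 h))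

lemma card_active_le (p : ℝ × ℝ) : (active p).card ≤ nearBound := by
  have h := support_cutoff_encard_le p
  rw [(support_cutoff_finite p).encard_eq_coe_toFinset_card] at h
  exact_mod_cast h

lemma exists_common_active (p q : ℝ × ℝ) : ∃ F : Finset WhitneyBox,
    (∀ Q, Q ∈ F ↔ Q ∈ active p ∨ Q ∈ active q) ∧ (F.card : ℝ) ≤ 2 * nearBound := by
  classical
  refine ⟨active p ∪ active q, by simp, ?_⟩
  have := Finset.card_union_le (active p) (active q)
  have := card_active_le p
  have := card_active_le q
  have h : (active p ∪ active q).card ≤ 2 * nearBound := by omega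
  exact_mod_cast h

lemma sum_cutoff_eq_one {p : ℝ × ℝ} (hp : p.1 ≠ 0) {F : Finset WhitneyBox}
    (hF : ∀ Q, Q ∈ active p → Q ∈ F) : ∑ Q ∈ F, cutoff Q p = 1 := by
  rw [← finsum_cutoff hp, finsum_eq_sum_of_support_subset]
  exact fun Q hQ => hF Q (mem_active.2 hQ)

lemma extension_eq_sum (f : ℝ × ℝ → EuclideanSpace ℝ (Fin 3)) {p : ℝ × ℝ} (hp : p.1 ≠ 0)
    {F : Finset WhitneyBox} (hF : ∀ Q, Q ∈ active p → Q ∈ F) :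
    extension f p = ∑ Q ∈ F, cutoff Q p • f (nearestPoint Q) := by
  unfold extension whitneyExtension
  rw [if_neg hp, finsum_eq_sum_of_support_subset]
  intro Q hQ
  refine hF Q (mem_active.2 fun h => hQ ?_)
  simp [h]

/-- The cutoffs sum to one, so a constant can be moved inside the sum. For a suitable constant all
terms become as small as the local scale. -/
lemma extension_sub_eq_sum (f : ℝ × ℝ → EuclideanSpace ℝ (Fin 3)) {p : ℝ × ℝ} (hp : p.1 ≠ 0)
    {F : Finset WhitneyBox} (hF : ∀ Q, Q ∈ active p → Q ∈ F) (a : EuclideanSpace ℝ (Fin 3)) :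
    extension f p - a = ∑ Q ∈ F, cutoff Q p • (f (nearestPoint Q) - a) := by
  simp only [smul_sub, Finset.sum_sub_distrib, ← Finset.sum_smul]
  rw [sum_cutoff_eq_one hp hF, one_smul, extension_eq_sum f hp hF]

variable {L : ℝ} {f : ℝ × ℝ → EuclideanSpace ℝ (Fin 3)}

/-- The bottom of an active box differs from `p.2` by at most `100 * scale ^ 2 ≤ (80 * |p.1|) ^ 2`.
The extension averages values of `f` at such heights, whence `3 * 80 = 240`. -/
lemma norm_extension_sub_le (hf : SqrtBiLipschitz L f) (p : ℝ × ℝ) :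
    ‖extension f p - f (0, p.2)‖ ≤ 240 * L * |p.1| := by
  have hL := hf.one_le
  by_cases hp : p.1 = 0
  · have : extension f p = f (0, p.2) := by
      unfold extension whitneyExtension
      rw [if_pos hp]; congr 1; ext <;> simp [hp]
    rw [this, sub_self, norm_zero]
    positivity
  · rw [extension_sub_eq_sum f hp (fun Q hQ => hQ)]
    have h1 : ∀ Q ∈ active p, ‖cutoff Q p • (f (nearestPoint Q) - f (0, p.2))‖ ≤
        cutoff Q p * (240 * L * |p.1|) := by
      intro Q hQ
      have hc := Q.cutoff_nonneg p
      have hs := Q.scale_pos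
      rw [norm_smul, Real.norm_of_nonneg hc]
      refine mul_le_mul_of_nonneg_left ?_ hc
      obtain ⟨-, h2, h3⟩ := near_of_mem_active hQ
      refine (hf.upper Q.bottom p.2).trans ?_
      have h4 : √|Q.bottom - p.2| ≤ 80 * |p.1| := by
        refine Real.sqrt_le_iff.2 ⟨by positivity, ?_⟩
        rw [abs_sub_comm]
        refine h3.trans ?_
        nlinarith
      calc 3 * L * √|Q.bottom - p.2| ≤ 3 * L * (80 * |p.1|) := by gcongr
        _ = _ := by ring
    refine (norm_sum_le_of_le _ h1).trans ?_
    rw [← Finset.sum_mul, sum_cutoff_eq_one hp (fun Q hQ => hQ), one_mul]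

lemma norm_extension_sub_singularLine_le (hf : SqrtBiLipschitz L f) (p : ℝ × ℝ) (y : ℝ) {D : ℝ}
    (h1 : |p.1| ≤ D) (h2 : |p.2 - y| ≤ 2 * D * D) :
    ‖extension f p - f (0, y)‖ ≤ 246 * L * D := by
  have hL := hf.one_le
  have hD : 0 ≤ D := (abs_nonneg _).trans h1
  have h3 : √|p.2 - y| ≤ 2 * D := Real.sqrt_le_iff.2 ⟨by positivity, by nlinarith⟩
  calc ‖extension f p - f (0, y)‖
      ≤ ‖extension f p - f (0, p.2)‖ + ‖f (0, p.2) - f (0, y)‖ := norm_sub_le_norm_sub_add_norm_sub ..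
    _ ≤ 240 * L * |p.1| + 3 * L * √|p.2 - y| :=
      add_le_add (norm_extension_sub_le hf p) (hf.upper _ _)
    _ ≤ 240 * L * D + 3 * L * (2 * D) := by gcongr
    _ = _ := by ring

/-- A point on the singular line is handled by the preceding bounds. Off the line, in each term the
difference of cutoffs is at most 1 and at most a multiple of `D / scale`, while the difference of
the values of `f` is at most `3 * L * (10 * scale + 2 * D)`. The scale cancels, and there are at
most `2 * nearBound` terms. -/
lemma norm_extension_sub_extension_le (hf : SqrtBiLipschitz L f) (p q : ℝ × ℝ) :
    ‖extension f p - extension f q‖ ≤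
      (246 + 2 * nearBound * (3 * (420 * nearBound + 2))) * L * rdist p q := by
  have hL := hf.one_le
  have hD := rdist_nonneg p q
  have hx := abs_fst_sub_le_rdist p q
  have hy := abs_snd_sub_le_rdist p q
  have hy' := abs_snd_sub_le_rdist' p q
  set D := rdist p q with hDdef
  have hcomb : 246 * L * D ≤ (246 + 2 * nearBound * (3 * (420 * nearBound + 2))) * L * D := by
    gcongr; exact le_add_of_nonneg_right (by positivity)
  have hline (r : ℝ × ℝ) (hr : r.1 = 0) : extension f r = f (0, r.2) := by
    unfold extension whitneyExtension
    rw [if_pos hr]; congr 1; ext <;> simp [hr]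
  by_cases hq : q.1 = 0
  · rw [hline q hq]
    refine (norm_extension_sub_singularLine_le hf p q.2 ?_ ?_).trans hcomb
    · simpa [hq] using hx
    · simpa [hq] using hy'
  by_cases hp : p.1 = 0
  · rw [hline p hp, norm_sub_rev]
    refine (norm_extension_sub_singularLine_le hf q p.2 ?_ ?_).trans hcomb
    · simpa [hp] using hx
    · rw [abs_sub_comm]
      rw [hp] at hy
      simp only [abs_zero, zero_add] at hy
      nlinarith
  obtain ⟨F, hF, hcard⟩ := exists_common_active p q
  have e : extension f p - extension f q =
      ∑ Q ∈ F, (cutoff Q p - cutoff Q q) • (f (nearestPoint Q) - f (0, p.2)) := by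
    rw [← sub_sub_sub_cancel_right _ _ (f (0, p.2)),
      extension_sub_eq_sum f hp (fun Q hQ => (hF Q).2 (Or.inl hQ)),
      extension_sub_eq_sum f hq (fun Q hQ => (hF Q).2 (Or.inr hQ)), ← Finset.sum_sub_distrib]
    simp only [sub_smul]
  rw [e]
  have h1 : ∀ Q ∈ F, ‖(cutoff Q p - cutoff Q q) • (f (nearestPoint Q) - f (0, p.2))‖ ≤
      3 * (420 * nearBound + 2) * L * D := by
    intro Q hQ
    have hs := Q.scale_pos
    have h2 : √|Q.bottom - p.2| ≤ 10 * Q.scale + 2 * D := by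
      refine Real.sqrt_le_iff.2 ⟨by positivity, ?_⟩
      rcases (hF Q).1 hQ with h | h
      · obtain ⟨-, -, h⟩ := near_of_mem_active h
        rw [abs_sub_comm]
        nlinarith [mul_nonneg hs.le hD]
      · obtain ⟨h3, -, h⟩ := near_of_mem_active h
        have h4 : |p.2 - Q.bottom| ≤ |p.2 - q.2| + |q.2 - Q.bottom| := abs_sub_le _ _ _
        have h5 : (|q.1| + 2 * D) * D ≤ (8 * Q.scale + 2 * D) * D := by gcongr
        rw [abs_sub_comm]
        nlinarith [mul_nonneg hs.le hD]
    have h3 : |cutoff Q p - cutoff Q q| ≤ 1 := by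
      have := Q.cutoff_nonneg p
      have := Q.cutoff_nonneg q
      have := Q.cutoff_le_one p
      have := Q.cutoff_le_one q
      rw [abs_le]; constructor <;> linarith
    have h4 := Q.abs_cutoff_sub_le p q
    have h5 : |cutoff Q p - cutoff Q q| * Q.scale ≤ 42 * nearBound * D := by
      calc |cutoff Q p - cutoff Q q| * Q.scale ≤ 42 * nearBound * (D / Q.scale) * Q.scale := by
            gcongr
        _ = _ := by field_simp
    rw [norm_smul, Real.norm_eq_abs]
    calc |cutoff Q p - cutoff Q q| * ‖f (nearestPoint Q) - f (0, p.2)‖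
        ≤ |cutoff Q p - cutoff Q q| * (3 * L * (10 * Q.scale + 2 * D)) := by
          gcongr
          refine (hf.upper Q.bottom p.2).trans ?_
          gcongr
      _ = 3 * L * (10 * (|cutoff Q p - cutoff Q q| * Q.scale) +
            2 * (|cutoff Q p - cutoff Q q| * D)) := by ring
      _ ≤ 3 * L * (10 * (42 * nearBound * D) + 2 * (1 * D)) := by gcongr
      _ = _ := by ring
  refine (norm_sum_le_of_le _ h1).trans ?_
  rw [Finset.sum_const, nsmul_eq_mul]
  calc (F.card : ℝ) * (3 * (420 * nearBound + 2) * L * D)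
      ≤ (2 * nearBound) * (3 * (420 * nearBound + 2) * L * D) := by gcongr
    _ = (2 * nearBound * (3 * (420 * nearBound + 2))) * L * D := by ring
    _ ≤ _ := by gcongr; linarith

/-! ### Lipschitz bound for the colored charts -/

lemma chart_zero (Q : WhitneyBox) (p : ℝ × ℝ) : Q.chart p 0 = p.1 := rfl

lemma chart_one (Q : WhitneyBox) (p : ℝ × ℝ) : Q.chart p 1 = (p.2 - Q.bottom) / Q.rdiam := by
  unfold chart bottom
  rw [scale_sq]; rfl

lemma abs_chart_le {Q : WhitneyBox} {p : ℝ × ℝ} (h : Near p Q) (j : Fin 2) :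
    |Q.chart p j| ≤ 100 * Q.scale := by
  have hs := Q.scale_pos
  obtain ⟨h1, h2, h3⟩ := h
  fin_cases j
  · change |p.1| ≤ _; linarith
  · change |Q.chart p 1| ≤ _
    rw [chart_one, abs_div, abs_of_pos Q.rdiam_pos, div_le_iff₀ Q.rdiam_pos]
    refine h3.trans ?_
    nlinarith [Q.scale_le_rdiam]

/-- At distances up to the scale, a vertical displacement is at most `10 * scale` times the
distance; dividing by the diameter, which is at least the scale, normalizes the chart. At larger
distances the vertical coordinate grows quadratically and no such bound holds. -/
lemma abs_chart_sub_le {Q : WhitneyBox} {p q : ℝ × ℝ} (h : Near p Q ∨ Near q Q)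
    (hs : rdist p q ≤ Q.scale) (j : Fin 2) : |Q.chart p j - Q.chart q j| ≤ 10 * rdist p q := by
  have hs0 := Q.scale_pos
  have hD := rdist_nonneg p q
  have hx := abs_fst_sub_le_rdist p q
  have hy := abs_snd_sub_le_rdist p q
  have hy' := abs_snd_sub_le_rdist' p q
  set D := rdist p q
  fin_cases j
  · change |p.1 - q.1| ≤ _; linarith
  · change |Q.chart p 1 - Q.chart q 1| ≤ _
    rw [chart_one, chart_one, ← sub_div, sub_sub_sub_cancel_right, abs_div, abs_of_pos Q.rdiam_pos,
      div_le_iff₀ Q.rdiam_pos]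
    have h1 : |p.2 - q.2| ≤ (10 * Q.scale) * D := by
      rcases h with h | h
      · refine hy.trans ?_
        gcongr
        linarith [h.1]
      · refine hy'.trans ?_
        gcongr
        linarith [h.1]
    have : D * Q.scale ≤ D * Q.rdiam := by gcongr; exact Q.scale_le_rdiam
    linarith

/-- Both products are at most `100 * scale`, which settles distances above the scale. Below it the
product rule is used, with the chart evaluated at a point where the cutoff is nonzero, since only
there is the chart bounded. -/
lemma abs_cutoff_mul_chart_sub_le (Q : WhitneyBox) (p q : ℝ × ℝ) (j : Fin 2) :
    |cutoff Q p * Q.chart p j - cutoff Q q * Q.chart q j| ≤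
      (4200 * nearBound + 200) * rdist p q := by
  have hs := Q.scale_pos
  have hD := rdist_nonneg p q
  have hu0 := Q.cutoff_nonneg p
  have hv0 := Q.cutoff_nonneg q
  have hu1 := Q.cutoff_le_one p
  have hv1 := Q.cutoff_le_one q
  have huv := Q.abs_cutoff_sub_le p q
  have hnear (r : ℝ × ℝ) : |cutoff Q r * Q.chart r j| ≤ 100 * Q.scale := by
    by_cases h : cutoff Q r = 0
    · rw [h, zero_mul, abs_zero]; positivity
    · rw [abs_mul, abs_of_nonneg (Q.cutoff_nonneg r)]
      calc cutoff Q r * |Q.chart r j| ≤ 1 * (100 * Q.scale) := by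
            gcongr
            · exact Q.cutoff_le_one r
            · exact abs_chart_le (near_of_mem_active (mem_active.2 h)) j
        _ = _ := one_mul _
  have hN : (0 : ℝ) ≤ 4200 * nearBound := by positivity
  rcases le_total Q.scale (rdist p q) with h | h
  · refine (abs_sub _ _).trans ?_
    have := hnear p
    have := hnear q
    nlinarith
  have hlip : |cutoff Q p - cutoff Q q| * (100 * Q.scale) ≤ 4200 * nearBound * rdist p q := by
    calc |cutoff Q p - cutoff Q q| * (100 * Q.scale)
        ≤ 42 * nearBound * (rdist p q / Q.scale) * (100 * Q.scale) := by gcongr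
      _ = _ := by field_simp; ring
  by_cases hp : cutoff Q p = 0
  · by_cases hq : cutoff Q q = 0
    · rw [hp, hq, zero_mul, zero_mul, sub_zero, abs_zero]; positivity
    have hn := near_of_mem_active (mem_active.2 hq)
    have h1 := abs_chart_sub_le (Or.inr hn) h j
    have h2 := abs_chart_le hn j
    have e : cutoff Q p * Q.chart p j - cutoff Q q * Q.chart q j =
      (cutoff Q p - cutoff Q q) * Q.chart q j + cutoff Q p * (Q.chart p j - Q.chart q j) := by ring
    rw [e]
    refine (abs_add_le _ _).trans ?_
    rw [abs_mul, abs_mul, abs_of_nonneg hu0]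
    have h3 : |cutoff Q p - cutoff Q q| * |Q.chart q j| ≤
      |cutoff Q p - cutoff Q q| * (100 * Q.scale) := by gcongr
    have h4 : cutoff Q p * |Q.chart p j - Q.chart q j| ≤ 1 * (10 * rdist p q) := by gcongr
    linarith
  · have hn := near_of_mem_active (mem_active.2 hp)
    have h1 := abs_chart_sub_le (Or.inl hn) h j
    have h2 := abs_chart_le hn j
    have e : cutoff Q p * Q.chart p j - cutoff Q q * Q.chart q j =
      (cutoff Q p - cutoff Q q) * Q.chart p j + cutoff Q q * (Q.chart p j - Q.chart q j) := by ring
    rw [e]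
    refine (abs_add_le _ _).trans ?_
    rw [abs_mul, abs_mul, abs_of_nonneg hv0]
    have h3 : |cutoff Q p - cutoff Q q| * |Q.chart p j| ≤
      |cutoff Q p - cutoff Q q| * (100 * Q.scale) := by gcongr
    have h4 : cutoff Q q * |Q.chart p j - Q.chart q j| ≤ 1 * (10 * rdist p q) := by gcongr
    linarith

lemma coloredSum_eq_sum {M : ℕ} (K : WhitneyBox → Fin M) {p : ℝ × ℝ} {F : Finset WhitneyBox}
    (hF : ∀ Q, Q ∈ active p → Q ∈ F) (c : Fin M × Fin 2) : coloredSum cutoff K p c =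
      ∑ Q ∈ F, if K Q = c.1 then cutoff Q p * Q.chart p c.2 else 0 := by
  unfold coloredSum
  rw [finsum_eq_sum_of_support_subset]
  intro Q hQ
  refine hF Q (mem_active.2 fun h => hQ ?_)
  simp [h]

lemma abs_coloredSum_sub_le {M : ℕ} (K : WhitneyBox → Fin M) (p q : ℝ × ℝ) (c : Fin M × Fin 2) :
    |coloredSum cutoff K p c - coloredSum cutoff K q c| ≤
      2 * nearBound * (4200 * nearBound + 200) * rdist p q := by
  have hD := rdist_nonneg p q
  obtain ⟨F, hF, hcard⟩ := exists_common_active p q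
  rw [coloredSum_eq_sum K (fun Q hQ => (hF Q).2 (Or.inl hQ)),
    coloredSum_eq_sum K (fun Q hQ => (hF Q).2 (Or.inr hQ)), ← Finset.sum_sub_distrib]
  refine (Finset.abs_sum_le_sum_abs _ _).trans ?_
  have h1 : ∀ Q ∈ F, |(if K Q = c.1 then cutoff Q p * Q.chart p c.2 else 0) -
      (if K Q = c.1 then cutoff Q q * Q.chart q c.2 else 0)| ≤
        (4200 * nearBound + 200) * rdist p q := by
    intro Q _
    split_ifs
    · exact abs_cutoff_mul_chart_sub_le Q p q c.2
    · rw [sub_zero, abs_zero]; positivity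
  refine (Finset.sum_le_card_nsmul _ _ _ h1).trans ?_
  rw [nsmul_eq_mul]
  calc (F.card : ℝ) * ((4200 * nearBound + 200) * rdist p q)
      ≤ (2 * nearBound) * ((4200 * nearBound + 200) * rdist p q) := by gcongr
    _ = _ := by ring

lemma coloredSum_eq_of_unique {M : ℕ} (K : WhitneyBox → Fin M) {p : ℝ × ℝ} {Q : WhitneyBox}
    (h : ∀ R ∈ active p, K R = K Q → R = Q) (j : Fin 2) :
    coloredSum cutoff K p (K Q, j) = cutoff Q p * Q.chart p j := by
  unfold coloredSum
  rw [finsum_eq_single _ Q]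
  · simp
  · intro R hR
    by_cases hK : K R = K Q
    · rw [if_pos hK]
      have : cutoff R p = 0 := by
        by_contra h0
        exact hR (h R (mem_active.2 h0) hK)
      rw [this, zero_mul]
    · rw [if_neg hK]

/-! ### The lower bound -/

lemma exists_mem_carrier {p : ℝ × ℝ} (hp : p.1 ≠ 0) : ∃ Q : WhitneyBox, p ∈ Q.carrier := by
  obtain ⟨F, -, hs⟩ := exists_finset_sum_bump hp
  obtain ⟨Q, -, hQ⟩ := Finset.exists_ne_zero_of_sum_ne_zero (by rw [hs]; exact one_ne_zero)
  obtain ⟨R, -, hR⟩ := exists_touches_of_bump_ne_zero hQ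
  exact ⟨R, hR⟩

/-- The separation needed of the coloring for maps with constant `L`. -/
def separation (L : ℝ) : ℝ := 40000 + 4 * (1000 * L ^ 2) ^ 2

/-- Two points which lie close to each other compared with their distance from the singular line
meet the support of at most one box of a given color. -/
lemma eq_of_color_eq {T : ℝ} (hT : 0 ≤ T) {M : ℕ} {K : WhitneyBox → Fin M}
    (hK : ∀ Q R, K Q = K R → Q.scale ≤ (40000 + 4 * T) * R.scale →
      R.scale ≤ (40000 + 4 * T) * Q.scale →
        |Q.bottom - R.bottom| ≤ (40000 + 4 * T) * Q.scale ^ 2 → Q = R)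
    {p q : ℝ × ℝ} (hq1 : |p.1| ≤ 10 / 9 * |q.1|) (hq2 : |q.1| ≤ 9 / 8 * |p.1|)
    (hy : |p.2 - q.2| ≤ T * |p.1| ^ 2) {Q R : WhitneyBox} (hQ : p ∈ Q.carrier)
    (hR : R ∈ active q) (hKR : K R = K Q) : R = Q := by
  obtain ⟨hs1, hs2⟩ := abs_fst_bounds hQ
  obtain ⟨h1, h2, h3⟩ := near_of_mem_active hR
  have hs := Q.scale_pos
  have hR0 := R.scale_pos
  have hyb : |Q.bottom - p.2| ≤ Q.scale ^ 2 := by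
    have := (mem_carrier.1 hQ).2
    rw [abs_le]; constructor <;> nlinarith
  have hr2 : |p.1| ^ 2 ≤ 4 * Q.scale ^ 2 := by nlinarith
  have h4 : |Q.bottom - R.bottom| ≤ |Q.bottom - p.2| + |p.2 - R.bottom| := abs_sub_le _ _ _
  have h6 : |p.2 - R.bottom| ≤ |p.2 - q.2| + |q.2 - R.bottom| := abs_sub_le _ _ _
  -- Here `18 = 8 * (9 / 8) * 2`. The bottoms then differ by at most `1 + 4 * T + 100 * 18 ^ 2`
  -- squared scales, which explains the number 40000.
  have h5 : R.scale ≤ 18 * Q.scale := by linarith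
  have h5' : Q.scale ≤ 18 * R.scale := by linarith
  have h8 : R.scale ^ 2 ≤ 324 * Q.scale ^ 2 := by nlinarith
  have h7 : T * |p.1| ^ 2 ≤ T * (4 * Q.scale ^ 2) := by gcongr
  refine (hK Q R hKR.symm ?_ ?_ ?_).symm
  · refine h5'.trans ?_
    gcongr; linarith
  · refine h5.trans ?_
    gcongr; linarith
  · have := sq_nonneg Q.scale
    linarith

/-- If `u x` is close to `v x'` with `u` bounded from below and `v ≥ 0`, then `x` and `x'` have the
same sign. -/
lemma abs_sub_le_of_abs_abs_sub_le {N u v x x' E : ℝ} (hN : 1 ≤ N) (hu : 1 ≤ 4 * N * u)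
    (hu0 : 0 ≤ u) (hv : 0 ≤ v) (h : |u * x - v * x'| ≤ E) (hE : 8 * N * E < |x|)
    (hx : |(|x| - |x'|)| ≤ E) : |x - x'| ≤ E := by
  have hE0 : 0 ≤ E := (abs_nonneg _).trans hx
  rcases le_or_gt 0 (x * x') with hxx | hxx
  · have : |x - x'| = |(|x| - |x'|)| := by
      rw [← sq_eq_sq₀ (abs_nonneg _) (abs_nonneg _), sq_abs, sq_abs]
      have := abs_mul x x'
      rw [abs_of_nonneg hxx] at this
      nlinarith [sq_abs x, sq_abs x']
    rw [this]; exact hx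
  · exfalso
    -- With opposite signs nothing cancels, so `x` would be too small to satisfy `hE`.
    have h2 : u * |x| ≤ |u * x - v * x'| := by
      rw [← abs_of_nonneg (mul_nonneg hu0 (abs_nonneg x)), ← sq_le_sq]
      have e : (u * |x|) ^ 2 = (u * x) ^ 2 := by rw [mul_pow, sq_abs, mul_pow]
      rw [e]
      nlinarith [mul_nonneg (mul_nonneg hu0 hv) (neg_nonneg.2 hxx.le), sq_nonneg (v * x')]
    have h3 : |x| ≤ 4 * N * E := by
      calc |x| ≤ (4 * N * u) * |x| := le_mul_of_one_le_left (abs_nonneg _) hu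
        _ = 4 * N * (u * |x|) := by ring
        _ ≤ 4 * N * E := by gcongr; exact h2.trans h
    nlinarith

/-- From differences of the products of two charts with the cutoff functions, one recovers the
difference of the second coordinates. -/
lemma abs_sub_le_of_products {N u v x x' η η' r B E : ℝ} (hN : 1 ≤ N) (hu : 1 ≤ 4 * N * u)
    (hu0 : 0 ≤ u) (hv0 : 0 ≤ v) (hv1 : v ≤ 1) (h0 : |u * x - v * x'| ≤ E) (hx : |x - x'| ≤ E)
    (h1 : |u * η - v * η'| ≤ E) (hr : r = |x|) (hη : |η'| ≤ B * r) (hB : 0 ≤ B) :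
    |η - η'| ≤ 4 * N * ((2 * B + 1) * E) := by
  -- The horizontal coordinate is already known up to `E`, so its weighted version measures the
  -- change of the cutoff. This is then removed from the weighted vertical coordinate.
  have huv : |u - v| * r ≤ 2 * E := by
    rw [hr, ← abs_mul]
    have e : (u - v) * x = (u * x - v * x') - v * (x - x') := by ring
    rw [e]
    refine (abs_sub _ _).trans ?_
    rw [abs_mul, abs_of_nonneg hv0]
    have : v * |x - x'| ≤ 1 * E := by gcongr
    linarith
  have h2 : u * |η - η'| ≤ (2 * B + 1) * E := by
    have e : u * (η - η') = (u * η - v * η') - (u - v) * η' := by ring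
    rw [← abs_of_nonneg hu0, ← abs_mul, e]
    refine (abs_sub _ _).trans ?_
    rw [abs_mul]
    have h3 : |u - v| * |η'| ≤ |u - v| * (B * r) := by gcongr
    have h4 : B * (|u - v| * r) ≤ B * (2 * E) := by gcongr
    linarith
  calc |η - η'| ≤ (4 * N * u) * |η - η'| := le_mul_of_one_le_left (abs_nonneg _) hu
    _ = 4 * N * (u * |η - η'|) := by ring
    _ ≤ _ := by gcongr

/-- The lower bound for points at which the differences of the components of the embedding are at
most `E`, where `E` is small with respect to the distance from the singular line. -/
lemma rdist_le_of_close {T : ℝ} (hT : 0 ≤ T) {M : ℕ} {K : WhitneyBox → Fin M}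
    (hK : ∀ Q R, K Q = K R → Q.scale ≤ (40000 + 4 * T) * R.scale →
      R.scale ≤ (40000 + 4 * T) * Q.scale →
        |Q.bottom - R.bottom| ≤ (40000 + 4 * T) * Q.scale ^ 2 → Q = R)
    (p q : ℝ × ℝ) {E : ℝ} (hx : |(|p.1| - |q.1|)| ≤ E)
    (hH : ∀ c, |coloredSum cutoff K p c - coloredSum cutoff K q c| ≤ E)
    (hE : 8 * nearBound * E < |p.1|) (hy : |p.2 - q.2| ≤ T * |p.1| ^ 2) :
    rdist p q ≤ (1 + 8 * nearBound * (4 * T + 3)) * E := by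
  have hE0 : 0 ≤ E := (abs_nonneg _).trans hx
  have hN : (1 : ℝ) ≤ nearBound := by norm_num [nearBound]
  have hN16 : (16 : ℝ) ≤ nearBound := by norm_num [nearBound]
  generalize hNN : (nearBound : ℝ) = N at *
  have hr : 0 < |p.1| := lt_of_le_of_lt (by positivity) hE
  -- This gives the ratios `10 / 9` and `9 / 8` required by `eq_of_color_eq`.
  have hE8 : 10 * E < |p.1| := lt_of_le_of_lt (by gcongr; linarith) hE
  have hp : p.1 ≠ 0 := abs_pos.1 hr
  obtain ⟨hq1, hq2⟩ := abs_le.1 hx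
  obtain ⟨Q, hQ⟩ := exists_mem_carrier hp
  obtain ⟨hs1, hs2⟩ := abs_fst_bounds hQ
  have hs := Q.scale_pos
  have hyb : |p.2 - Q.bottom| ≤ Q.scale ^ 2 := by
    have := (mem_carrier.1 hQ).2
    rw [abs_le]; constructor <;> nlinarith
  have h0 := hH (K Q, 0)
  have h1 := hH (K Q, 1)
  -- At both points, the two coordinates with the color of `Q` reduce to the chart of `Q` times its
  -- cutoff.
  have up : ∀ R ∈ active p, K R = K Q → R = Q := fun R hR hKR =>
    eq_of_color_eq hT hK (by linarith) (by linarith) (by simp; positivity) hQ hR hKR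
  have uq : ∀ R ∈ active q, K R = K Q → R = Q := fun R hR hKR =>
    eq_of_color_eq hT hK (by linarith) (by linarith) hy hQ hR hKR
  rw [coloredSum_eq_of_unique K up, coloredSum_eq_of_unique K uq] at h0 h1
  rw [chart_zero, chart_zero] at h0
  rw [chart_one, chart_one] at h1
  have hu : (4 * nearBound : ℝ)⁻¹ ≤ cutoff Q p :=
    le_cutoff (mem_star.2 ⟨Q, Q.touches_self, hQ⟩)
  have hu' : 1 ≤ 4 * N * cutoff Q p := by
    rwa [hNN, inv_le_iff_one_le_mul₀' (by positivity)] at hu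
  have hu0 := Q.cutoff_nonneg p
  have hv0 := Q.cutoff_nonneg q
  have hv1 := Q.cutoff_le_one q
  have hδ := Q.rdiam_pos
  have hside := abs_sub_le_of_abs_abs_sub_le hN hu' hu0 hv0 h0 hE hx
  have hηq : |(q.2 - Q.bottom) / Q.rdiam| ≤ (2 * T + 1) * |p.1| := by
    rw [abs_div, abs_of_pos hδ, div_le_iff₀ hδ]
    have h4 : |q.2 - Q.bottom| ≤ |q.2 - p.2| + |p.2 - Q.bottom| := abs_sub_le _ _ _
    rw [abs_sub_comm q.2 p.2] at h4
    have h5 : T * |p.1| ^ 2 ≤ T * (2 * |p.1| * Q.scale) := by gcongr; nlinarith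
    have h6 : (2 * T + 1) * |p.1| * Q.scale ≤ (2 * T + 1) * |p.1| * Q.rdiam := by
      gcongr; exact Q.scale_le_rdiam
    have h7 : Q.scale ^ 2 ≤ |p.1| * Q.scale := by nlinarith
    linarith
  have h3 := abs_sub_le_of_products hN hu' hu0 hv0 hv1 h0 hside h1 rfl hηq (by positivity)
  rw [← sub_div, sub_sub_sub_cancel_right, abs_div, abs_of_pos hδ, div_le_iff₀ hδ] at h3
  have h5 : |p.2 - q.2| / |p.1| ≤ 8 * N * ((4 * T + 3) * E) := by
    rw [div_le_iff₀ hr]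
    have : Q.rdiam ≤ 2 * |p.1| := Q.rdiam_le.trans (by linarith)
    calc |p.2 - q.2| ≤ 4 * N * ((2 * (2 * T + 1) + 1) * E) * Q.rdiam := h3
      _ ≤ 4 * N * ((2 * (2 * T + 1) + 1) * E) * (2 * |p.1|) := by gcongr
      _ = _ := by ring
  refine (rdist_le_div p q hp).trans ?_
  linarith

/-- The constant in the lower bound for the embedding. -/
def lowerConstant (L : ℝ) : ℝ :=
  (1 + 8 * nearBound * (4 * (1000 * L ^ 2) ^ 2 + 3)) +
    ((16 * nearBound + 1) + 3 * (L * (3 + 240 * L * (16 * nearBound + 1))))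

/-- The map `f` controls `√|p.2 - q.2|` up to an error proportional to the distances from the line.
If `|p.1| ≤ 8 * nearBound * E` this error is `O(E)` and `rdist_le_sqrt` concludes. Otherwise it says
only that `p` and `q` are at bounded relative position, which is exactly what the charts in
`rdist_le_of_close` need. -/
lemma rdist_le_lowerConstant_mul (hf : SqrtBiLipschitz L f) {M : ℕ} {K : WhitneyBox → Fin M}
    (hK : ∀ Q R, K Q = K R → Q.scale ≤ separation L * R.scale →
      R.scale ≤ separation L * Q.scale →
        |Q.bottom - R.bottom| ≤ separation L * Q.scale ^ 2 → Q = R)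
    (p q : ℝ × ℝ) {E : ℝ} (hx : |(|p.1| - |q.1|)| ≤ E)
    (hg : ‖extension f p - extension f q‖ ≤ 3 * E)
    (hH : ∀ c, |coloredSum cutoff K p c - coloredSum cutoff K q c| ≤ E) :
    rdist p q ≤ lowerConstant L * E := by
  have hL := hf.one_le
  have hE0 : 0 ≤ E := (abs_nonneg _).trans hx
  have hN : (1 : ℝ) ≤ nearBound := by norm_num [nearBound]
  obtain ⟨hq1, hq2⟩ := abs_le.1 hx
  have h1 : √|p.2 - q.2| ≤ L * (3 * E + 240 * L * (|p.1| + |q.1|)) := by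
    refine (hf.lower p.2 q.2).trans ?_
    gcongr
    have h2 := norm_extension_sub_le hf p
    have h3 := norm_extension_sub_le hf q
    have e : f (0, p.2) - f (0, q.2) = (extension f p - extension f q) -
      (extension f p - f (0, p.2)) + (extension f q - f (0, q.2)) := by abel
    rw [e]
    have h4 := norm_add_le ((extension f p - extension f q) - (extension f p - f (0, p.2)))
      (extension f q - f (0, q.2))
    have h5 := norm_sub_le (extension f p - extension f q) (extension f p - f (0, p.2))
    linarith
  unfold lowerConstant
  rcases le_or_gt |p.1| (8 * nearBound * E) with h | h
  · have h2 : |p.1| + |q.1| ≤ (16 * nearBound + 1) * E := by linarith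
    have h3 : √|p.2 - q.2| ≤ (L * (3 + 240 * L * (16 * nearBound + 1))) * E := by
      refine h1.trans ?_
      calc L * (3 * E + 240 * L * (|p.1| + |q.1|))
          ≤ L * (3 * E + 240 * L * ((16 * nearBound + 1) * E)) := by gcongr
        _ = _ := by ring
    have h4 : 0 ≤ (1 + 8 * nearBound * (4 * (1000 * L ^ 2) ^ 2 + 3)) * E := by positivity
    refine (rdist_le_sqrt p q).trans ?_
    linarith
  · have h2 := rdist_le_of_close (sq_nonneg _) hK p q hx hH h ?_
    · refine h2.trans (mul_le_mul_of_nonneg_right ?_ hE0)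
      exact le_add_of_nonneg_right (by positivity)
    · have h8 : 8 * E < |p.1| := by nlinarith
      have hr : 0 ≤ |p.1| := abs_nonneg _
      -- The actual constant is `721 * L ^ 2`. The square of the bound is the value of `T` built
      -- into `separation`.
      have h3 : √|p.2 - q.2| ≤ 1000 * L ^ 2 * |p.1| := by
        refine h1.trans ?_
        calc L * (3 * E + 240 * L * (|p.1| + |q.1|)) ≤ L * (L * |p.1| + 240 * L * (3 * |p.1|)) := by
              have a1 : 3 * E ≤ L * |p.1| := by nlinarith
              have a2 : |p.1| + |q.1| ≤ 3 * |p.1| := by linarith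
              gcongr
          _ ≤ _ := by nlinarith [mul_nonneg (sq_nonneg L) hr]
      rw [← mul_pow]
      exact (Real.sqrt_le_iff.1 h3).2

/-! ### Assembling the coordinates of the embedding -/

section embedding

variable {M : ℕ} (K : WhitneyBox → Fin M) (f)

/-- The embedding for the partition `cutoff` and the points `nearestPoint`. -/
abbrev whitneyEmbedding : ℝ × ℝ → EuclideanSpace ℝ (Fin (3 + M * 2 + 1)) :=
  embedding cutoff nearestPoint K f

lemma whitneyEmbedding_extension (p : ℝ × ℝ) (i : Fin 3) :
    whitneyEmbedding f K p (Fin.castAdd 1 (Fin.castAdd (M * 2) i)) = extension f p i := by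
  simp [whitneyEmbedding, embedding]

lemma whitneyEmbedding_coloredSum (p : ℝ × ℝ) (i : Fin (M * 2)) :
    whitneyEmbedding f K p (Fin.castAdd 1 (Fin.natAdd 3 i)) =
      coloredSum cutoff K p (finProdFinEquiv.symm i) := by
  simp [whitneyEmbedding, embedding]

lemma whitneyEmbedding_dist (p : ℝ × ℝ) (i : Fin 1) :
    whitneyEmbedding f K p (Fin.natAdd (3 + M * 2) i) = |p.1| := by
  simp [whitneyEmbedding, embedding, setDist_singleton_singularLine]

lemma norm_le_sum_abs {n : ℕ} (v : EuclideanSpace ℝ (Fin n)) : ‖v‖ ≤ ∑ i, |v i| := by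
  rw [EuclideanSpace.norm_eq]
  refine Real.sqrt_le_iff.2 ⟨Finset.sum_nonneg fun i _ => abs_nonneg _, ?_⟩
  exact Finset.sum_sq_le_sq_sum_of_nonneg fun i _ => abs_nonneg _

lemma abs_coord_le_norm {n : ℕ} (v : EuclideanSpace ℝ (Fin n)) (i : Fin n) : |v i| ≤ ‖v‖ :=
  PiLp.norm_apply_le v i

/-- The constant in the upper bound for the coordinates of the embedding. -/
def upperConstant (L : ℝ) : ℝ :=
  (246 + 2 * nearBound * (3 * (420 * nearBound + 2))) * L +
    2 * nearBound * (4200 * nearBound + 200) + 1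

variable {f}

lemma norm_whitneyEmbedding_sub_le (hf : SqrtBiLipschitz L f) (p q : ℝ × ℝ) :
    ‖whitneyEmbedding f K p - whitneyEmbedding f K q‖ ≤
      (3 + M * 2 + 1) * upperConstant L * rdist p q := by
  have hL := hf.one_le
  have hD := rdist_nonneg p q
  have h : ∀ i ∈ Finset.univ, |(whitneyEmbedding f K p - whitneyEmbedding f K q) i| ≤
      upperConstant L * rdist p q := by
    intro i _
    rw [PiLp.sub_apply]
    unfold upperConstant
    have a1 : 0 ≤ (246 + 2 * nearBound * (3 * (420 * nearBound + 2))) * L * rdist p q := by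
      positivity
    have a2 : 0 ≤ 2 * nearBound * (4200 * nearBound + 200) * rdist p q := by positivity
    refine Fin.addCases (fun i => ?_) (fun i => ?_) i
    · refine Fin.addCases (fun i => ?_) (fun i => ?_) i
      · rw [whitneyEmbedding_extension, whitneyEmbedding_extension, ← PiLp.sub_apply]
        have := (abs_coord_le_norm _ i).trans (norm_extension_sub_extension_le hf p q)
        linarith
      · rw [whitneyEmbedding_coloredSum, whitneyEmbedding_coloredSum]
        have := abs_coloredSum_sub_le K p q (finProdFinEquiv.symm i)
        linarith
    · rw [whitneyEmbedding_dist, whitneyEmbedding_dist]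
      have := (abs_abs_sub_abs_le p.1 q.1).trans (abs_fst_sub_le_rdist p q)
      linarith
  refine (norm_le_sum_abs _).trans ((Finset.sum_le_card_nsmul _ _ _ h).trans (le_of_eq ?_))
  rw [nsmul_eq_mul, Finset.card_univ, Fintype.card_fin]
  push_cast
  ring

lemma rdist_le_norm_whitneyEmbedding_sub (hf : SqrtBiLipschitz L f)
    (hK : ∀ Q R, K Q = K R → Q.scale ≤ separation L * R.scale →
      R.scale ≤ separation L * Q.scale →
        |Q.bottom - R.bottom| ≤ separation L * Q.scale ^ 2 → Q = R) (p q : ℝ × ℝ) :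
    rdist p q ≤ lowerConstant L * ‖whitneyEmbedding f K p - whitneyEmbedding f K q‖ := by
  have hc := abs_coord_le_norm (whitneyEmbedding f K p - whitneyEmbedding f K q)
  simp only [PiLp.sub_apply] at hc
  refine rdist_le_lowerConstant_mul hf hK p q ?_ ?_ ?_
  · have := hc (Fin.natAdd (3 + M * 2) 0)
    rwa [whitneyEmbedding_dist, whitneyEmbedding_dist] at this
  -- Each of the three coordinates is at most the full norm; their sum explains the factor 3 in the
  -- hypothesis on the extension.
  · refine (norm_le_sum_abs _).trans ?_
    refine (Finset.sum_le_card_nsmul _ _ ‖whitneyEmbedding f K p - whitneyEmbedding f K q‖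
      fun i _ => ?_).trans (le_of_eq ?_)
    · have := hc (Fin.castAdd 1 (Fin.castAdd (M * 2) i))
      rwa [whitneyEmbedding_extension, whitneyEmbedding_extension] at this
    · simp
  · intro c
    have := hc (Fin.castAdd 1 (Fin.natAdd 3 (finProdFinEquiv c)))
    rwa [whitneyEmbedding_coloredSum, whitneyEmbedding_coloredSum, Equiv.symm_apply_apply] at this

end embedding

/-- For every `L` there are a coloring and a constant for which the embedding is bi-Lipschitz. -/
lemma exists_coloring_isBiLipschitzOn_embedding (L : ℝ≥0) (hL : 1 ≤ L) :
    ∃ (M : ℕ) (K : WhitneyBox → Fin M) (C : ℝ≥0), IsColoring L K ∧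
      ∀ f : ℝ × ℝ → EuclideanSpace ℝ (Fin 3), IsBiLipschitzOn L singularLine f →
        IsBiLipschitzOn C Set.univ (embedding cutoff nearestPoint K f) := by
  set c : ℝ := 2000 * (L : ℝ) ^ 2 with hc
  have hc0 : 0 ≤ c := by positivity
  have hL1 : (1 : ℝ) ≤ L := by exact_mod_cast hL
  -- One coloring serves two purposes: the first summand is what the lower bound needs, the second
  -- enforces the prescribed Whitney separation.
  set T := separation L + (3 + 2 * c) ^ 3
  have hsep : 0 ≤ separation L := by unfold separation; positivity
  have hT1 : separation L ≤ T := le_add_of_nonneg_right (by positivity)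
  have hT2 : (3 + 2 * c) ^ 3 ≤ T := le_add_of_nonneg_left hsep
  obtain ⟨M, K, hK⟩ := exists_separating_coloring T
  have hmono (t : ℝ) (ht : t ≤ T) (Q R : WhitneyBox) (h : K Q = K R) (h1 : Q.scale ≤ t * R.scale)
      (h2 : R.scale ≤ t * Q.scale) (h3 : |Q.bottom - R.bottom| ≤ t * Q.scale ^ 2) : Q = R := by
    have := Q.scale_pos
    have := R.scale_pos
    exact hK Q R h (h1.trans (by gcongr)) (h2.trans (by gcongr)) (h3.trans (by gcongr))
  have hup : 0 ≤ upperConstant L := by unfold upperConstant; positivity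
  have hlow : 1 ≤ lowerConstant L := by
    unfold lowerConstant
    rw [add_assoc 1]
    exact le_add_of_nonneg_right (by positivity)
  set C : ℝ := (3 + M * 2 + 1) * upperConstant L + lowerConstant L
  have hup' : 0 ≤ (3 + M * 2 + 1) * upperConstant L := by positivity
  have hC : 1 ≤ C := by linarith
  have hC' : ((C.toNNReal : ℝ≥0) : ℝ) = C := Real.coe_toNNReal C (by linarith)
  refine ⟨M, K, C.toNNReal, ?_, ?_⟩
  · intro Q R hne hd hKQR
    refine hne ?_
    have hd' : Q.whitneyDist R < ENNReal.ofReal c := by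
      refine hd.trans_eq ?_
      rw [hc, ENNReal.ofReal_mul (by norm_num), ENNReal.ofReal_pow (by positivity),
        ENNReal.ofReal_coe_nnreal]
      norm_num
    obtain ⟨h1, h2, h3⟩ := bounds_of_whitneyDist_lt hc0 hd'
    exact hmono _ hT2 Q R hKQR h1 h2 h3
  · intro f hf
    have hf' := hf.sqrtBiLipschitz
    refine isBiLipschitzOn_iff.2 ⟨by simpa [← NNReal.coe_le_coe, hC'] using hC, ?_⟩
    intro p _ q _
    have hD := rdist_nonneg p q
    rw [hC']
    constructor
    · refine (rdist_le_norm_whitneyEmbedding_sub K hf' (hmono _ hT1) p q).trans ?_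
      gcongr
      linarith
    · refine (norm_whitneyEmbedding_sub_le K hf' p q).trans ?_
      gcongr
      linarith

end Grushin

/-! ### Self-similar lattice curves of dimension two -/

namespace Snowflake

/-- Rotation (or reflection) of the lattice which moves the first axis to a given direction: `±x`,
`±y`, `±z` in this order. -/
def rot : Fin 6 → ℤ × ℤ × ℤ → ℤ × ℤ × ℤ
  | 0, v => v
  | 1, v => (-v.1, v.2.1, v.2.2)
  | 2, v => (v.2.1, v.1, v.2.2)
  | 3, v => (v.2.1, -v.1, v.2.2)
  | 4, v => (v.2.2, v.2.1, v.1)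
  | 5, v => (v.2.2, v.2.1, -v.1)

/-- The unit vector in a given direction. -/
def step (d : Fin 6) : ℤ × ℤ × ℤ := rot d (1, 0, 0)

/-- `v` lies in the cube of side `2 t` about the origin. -/
def InBox (t : ℤ) (v : ℤ × ℤ × ℤ) : Prop :=
  (-t ≤ v.1 ∧ v.1 ≤ t) ∧ (-t ≤ v.2.1 ∧ v.2.1 ≤ t) ∧ -t ≤ v.2.2 ∧ v.2.2 ≤ t

/-- The squares of the coordinates of `v` are at most `K`. -/
def SqLe (K : ℤ) (v : ℤ × ℤ × ℤ) : Prop := v.1 ^ 2 ≤ K ∧ v.2.1 ^ 2 ≤ K ∧ v.2.2 ^ 2 ≤ K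

/-- The cone `2 max(|y|, |z|) ≤ x`. -/
def Cone (v : ℤ × ℤ × ℤ) : Prop :=
  (-v.1 ≤ 2 * v.2.1 ∧ 2 * v.2.1 ≤ v.1) ∧ -v.1 ≤ 2 * v.2.2 ∧ 2 * v.2.2 ≤ v.1

instance (v : ℤ × ℤ × ℤ) : Decidable (Cone v) := by unfold Cone; infer_instance

/-- The double cone with vertices `0` and `(s, 0, 0)`. -/
def Diamond (s : ℤ) (v : ℤ × ℤ × ℤ) : Prop := Cone v ∧ Cone (s - v.1, v.2)

instance (s : ℤ) (v : ℤ × ℤ × ℤ) : Decidable (Diamond s v) := by unfold Diamond; infer_instance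

/-- The image of `u` under the similarity of ratio `s` which maps the first unit vector to the edge
from `a` in direction `d`. -/
def place (s : ℤ) (a : ℤ × ℤ × ℤ) (d : Fin 6) (u : ℤ × ℤ × ℤ) : ℤ × ℤ × ℤ := s • a + rot d u

/-- A sufficient condition for the double cone on an edge to lie in the double cone of length `14`.
-/
def Fits (a : ℤ × ℤ × ℤ) (d : Fin 6) : Prop :=
  (Diamond 14 a ∧ Diamond 14 (a + step d)) ∧
    (d = 2 ∨ d = 3 → Diamond 13 (a.1 - 1, 0, a.2.2) ∧ Diamond 13 (a.1, 0, a.2.2)) ∧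
    (d = 4 ∨ d = 5 → Diamond 13 (a.1 - 1, a.2.1, 0) ∧ Diamond 13 (a.1, a.2.1, 0))

instance (a : ℤ × ℤ × ℤ) (d : Fin 6) : Decidable (Fits a d) := by unfold Fits; infer_instance

/-- The directions of the edges of the generator of the snowflake. -/
def word : List (Fin 6) :=
  [0,0,0,4,2,0,0,3,4,3,1,5,1,5,0,3,0,4,2,0,5,1,5,3,5,2,1,4,1,2,0,2,0,3,0,0,4,2,5,2,2,5,0,3,5,1,4,1,
   3,3,1,2,2,4,0,3,4,3,1,1,2,0,2,4,0,2,0,0,3,4,2,1,1,3,4,0,3,1,5,3,5,0,3,5,3,1,3,0,5,1,2,5,3,0,2,4,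
   2,1,5,5,0,0,4,1,2,0,4,3,0,0,5,1,3,1,4,0,4,1,4,0,2,1,4,4,1,1,5,0,3,1,5,3,0,4,4,2,0,5,0,2,2,0,5,1,
   5,3,1,2,4,2,4,3,4,1,5,2,2,5,5,1,2,0,0,3,0,3,4,4,2,5,0,3,5,5,5,1,1,4,2,0,3,3,0,4,3,0,4,2,2,5,3,5,
   0,4,0,0]

/-- The vertices of the generator: a self-avoiding lattice path with `196` edges from the origin to
`(14, 0, 0)`. -/
def vertices : List (ℤ × ℤ × ℤ) := word.scanl (fun v d => v + step d) 0

/-- The direction of the `i`-th edge of the generator. -/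
def dir (i : ℕ) : Fin 6 := word.getD i 0

/-- The `i`-th vertex of the generator. -/
def vert (i : ℕ) : ℤ × ℤ × ℤ := vertices.getD i 0

lemma length_vertices : vertices.length = 197 := by decide +kernel

lemma nodup_vertices : vertices.Nodup := by decide +kernel

lemma vert_succ : ∀ i < 196, vert (i + 1) = vert i + step (dir i) := by decide +kernel

lemma fits_vert : ∀ i < 196, Fits (vert i) (dir i) := by decide +kernel

/-- Only the first edge meets `x < 1` and only the last one `x > 13`. This keeps all other pieces
away from the two ends of the curve. -/
lemma vert_fst_bounds : ∀ i < 196, 1 ≤ (vert (i + 1)).1 ∧ (vert i).1 ≤ 13 := by decide +kernel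

lemma vert_dir_ends : vert 0 = 0 ∧ dir 0 = 0 ∧ vert 195 = (13, 0, 0) ∧ dir 195 = 0 ∧
    vert 196 = (14, 0, 0) := by decide +kernel

lemma vert_ne {i j : ℕ} (h : i < j) (hj : j ≤ 196) : vert i ≠ vert j := by
  have hl := length_vertices
  have hi' : i < vertices.length := by omega
  have hj' : j < vertices.length := by omega
  unfold vert
  rw [List.getD_eq_getElem _ _ hi', List.getD_eq_getElem _ _ hj']
  exact fun he => h.ne (nodup_vertices.getElem_inj_iff.1 he)

lemma rot_zero (d : Fin 6) : rot d 0 = 0 := by fin_cases d <;> rfl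

lemma rot_sub (d : Fin 6) (u v : ℤ × ℤ × ℤ) : rot d (u - v) = rot d u - rot d v := by
  fin_cases d <;> ext <;> simp [rot] <;> ring

lemma rot_smul_axis (d : Fin 6) (s : ℤ) : rot d (s, 0, 0) = s • step d := by
  fin_cases d <;> ext <;> simp [rot, step]

lemma inBox_rot {d : Fin 6} {t : ℤ} {v : ℤ × ℤ × ℤ} (h : InBox t (rot d v)) : InBox t v := by
  unfold InBox at *
  fin_cases d <;> simp only [rot] at h <;> omega

lemma sqLe_rot {d : Fin 6} {K : ℤ} {v : ℤ × ℤ × ℤ} (h : SqLe K v) : SqLe K (rot d v) := by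
  obtain ⟨h1, h2, h3⟩ := h
  unfold SqLe
  fin_cases d <;> simp only [rot, neg_sq] <;>
    exact ⟨by assumption, by assumption, by assumption⟩

lemma SqLe.sub {K K' : ℤ} {v w : ℤ × ℤ × ℤ} (hv : SqLe K v) (hw : SqLe K' w) :
    SqLe (2 * (K + K')) (v - w) := by
  have h (a b k k' : ℤ) (h1 : a ^ 2 ≤ k) (h2 : b ^ 2 ≤ k') : (a - b) ^ 2 ≤ 2 * (k + k') := by
    nlinarith [sq_nonneg (a + b)]
  exact ⟨h _ _ _ _ hv.1 hw.1, h _ _ _ _ hv.2.1 hw.2.1, h _ _ _ _ hv.2.2 hw.2.2⟩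

lemma SqLe.mono {K K' : ℤ} {v : ℤ × ℤ × ℤ} (hv : SqLe K v) (h : K ≤ K') : SqLe K' v :=
  ⟨hv.1.trans h, hv.2.1.trans h, hv.2.2.trans h⟩

lemma place_sub_place (s : ℤ) (a : ℤ × ℤ × ℤ) (d : Fin 6) (u v : ℤ × ℤ × ℤ) :
    place s a d u - place s a d v = rot d (u - v) := by
  rw [rot_sub]; unfold place; abel

/-- Points of the double cones on consecutive edges. -/
lemma place_sub_place_succ (s : ℤ) (a : ℤ × ℤ × ℤ) (d d' : Fin 6) (u v : ℤ × ℤ × ℤ) :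
    place s (a + step d) d' v - place s a d u = rot d' v - rot d (u - (s, 0, 0)) := by
  rw [rot_sub, rot_smul_axis]; unfold place
  rw [smul_add]; abel

/-- Edges along the axis need only their end points in the large double cone. A transversal edge
bulges by up to `s / 4` both along the axis and in the third direction, where it counts twice. This
uses up `3 * s / 4` of the slack, and the extra conditions of `Fits` provide a slack of `s`. -/
lemma diamond_place {s : ℤ} (hs : 0 ≤ s) {a : ℤ × ℤ × ℤ} {d : Fin 6} (h : Fits a d)
    {u : ℤ × ℤ × ℤ} (hu : Diamond s u) : Diamond (14 * s) (place s a d u) := by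
  obtain ⟨X, Y, Z⟩ := a
  obtain ⟨x, y, z⟩ := u
  obtain ⟨⟨h1, h2⟩, h3, h4⟩ := h
  have mul {b c : ℤ} (h : b ≤ c) : s * b ≤ s * c := mul_le_mul_of_nonneg_left h hs
  simp only [Diamond, Cone] at h1 h2 hu ⊢
  obtain ⟨⟨⟨a1, a2⟩, a3, a4⟩, ⟨a5, a6⟩, a7, a8⟩ := h1
  obtain ⟨⟨⟨b1, b2⟩, b3, b4⟩, ⟨b5, b6⟩, b7, b8⟩ := h2
  obtain ⟨⟨⟨u1, u2⟩, u3, u4⟩, ⟨u5, u6⟩, u7, u8⟩ := hu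
  replace a1 := mul a1; replace a2 := mul a2; replace a3 := mul a3; replace a4 := mul a4
  replace a5 := mul a5; replace a6 := mul a6; replace a7 := mul a7; replace a8 := mul a8
  replace b1 := mul b1; replace b2 := mul b2; replace b3 := mul b3; replace b4 := mul b4
  replace b5 := mul b5; replace b6 := mul b6; replace b7 := mul b7; replace b8 := mul b8
  have key : (d = 2 ∨ d = 3 → (2 * (s * Z) ≤ s * X - s ∧ -(2 * (s * Z)) ≤ s * X - s) ∧
      (2 * (s * Z) ≤ 13 * s - s * X ∧ -(2 * (s * Z)) ≤ 13 * s - s * X)) ∧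
      (d = 4 ∨ d = 5 → (2 * (s * Y) ≤ s * X - s ∧ -(2 * (s * Y)) ≤ s * X - s) ∧
      (2 * (s * Y) ≤ 13 * s - s * X ∧ -(2 * (s * Y)) ≤ 13 * s - s * X)) := by
    refine ⟨fun hd => ?_, fun hd => ?_⟩
    · obtain ⟨⟨⟨-, c1, c2⟩, -⟩, -, -, c3, c4⟩ := h3 hd
      simp only at c1 c2 c3 c4
      refine ⟨⟨?_, ?_⟩, ?_, ?_⟩ <;> nlinarith
    · obtain ⟨⟨⟨⟨c1, c2⟩, -⟩, -⟩, -, ⟨c3, c4⟩, -⟩ := h4 hd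
      simp only at c1 c2 c3 c4
      refine ⟨⟨?_, ?_⟩, ?_, ?_⟩ <;> nlinarith
  obtain ⟨k1, k2⟩ := key
  clear h3 h4
  fin_cases d <;>
  simp only [place, rot, step, Fin.reduceFinMk, Fin.isValue, Prod.smul_mk,
    Prod.mk_add_mk, smul_eq_mul, Fin.reduceEq, or_false, or_true, or_self,
    forall_const, IsEmpty.forall_iff] at *
  · clear k1 k2
    refine ⟨⟨⟨?_, ?_⟩, ?_, ?_⟩, ⟨?_, ?_⟩, ?_, ?_⟩ <;> linarith
  · clear k1 k2
    refine ⟨⟨⟨?_, ?_⟩, ?_, ?_⟩, ⟨?_, ?_⟩, ?_, ?_⟩ <;> linarith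
  · obtain ⟨⟨c1, c2⟩, c3, c4⟩ := k1
    refine ⟨⟨⟨?_, ?_⟩, ?_, ?_⟩, ⟨?_, ?_⟩, ?_, ?_⟩ <;> linarith
  · obtain ⟨⟨c1, c2⟩, c3, c4⟩ := k1
    refine ⟨⟨⟨?_, ?_⟩, ?_, ?_⟩, ⟨?_, ?_⟩, ?_, ?_⟩ <;> linarith
  · obtain ⟨⟨c1, c2⟩, c3, c4⟩ := k2
    refine ⟨⟨⟨?_, ?_⟩, ?_, ?_⟩, ⟨?_, ?_⟩, ?_, ?_⟩ <;> linarith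
  · obtain ⟨⟨c1, c2⟩, c3, c4⟩ := k2
    refine ⟨⟨⟨?_, ?_⟩, ?_, ?_⟩, ⟨?_, ?_⟩, ?_, ?_⟩ <;> linarith

/-- The double cone on an edge is close to the edge, in each coordinate. -/
lemma place_bounds {s : ℤ} {a : ℤ × ℤ × ℤ} {d : Fin 6} {u : ℤ × ℤ × ℤ} (hu : Diamond s u) :
    ((4 * (s * a.1) - s ≤ 4 * (place s a d u).1 ∨
        4 * (s * (a + step d).1) - s ≤ 4 * (place s a d u).1) ∧
      (4 * (place s a d u).1 ≤ 4 * (s * a.1) + s ∨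
        4 * (place s a d u).1 ≤ 4 * (s * (a + step d).1) + s)) ∧
    ((4 * (s * a.2.1) - s ≤ 4 * (place s a d u).2.1 ∨
        4 * (s * (a + step d).2.1) - s ≤ 4 * (place s a d u).2.1) ∧
      (4 * (place s a d u).2.1 ≤ 4 * (s * a.2.1) + s ∨
        4 * (place s a d u).2.1 ≤ 4 * (s * (a + step d).2.1) + s)) ∧
    ((4 * (s * a.2.2) - s ≤ 4 * (place s a d u).2.2 ∨
        4 * (s * (a + step d).2.2) - s ≤ 4 * (place s a d u).2.2) ∧
      (4 * (place s a d u).2.2 ≤ 4 * (s * a.2.2) + s ∨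
        4 * (place s a d u).2.2 ≤ 4 * (s * (a + step d).2.2) + s)) := by
  obtain ⟨X, Y, Z⟩ := a
  obtain ⟨x, y, z⟩ := u
  obtain ⟨⟨⟨u1, u2⟩, u3, u4⟩, ⟨u5, u6⟩, u7, u8⟩ := hu
  fin_cases d <;>
  simp only [place, rot, step, Prod.smul_mk, Prod.mk_add_mk, smul_eq_mul, mul_add, mul_neg, mul_one, mul_zero] at * <;> omega

/-- The intervals with end points `a`, `b` and `a'`, `b'` have distance at least one. -/
def Separated (a b a' b' : ℤ) : Prop :=
  (a + 1 ≤ a' ∧ a + 1 ≤ b' ∧ b + 1 ≤ a' ∧ b + 1 ≤ b') ∨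
    (a' + 1 ≤ a ∧ b' + 1 ≤ a ∧ a' + 1 ≤ b ∧ b' + 1 ≤ b)

/-- Intervals of length at most one with integral end points either share an end point or are at
least one apart. -/
lemma separated_or {a a' i i' : ℤ} (h : i = 0 ∨ i = 1 ∨ i = -1)
    (h' : i' = 0 ∨ i' = 1 ∨ i' = -1) :
    Separated a (a + i) a' (a' + i') ∨ a = a' ∨ a = a' + i' ∨ a + i = a' ∨ a + i = a' + i' := by
  unfold Separated; omega

lemma step_cases (d : Fin 6) : ∃ i j k : ℤ, step d = (i, j, k) ∧ (i = 0 ∨ i = 1 ∨ i = -1) ∧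
    (j = 0 ∨ j = 1 ∨ j = -1) ∧ (k = 0 ∨ k = 1 ∨ k = -1) ∧
      ((j = 0 ∧ k = 0) ∨ (i = 0 ∧ k = 0) ∨ (i = 0 ∧ j = 0)) := by
  fin_cases d <;> exact ⟨_, _, _, rfl, by decide⟩

/-- Lattice edges without a common end point are separated by a slab of width one. -/
lemma edges_separated {a a' : ℤ × ℤ × ℤ} {d d' : Fin 6} (h1 : a ≠ a') (h2 : a ≠ a' + step d')
    (h3 : a + step d ≠ a') (h4 : a + step d ≠ a' + step d') :
    Separated a.1 (a + step d).1 a'.1 (a' + step d').1 ∨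
    Separated a.2.1 (a + step d).2.1 a'.2.1 (a' + step d').2.1 ∨
    Separated a.2.2 (a + step d).2.2 a'.2.2 (a' + step d').2.2 := by
  obtain ⟨X, Y, Z⟩ := a
  obtain ⟨X', Y', Z'⟩ := a'
  obtain ⟨i, j, k, e, hi, hj, hk, h⟩ := step_cases d
  obtain ⟨i', j', k', e', hi', hj', hk', h'⟩ := step_cases d'
  rw [e] at h3 h4 ⊢
  rw [e'] at h2 h4 ⊢
  simp only [Prod.mk_add_mk, ne_eq, Prod.mk.injEq] at h1 h2 h3 h4 ⊢
  rcases separated_or (a := X) hi hi' with s1 | s1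
  · exact Or.inl s1
  rcases separated_or (a := Y) hj hj' with s2 | s2
  · exact Or.inr (Or.inl s2)
  rcases separated_or (a := Z) hk hk' with s3 | s3
  · exact Or.inr (Or.inr s3)
  exfalso
  clear e e' hi hj hk hi' hj' hk'
  rcases h with ⟨rfl, rfl⟩ | ⟨rfl, rfl⟩ | ⟨rfl, rfl⟩ <;>
  rcases h' with ⟨rfl, rfl⟩ | ⟨rfl, rfl⟩ | ⟨rfl, rfl⟩ <;>
  simp only [add_zero, or_self] at h1 h2 h3 h4 s1 s2 s3 <;> grind

/-- The edges, scaled by `s`, are separated by a slab of width `s`. Each double cone intrudes into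
it by at most `s / 4`, leaving a gap of at least `s / 2`. -/
lemma le_of_inBox_place_sub {s t : ℤ} (hs : 0 ≤ s) {a a' : ℤ × ℤ × ℤ} {d d' : Fin 6} (h1 : a ≠ a')
    (h2 : a ≠ a' + step d') (h3 : a + step d ≠ a') (h4 : a + step d ≠ a' + step d')
    {u v : ℤ × ℤ × ℤ} (hu : Diamond s u) (hv : Diamond s v)
    (h : InBox t (place s a' d' v - place s a d u)) : s ≤ 2 * t := by
  have bu := place_bounds (a := a) (d := d) hu
  have bv := place_bounds (a := a') (d := d') hv
  have hsep := edges_separated h1 h2 h3 h4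
  have mul {b c : ℤ} (h : b + 1 ≤ c) : s * b + s ≤ s * c := by nlinarith
  obtain ⟨⟨t1, t2⟩, ⟨t3, t4⟩, t5, t6⟩ := h
  simp only [Prod.fst_sub, Prod.snd_sub] at t1 t2 t3 t4 t5 t6
  obtain ⟨bu1, bu2, bu3⟩ := bu
  obtain ⟨bv1, bv2, bv3⟩ := bv
  rcases hsep with h | h | h
  · clear bu2 bu3 bv2 bv3
    rcases h with ⟨c1, c2, c3, c4⟩ | ⟨c1, c2, c3, c4⟩ <;>
    · replace c1 := mul c1; replace c2 := mul c2; replace c3 := mul c3; replace c4 := mul c4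
      omega
  · clear bu1 bu3 bv1 bv3
    rcases h with ⟨c1, c2, c3, c4⟩ | ⟨c1, c2, c3, c4⟩ <;>
    · replace c1 := mul c1; replace c2 := mul c2; replace c3 := mul c3; replace c4 := mul c4
      omega
  · clear bu1 bu2 bv1 bv2
    rcases h with ⟨c1, c2, c3, c4⟩ | ⟨c1, c2, c3, c4⟩ <;>
    · replace c1 := mul c1; replace c2 := mul c2; replace c3 := mul c3; replace c4 := mul c4
      omega

/-- Cones about two unit vectors which are not opposite to each other are separated. -/
lemma le_of_inBox_cone_sub {t : ℤ} {d d' : Fin 6} (hd : step d + step d' ≠ 0)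
    {g h : ℤ × ℤ × ℤ} (hg : Cone (-g.1, g.2)) (hh : Cone h) (hb : InBox t (rot d' h - rot d g)) :
    -g.1 ≤ 2 * t ∧ h.1 ≤ 2 * t := by
  obtain ⟨x, y, z⟩ := g
  obtain ⟨x', y', z'⟩ := h
  simp only [Cone] at hg hh
  fin_cases d <;> fin_cases d' <;>
  first
  | exact absurd rfl hd
  | simp only [InBox, rot, Prod.fst_sub, Prod.snd_sub] at hb
    omega

/-- `P` is a lattice curve of `s ^ 2` steps from the origin to `(s, 0, 0)` which satisfies the
estimates of a snowflake of dimension two. -/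
structure IsSnowflake (s : ℤ) (n : ℕ) (P : ℕ → ℤ × ℤ × ℤ) : Prop where
  one_le : 1 ≤ s
  card_eq : (n : ℤ) = s ^ 2
  diamond : ∀ j ≤ n, Diamond s (P j)
  start : P 0 = 0
  finish : P n = (s, 0, 0)
  left_lower : ∀ j ≤ n, (j : ℤ) ≤ 392 * (P j).1 ^ 2
  right_lower : ∀ j ≤ n, (n : ℤ) - j ≤ 392 * (s - (P j).1) ^ 2
  lower : ∀ i j, i ≤ j → j ≤ n → ∀ t, InBox t (P j - P i) → (j : ℤ) - i ≤ 3136 * t ^ 2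
  left_upper : ∀ j ≤ n, SqLe (196 * j) (P j)
  right_upper : ∀ j ≤ n, SqLe (196 * (n - j)) (P j - (s, 0, 0))
  upper : ∀ i j, i ≤ j → j ≤ n → SqLe (392 * (j - i)) (P j - P i)

lemma isSnowflake_one : IsSnowflake 1 1 (fun j => (j, 0, 0)) where
  one_le := le_rfl
  card_eq := rfl
  diamond j hj := by interval_cases j <;> decide
  start := rfl
  finish := rfl
  left_lower j hj := by interval_cases j <;> decide
  right_lower j hj := by interval_cases j <;> decide
  lower i j hij hj t h := by
    have h1 := h.1.2
    simp only [Prod.fst_sub] at h1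
    interval_cases j <;> interval_cases i <;> simp at h1 ⊢ <;> nlinarith
  left_upper j hj := by interval_cases j <;> unfold SqLe <;> decide
  right_upper j hj := by interval_cases j <;> unfold SqLe <;> decide
  upper i j hij hj := by
    interval_cases j <;> interval_cases i <;> unfold SqLe <;> decide

/-- Replace each edge of the generator by a copy of `P`. -/
def subdivide (s : ℤ) (n : ℕ) (P : ℕ → ℤ × ℤ × ℤ) (j : ℕ) : ℤ × ℤ × ℤ :=
  place s (vert (j / n)) (dir (j / n)) (P (j % n))

lemma IsSnowflake.pos {s : ℤ} {n : ℕ} {P : ℕ → ℤ × ℤ × ℤ} (h : IsSnowflake s n P) : 0 < n := by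
  have h1 := h.one_le
  have h2 := h.card_eq
  have : (0 : ℤ) < n := by rw [h2]; positivity
  exact_mod_cast this

lemma subdivide_block {s : ℤ} {n : ℕ} {P : ℕ → ℤ × ℤ × ℤ} (h : IsSnowflake s n P) {q r : ℕ}
    (hq : q < 196) (hr : r ≤ n) :
    subdivide s n P (q * n + r) = place s (vert q) (dir q) (P r) := by
  have hn := h.pos
  unfold subdivide
  rcases hr.lt_or_eq with hr | rfl
  · rw [mul_comm, Nat.mul_add_div hn, Nat.div_eq_of_lt hr, Nat.mul_add_mod, Nat.mod_eq_of_lt hr,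
      add_zero]
  -- The index belongs to the next block, whose start is the end of this edge. For `q = 195` the
  -- direction of that block is a default value, which is harmless since `rot` fixes the origin.
  · have e : q * r + r = (q + 1) * r := by ring
    rw [e, Nat.mul_div_cancel _ hn, Nat.mul_mod_left, h.start, h.finish, vert_succ q hq]
    unfold place
    rw [rot_zero, rot_smul_axis, smul_add, add_zero]

/-- Division with remainder, except that the final index becomes the end of the last block instead
of the start of a nonexistent one. -/
lemma exists_block {n j : ℕ} (hn : 0 < n) (hj : j ≤ 196 * n) :
    ∃ q r, q < 196 ∧ r ≤ n ∧ (r = n → q = 195) ∧ j = q * n + r := by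
  rcases hj.lt_or_eq with hj | rfl
  · refine ⟨j / n, j % n, (Nat.div_lt_iff_lt_mul hn).2 hj, (Nat.mod_lt j hn).le,
      fun h => absurd h (Nat.mod_lt j hn).ne, ?_⟩
    rw [mul_comm]; exact (Nat.div_add_mod j n).symm
  · exact ⟨195, n, by norm_num, le_rfl, fun _ => rfl, by ring⟩

lemma sqLe_of_diamond {s : ℤ} {v : ℤ × ℤ × ℤ} (h : Diamond s v) :
    SqLe (s ^ 2) v ∧ SqLe (s ^ 2) (v - (s, 0, 0)) := by
  obtain ⟨⟨⟨u1, u2⟩, u3, u4⟩, ⟨u5, u6⟩, u7, u8⟩ := h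
  simp only at u5 u6 u7 u8
  refine ⟨⟨?_, ?_, ?_⟩, ?_, ?_, ?_⟩ <;> try simp only [Prod.fst_sub, Prod.snd_sub, sub_zero]
  all_goals exact sq_le_sq' (by omega) (by omega)

lemma sqLe_sub_of_diamond {s : ℤ} {v w : ℤ × ℤ × ℤ} (hv : Diamond s v) (hw : Diamond s w) :
    SqLe (s ^ 2) (w - v) := by
  obtain ⟨⟨⟨u1, u2⟩, u3, u4⟩, ⟨u5, u6⟩, u7, u8⟩ := hv
  obtain ⟨⟨⟨v1, v2⟩, v3, v4⟩, ⟨v5, v6⟩, v7, v8⟩ := hw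
  simp only at u5 u6 u7 u8 v5 v6 v7 v8
  refine ⟨?_, ?_, ?_⟩ <;> simp only [Prod.fst_sub, Prod.snd_sub] <;>
    exact sq_le_sq' (by omega) (by omega)

/-- The constants are reproduced because each pair of indices falls into one of three cases. On one
edge the estimates are inherited. On consecutive edges the one-sided estimates at the common vertex
are combined: from below through the separation of the cones, from above by `(a - b) ^ 2 ≤ 2 * (a ^
2 + b ^ 2)`. On other edges the points are at least `s / 2` apart and their indices differ by at
least `s ^ 2` and at most `196 * s ^ 2`, so crude bounds suffice. -/
lemma IsSnowflake.subdivide {s : ℤ} {n : ℕ} {P : ℕ → ℤ × ℤ × ℤ} (h : IsSnowflake s n P) :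
    IsSnowflake (14 * s) (196 * n) (subdivide s n P) := by
  have hs := h.one_le
  have hs0 : 0 ≤ s := by linarith
  have hn := h.pos
  have hcard := h.card_eq
  obtain ⟨v0, d0, v195, d195, v196⟩ := vert_dir_ends
  have hdiam : ∀ j ≤ 196 * n, Diamond (14 * s) (Snowflake.subdivide s n P j) := by
    intro j hj
    obtain ⟨q, r, hq, hr, -, rfl⟩ := exists_block hn hj
    rw [subdivide_block h hq hr]
    exact diamond_place hs0 (fits_vert q hq) (h.diamond r hr)
  have hfirst : ∀ r ≤ n, Snowflake.subdivide s n P (0 * n + r) = P r := by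
    intro r hr
    rw [subdivide_block h (by norm_num) hr, v0, d0]
    simp [place, rot]
  have hlast : ∀ r ≤ n, Snowflake.subdivide s n P (195 * n + r) = (13 * s, 0, 0) + P r := by
    intro r hr
    rw [subdivide_block h (by norm_num) hr, v195, d195]
    simp [place, rot, mul_comm]
  exact
  { one_le := by linarith
    card_eq := by push_cast; rw [hcard]; ring
    diamond := hdiam
    start := by
      have := hfirst 0 hn.le
      rw [h.start] at this
      simpa using this
    finish := by
      have := hlast n le_rfl
      rw [h.finish] at this
      rw [show 196 * n = 195 * n + n by ring, this]
      ext <;> simp; ring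
    left_lower := by
      intro j hj
      obtain ⟨q, r, hq, hr, -, rfl⟩ := exists_block hn hj
      rcases Nat.eq_zero_or_pos q with rfl | hq0
      · rw [hfirst r hr, zero_mul, zero_add]
        exact h.left_lower r hr
      · rw [subdivide_block h hq hr]
        have b1 := (vert_fst_bounds q hq).1
        have b2 := (vert_fst_bounds (q - 1) (by omega)).1
        rw [Nat.sub_add_cancel hq0] at b2
        rw [vert_succ q hq] at b1
        have b3 : s * 1 ≤ s * (vert q).1 := mul_le_mul_of_nonneg_left b2 hs0
        have b4 : s * 1 ≤ s * (vert q + step (dir q)).1 := mul_le_mul_of_nonneg_left b1 hs0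
        have b := (place_bounds (a := vert q) (d := dir q) (h.diamond r hr)).1.1
        -- Past the first edge the curve stays beyond `x = 3 * s / 4`, and `392 * 9 / 16 > 196`
        -- covers all remaining indices.
        have b5 : 3 * s ≤ 4 * (place s (vert q) (dir q) (P r)).1 := by omega
        have hj' : ((q * n + r : ℕ) : ℤ) ≤ 196 * s ^ 2 := by rw [← hcard]; exact_mod_cast hj
        nlinarith
    right_lower := by
      intro j hj
      obtain ⟨q, r, hq, hr, -, rfl⟩ := exists_block hn hj
      rcases eq_or_ne q 195 with rfl | hq'
      · rw [hlast r hr]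
        have := h.right_lower r hr
        have e : 14 * s - ((13 * s, 0, 0) + P r).1 = s - (P r).1 := by simp; ring
        rw [e]
        push_cast
        linarith
      · rw [subdivide_block h hq hr]
        have b1 := (vert_fst_bounds (q + 1) (by omega)).2
        have b2 := (vert_fst_bounds q hq).2
        rw [vert_succ q hq] at b1
        have b3 : s * (vert q).1 ≤ s * 13 := mul_le_mul_of_nonneg_left b2 hs0
        have b4 : s * (vert q + step (dir q)).1 ≤ s * 13 := mul_le_mul_of_nonneg_left b1 hs0
        have b := (place_bounds (a := vert q) (d := dir q) (h.diamond r hr)).1.2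
        have b5 : 4 * (place s (vert q) (dir q) (P r)).1 ≤ 53 * s := by omega
        have hj' : ((196 * n : ℕ) : ℤ) = 196 * s ^ 2 := by rw [← hcard]; push_cast; ring
        have hj'' : (0 : ℤ) ≤ ((q * n + r : ℕ) : ℤ) := by positivity
        rw [hj']
        nlinarith
    lower := by
      intro i j hij hj t ht
      obtain ⟨q, r, hq, hr, hr', rfl⟩ := exists_block hn (hij.trans hj)
      obtain ⟨q', r', hq', hr1, hr1', rfl⟩ := exists_block hn hj
      rw [subdivide_block h hq hr, subdivide_block h hq' hr1] at ht
      have hqq : q ≤ q' := by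
        by_contra! hc
        have h1 : r' < n := lt_of_le_of_ne hr1 fun e => by have := hr1' e; omega
        have h2 : (q' + 1) * n ≤ q * n := Nat.mul_le_mul_right n hc
        have : (q' + 1) * n = q' * n + n := by ring
        omega
      rcases eq_or_ne q q' with rfl | hne
      · rw [place_sub_place] at ht
        have := h.lower r r' (by omega) hr1 t (inBox_rot ht)
        push_cast; linarith
      rcases eq_or_ne q' (q + 1) with rfl | hne'
      · rw [vert_succ q hq, place_sub_place_succ] at ht
        -- Consecutive edges in opposite directions would make the generator return to a vertex. The
        -- cone lemma then applies, and `392 * (2 ^ 2 + 2 ^ 2) = 3136` is the constant of `lower`.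
        have hd : step (dir q) + step (dir (q + 1)) ≠ 0 := by
          intro h0
          have := vert_ne (show q < q + 2 by omega) (by omega)
          rw [vert_succ (q + 1) hq', vert_succ q hq, add_assoc, h0, add_zero] at this
          exact this rfl
        have hc : Cone (-(P r - (s, 0, 0)).1, (P r - (s, 0, 0)).2) := by
          have := (h.diamond r hr).2
          have e : (P r - (s, 0, 0)).2 = (P r).2 := sub_zero _
          rw [e]
          simpa using this
        obtain ⟨c1, c2⟩ := le_of_inBox_cone_sub hd hc (h.diamond r' hr1).1 ht
        have e1 := h.right_lower r hr
        have e2 := h.left_lower r' hr1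
        have c0 : 0 ≤ (P r').1 := by
          have := (h.diamond r' hr1).1.1
          omega
        have c0' : 0 ≤ s - (P r).1 := by
          have := (h.diamond r hr).2.1
          simp only at this
          omega
        simp only [Prod.fst_sub, neg_sub] at c1
        have f1 : (s - (P r).1) ^ 2 ≤ (2 * t) ^ 2 := by gcongr
        have f2 : (P r').1 ^ 2 ≤ (2 * t) ^ 2 := by gcongr
        push_cast
        linarith
      · have hst := le_of_inBox_place_sub hs0 (vert_ne (show q < q' by omega) (by omega))
          (by rw [← vert_succ q' hq']; exact vert_ne (by omega) (by omega))
          (by rw [← vert_succ q hq]; exact vert_ne (by omega) (by omega))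
          (by rw [← vert_succ q hq, ← vert_succ q' hq']; exact vert_ne (by omega) (by omega))
          (h.diamond r hr) (h.diamond r' hr1) ht
        have hj' : ((q' * n + r' : ℕ) : ℤ) ≤ 196 * s ^ 2 := by rw [← hcard]; exact_mod_cast hj
        have hi : (0 : ℤ) ≤ ((q * n + r : ℕ) : ℤ) := by positivity
        nlinarith
    left_upper := by
      intro j hj
      obtain ⟨q, r, hq, hr, -, rfl⟩ := exists_block hn hj
      rcases Nat.eq_zero_or_pos q with rfl | hq0
      · rw [hfirst r hr, zero_mul, zero_add]
        exact h.left_upper r hr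
      · have hd := hdiam _ hj
        have hj' : s ^ 2 ≤ ((q * n + r : ℕ) : ℤ) := by
          rw [← hcard]
          have : n ≤ q * n + r := by nlinarith
          exact_mod_cast this
        exact (sqLe_of_diamond hd).1.mono (by linarith)
    right_upper := by
      intro j hj
      obtain ⟨q, r, hq, hr, -, rfl⟩ := exists_block hn hj
      rcases eq_or_ne q 195 with rfl | hq'
      · rw [hlast r hr]
        have e : (13 * s, 0, 0) + P r - (14 * s, 0, 0) = P r - (s, 0, 0) := by
          ext <;> simp; ring
        rw [e]
        refine (h.right_upper r hr).mono (le_of_eq ?_)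
        push_cast; ring
      · have hd := hdiam _ hj
        have hj' : s ^ 2 ≤ ((196 * n : ℕ) : ℤ) - ((q * n + r : ℕ) : ℤ) := by
          rw [← hcard]
          have : (q + 1) * n ≤ 195 * n := Nat.mul_le_mul_right n (by omega)
          have : (q + 1) * n = q * n + n := by ring
          omega
        exact (sqLe_of_diamond hd).2.mono (by linarith)
    upper := by
      intro i j hij hj
      have hi := hij.trans hj
      have di := hdiam i hi
      have dj := hdiam j hj
      obtain ⟨q, r, hq, hr, hr', rfl⟩ := exists_block hn hi
      obtain ⟨q', r', hq', hr1, hr1', rfl⟩ := exists_block hn hj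
      have hqq : q ≤ q' := by
        by_contra! hc
        have h1 : r' < n := lt_of_le_of_ne hr1 fun e => by have := hr1' e; omega
        have h2 : (q' + 1) * n ≤ q * n := Nat.mul_le_mul_right n hc
        have : (q' + 1) * n = q' * n + n := by ring
        omega
      rcases eq_or_ne q q' with rfl | hne
      · rw [subdivide_block h hq hr, subdivide_block h hq' hr1, place_sub_place]
        refine (sqLe_rot (h.upper r r' (by omega) hr1)).mono (le_of_eq ?_)
        push_cast; ring
      rcases eq_or_ne q' (q + 1) with rfl | hne'
      · rw [subdivide_block h hq hr, subdivide_block h hq' hr1, vert_succ q hq, place_sub_place_succ]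
        refine ((sqLe_rot (h.left_upper r' hr1)).sub (sqLe_rot (h.right_upper r hr))).mono
          (le_of_eq ?_)
        push_cast; ring
      · have hj' : s ^ 2 ≤ ((q' * n + r' : ℕ) : ℤ) - ((q * n + r : ℕ) : ℤ) := by
          rw [← hcard]
          have : (q + 2) * n ≤ q' * n := Nat.mul_le_mul_right n (by omega)
          have : (q + 2) * n = q * n + n + n := by ring
          omega
        exact (sqLe_sub_of_diamond di dj).mono (by linarith) }

lemma exists_isSnowflake (k : ℕ) : ∃ P, IsSnowflake (14 ^ k) (196 ^ k) P := by
  induction k with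
  | zero => exact ⟨_, by simpa using isSnowflake_one⟩
  | succ k ih =>
    obtain ⟨P, hP⟩ := ih
    exact ⟨_, by simpa only [pow_succ'] using hP.subdivide⟩

end Snowflake

/-! ### Passage to the limit: the snowflake line in Euclidean space -/

namespace Snowflake

open Filter Topology

/-- The point of `ℝ³` with given integral coordinates. -/
def toEuclidean (v : ℤ × ℤ × ℤ) : EuclideanSpace ℝ (Fin 3) := !₂[(v.1 : ℝ), (v.2.1 : ℝ), (v.2.2 : ℝ)]

lemma toEuclidean_sub (v w : ℤ × ℤ × ℤ) : toEuclidean (v - w) = toEuclidean v - toEuclidean w := by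
  ext i; fin_cases i <;> simp [toEuclidean]

lemma norm_toEuclidean_sq (v : ℤ × ℤ × ℤ) :
    ‖toEuclidean v‖ ^ 2 = (v.1 : ℝ) ^ 2 + (v.2.1 : ℝ) ^ 2 + (v.2.2 : ℝ) ^ 2 := by
  rw [EuclideanSpace.norm_sq_eq, Fin.sum_univ_three]
  simp [toEuclidean]

lemma exists_inBox (v : ℤ × ℤ × ℤ) : ∃ t, InBox t v ∧ (t : ℝ) ^ 2 ≤ ‖toEuclidean v‖ ^ 2 := by
  refine ⟨max |v.1| (max |v.2.1| |v.2.2|), ?_, ?_⟩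
  · simp only [InBox, ← abs_le]
    exact ⟨le_max_left _ _, le_max_of_le_right (le_max_left _ _),
      le_max_of_le_right (le_max_right _ _)⟩
  · rw [norm_toEuclidean_sq]
    have h1 := sq_nonneg (v.1 : ℝ)
    have h2 := sq_nonneg (v.2.1 : ℝ)
    have h3 := sq_nonneg (v.2.2 : ℝ)
    rcases max_choice |v.1| (max |v.2.1| |v.2.2|) with h | h
    · rw [h, Int.cast_abs, sq_abs]; linarith
    · rw [h]
      rcases max_choice |v.2.1| |v.2.2| with h | h <;>
      · rw [h, Int.cast_abs, sq_abs]; linarith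

lemma IsSnowflake.norm_bounds {s : ℤ} {n : ℕ} {P : ℕ → ℤ × ℤ × ℤ} (h : IsSnowflake s n P)
    {i j : ℕ} (hi : i ≤ n) (hj : j ≤ n) :
    |(i : ℝ) - j| ≤ 3136 * ‖toEuclidean (P i) - toEuclidean (P j)‖ ^ 2 ∧
      ‖toEuclidean (P i) - toEuclidean (P j)‖ ^ 2 ≤ 1176 * |(i : ℝ) - j| := by
  wlog hij : i ≤ j generalizing i j
  · rw [abs_sub_comm, norm_sub_rev]
    exact this hj hi (by omega)
  rw [norm_sub_rev, ← toEuclidean_sub, abs_sub_comm,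
    abs_of_nonneg (sub_nonneg.2 (Nat.cast_le.2 hij) : (0 : ℝ) ≤ j - i)]
  constructor
  · obtain ⟨t, ht, ht'⟩ := exists_inBox (P j - P i)
    have h1 : ((j : ℤ) - i : ℝ) ≤ 3136 * (t : ℝ) ^ 2 := by exact_mod_cast h.lower i j hij hj t ht
    push_cast at h1
    linarith
  · obtain ⟨h1, h2, h3⟩ := h.upper i j hij hj
    rw [norm_toEuclidean_sq]
    have h1' : (((P j - P i).1 : ℤ) : ℝ) ^ 2 ≤ 392 * ((j : ℝ) - i) := by exact_mod_cast h1
    have h2' : (((P j - P i).2.1 : ℤ) : ℝ) ^ 2 ≤ 392 * ((j : ℝ) - i) := by exact_mod_cast h2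
    have h3' : (((P j - P i).2.2 : ℤ) : ℝ) ^ 2 ≤ 392 * ((j : ℝ) - i) := by exact_mod_cast h3
    linarith

/-- Rescaled snowflake curves on large intervals which approximate a snowflake line. -/
lemma exists_approximate_snowflake (k : ℕ) : ∃ f : ℝ → EuclideanSpace ℝ (Fin 3), f 0 = 0 ∧
    ∀ y y' : ℝ, |y| ≤ 2 ^ k → |y'| ≤ 2 ^ k →
      |y - y'| - (196 ^ k : ℝ)⁻¹ ≤ 3136 * ‖f y - f y'‖ ^ 2 ∧
      ‖f y - f y'‖ ^ 2 ≤ 1176 * (|y - y'| + (196 ^ k : ℝ)⁻¹) := by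
  -- The interval `[-2 ^ k, 2 ^ k]` is sampled with mesh `196 ^ (-k)`, which needs `2 * N` steps; a
  -- curve with `196 ^ (2 * k + 1)` steps is long enough. Shrinking by `14 ^ k`, the square root of
  -- `196 ^ k`, matches the metric.
  obtain ⟨P, hP⟩ := exists_isSnowflake (2 * k + 1)
  set N : ℕ := 196 ^ k * 2 ^ k with hN
  let idx : ℝ → ℕ := fun y => (⌊(196 : ℝ) ^ k * y⌋ + N).toNat
  have hlarge : 2 * N ≤ 196 ^ (2 * k + 1) := by
    rw [pow_succ, two_mul k, pow_add, hN]
    have h1 : (2 : ℕ) ^ k ≤ 196 ^ k := Nat.pow_le_pow_left (by norm_num) k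
    calc 2 * (196 ^ k * 2 ^ k) ≤ 196 * (196 ^ k * 196 ^ k) := by gcongr; norm_num
      _ = _ := by ring
  have hidx (y : ℝ) (hy : |y| ≤ 2 ^ k) :
      idx y ≤ 196 ^ (2 * k + 1) ∧ (idx y : ℝ) = ⌊(196 : ℝ) ^ k * y⌋ + N := by
    obtain ⟨h1, h2⟩ := abs_le.1 hy
    have h3 : -(N : ℤ) ≤ ⌊(196 : ℝ) ^ k * y⌋ := by
      rw [Int.le_floor, hN]
      push_cast
      rw [← mul_neg]
      gcongr
    have h4 : ⌊(196 : ℝ) ^ k * y⌋ ≤ (N : ℤ) := by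
      have : (⌊(196 : ℝ) ^ k * y⌋ : ℝ) ≤ ((N : ℤ) : ℝ) := by
        refine (Int.floor_le _).trans ?_
        rw [hN]
        push_cast
        gcongr
      exact_mod_cast this
    have h5 : ((idx y : ℕ) : ℤ) = ⌊(196 : ℝ) ^ k * y⌋ + N := Int.toNat_of_nonneg (by omega)
    refine ⟨?_, by exact_mod_cast h5⟩
    omega
  have h14 : ((14 : ℝ) ^ k) ^ 2 = 196 ^ k := by rw [← pow_mul, mul_comm, pow_mul]; norm_num
  -- Sending the origin to the origin keeps the values at each fixed point bounded in `k`, as the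
  -- limit requires.
  refine ⟨fun y => ((14 : ℝ) ^ k)⁻¹ • (toEuclidean (P (idx y)) - toEuclidean (P (idx 0))), by simp,
    fun y y' hy hy' => ?_⟩
  obtain ⟨a1, a2⟩ := hidx y hy
  obtain ⟨b1, b2⟩ := hidx y' hy'
  obtain ⟨c1, c2⟩ := hP.norm_bounds a1 b1
  have e : ‖((14 : ℝ) ^ k)⁻¹ • (toEuclidean (P (idx y)) - toEuclidean (P (idx 0))) -
      ((14 : ℝ) ^ k)⁻¹ • (toEuclidean (P (idx y')) - toEuclidean (P (idx 0)))‖ ^ 2 =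
      (196 ^ k : ℝ)⁻¹ * ‖toEuclidean (P (idx y)) - toEuclidean (P (idx y'))‖ ^ 2 := by
    rw [← smul_sub, sub_sub_sub_cancel_right, norm_smul, mul_pow, norm_inv, inv_pow, norm_pow,
      Real.norm_of_nonneg (by norm_num), h14]
  simp only [e]
  have hpos : (0 : ℝ) < 196 ^ k := by positivity
  have d1 := Int.floor_le ((196 : ℝ) ^ k * y)
  have d2 := Int.lt_floor_add_one ((196 : ℝ) ^ k * y)
  have d3 := Int.floor_le ((196 : ℝ) ^ k * y')
  have d4 := Int.lt_floor_add_one ((196 : ℝ) ^ k * y')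
  have hclose : |((idx y : ℝ) - idx y') - 196 ^ k * (y - y')| ≤ 1 := by
    rw [a2, b2, abs_le]
    constructor <;> linarith
  have e2 : |196 ^ k * (y - y')| = 196 ^ k * |y - y'| := by rw [abs_mul, abs_of_pos hpos]
  have g1 := (abs_abs_sub_abs_le _ _).trans hclose
  rw [e2, abs_le] at g1
  constructor
  · rw [← mul_le_mul_iff_right₀ hpos, mul_sub, mul_inv_cancel₀ hpos.ne', mul_left_comm,
      mul_inv_cancel_left₀ hpos.ne']
    linarith
  · rw [inv_mul_le_iff₀ hpos, mul_left_comm, mul_add, mul_inv_cancel₀ hpos.ne']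
    linarith

/-- The line with the metric `|y - y'|^(1/2)` embeds into `ℝ³`. -/
theorem exists_snowflake_embedding : ∃ f : ℝ → EuclideanSpace ℝ (Fin 3), ∀ y y' : ℝ,
    |y - y'| ≤ 3136 * ‖f y - f y'‖ ^ 2 ∧ ‖f y - f y'‖ ^ 2 ≤ 1176 * |y - y'| := by
  choose g hg0 hg using exists_approximate_snowflake
  -- An ultrafilter gives limits at all real points at once by compactness of balls, so no diagonal
  -- subsequence or continuity of the approximants is needed.
  let U : Ultrafilter ℕ := hyperfilter ℕ
  have hU : (U : Filter ℕ) ≤ atTop := by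
    rw [← Nat.cofinite_eq_atTop]; exact hyperfilter_le_cofinite
  have hlarge (y : ℝ) : ∀ᶠ k in (U : Filter ℕ), |y| ≤ 2 ^ k :=
    hU ((tendsto_pow_atTop_atTop_of_one_lt (by norm_num : (1 : ℝ) < 2)).eventually_ge_atTop |y|)
  have hsmall : Tendsto (fun k : ℕ => (196 ^ k : ℝ)⁻¹) U (𝓝 0) :=
    (tendsto_inv_atTop_zero.comp
      (tendsto_pow_atTop_atTop_of_one_lt (by norm_num : (1 : ℝ) < 196))).mono_left hU
  have hlim (y : ℝ) : ∃ v, Tendsto (fun k => g k y) U (𝓝 v) := by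
    set r := √(1176 * (|y| + 1))
    have hb : ∀ᶠ k in (U : Filter ℕ), g k y ∈ Metric.closedBall (0 : EuclideanSpace ℝ (Fin 3)) r := by
      filter_upwards [hlarge y] with k hk
      have h := (hg k y 0 hk (by simp)).2
      rw [hg0, sub_zero, sub_zero] at h
      rw [mem_closedBall_zero_iff]
      refine Real.le_sqrt_of_sq_le (h.trans ?_)
      gcongr
      exact inv_le_one_of_one_le₀ (one_le_pow₀ (by norm_num))
    obtain ⟨v, -, hv⟩ := (isCompact_closedBall (0 : EuclideanSpace ℝ (Fin 3)) r).ultrafilter_le_nhds'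
      (U.map fun k => g k y) hb
    exact ⟨v, hv⟩
  choose f hf using hlim
  refine ⟨f, fun y y' => ?_⟩
  have hn : Tendsto (fun k => ‖g k y - g k y'‖ ^ 2) U (𝓝 (‖f y - f y'‖ ^ 2)) :=
    (((hf y).sub (hf y')).norm).pow 2
  constructor
  · have h1 : Tendsto (fun k : ℕ => |y - y'| - (196 ^ k : ℝ)⁻¹) U (𝓝 |y - y'|) := by
      simpa using tendsto_const_nhds.sub hsmall
    refine le_of_tendsto_of_tendsto h1 (hn.const_mul 3136) ?_
    filter_upwards [hlarge y, hlarge y'] with k hk hk'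
    exact (hg k y y' hk hk').1
  · have h1 : Tendsto (fun k : ℕ => 1176 * (|y - y'| + (196 ^ k : ℝ)⁻¹)) U
        (𝓝 (1176 * |y - y'|)) := by
      simpa using (tendsto_const_nhds.add hsmall).const_mul 1176
    refine le_of_tendsto_of_tendsto hn h1 ?_
    filter_upwards [hlarge y, hlarge y'] with k hk hk'
    exact (hg k y y' hk hk').2

end Snowflake

/-! ### The singular line in `ℝ³` and the conclusion -/

namespace Grushin

lemma exists_isBiLipschitzOn_singularLine :
    ∃ (L : ℝ≥0) (f : ℝ × ℝ → EuclideanSpace ℝ (Fin 3)), IsBiLipschitzOn L singularLine f := by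
  obtain ⟨f, hf⟩ := Snowflake.exists_snowflake_embedding
  -- Here `168 = 3 * 56` with `56 ^ 2 = 3136`, the factor 3 being the loss in
  -- `rdist_singularLine_le`. The upper bound needs only `√1176 ≤ 168`.
  refine ⟨168, fun p => f p.2, isBiLipschitzOn_iff.2 ⟨by norm_num, ?_⟩⟩
  rintro ⟨x, y⟩ (rfl : x = 0) ⟨x', y'⟩ (rfl : x' = 0)
  obtain ⟨h1, h2⟩ := hf y y'
  have h3 := rdist_singularLine_le y y'
  have h4 := sqrt_le_rdist_singularLine y y'
  have h5 : √|y - y'| ≤ 56 * ‖f y - f y'‖ := by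
    refine Real.sqrt_le_iff.2 ⟨by positivity, ?_⟩
    linarith
  have h6 : ‖f y - f y'‖ ≤ 168 * √|y - y'| := by
    refine (Real.le_sqrt_of_sq_le h2).trans ?_
    rw [Real.sqrt_mul (by norm_num)]
    gcongr
    exact Real.sqrt_le_iff.2 ⟨by norm_num, by norm_num⟩
  push_cast
  constructor <;> linarith

end Grushin

end

theorem theorem1 :
    -- the Grushin plane embeds bi-Lipschitzly into some Euclidean space
    (∃ (N : ℕ) (C : ℝ≥0) (F : ℝ × ℝ → EuclideanSpace ℝ (Fin N)),
      IsBiLipschitzOn C Set.univ F) ∧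
    -- the singular line embeds bi-Lipschitzly into `ℝ³`
    (∃ (L : ℝ≥0) (f : ℝ × ℝ → EuclideanSpace ℝ (Fin 3)),
      IsBiLipschitzOn L singularLine f) ∧
    -- every such `f` yields an embedding whose dimension and constant depend only on `L`
    (∃ (C₁ C₂ : ℝ≥0) (C₃ : ℕ) (φ : WhitneyBox → ℝ × ℝ → ℝ) (z : WhitneyBox → ℝ × ℝ),
      IsLipschitzPartition C₁ C₂ C₃ φ ∧ IsNearestPointChoice z ∧
      ∀ L : ℝ≥0, 1 ≤ L →
        ∃ (M : ℕ) (K : WhitneyBox → Fin M) (C : ℝ≥0), IsColoring L K ∧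
          ∀ f : ℝ × ℝ → EuclideanSpace ℝ (Fin 3), IsBiLipschitzOn L singularLine f →
            IsBiLipschitzOn C Set.univ (embedding φ z K f)) := by
  refine ⟨?_, exists_isBiLipschitzOn_singularLine, 4 * WhitneyBox.nearBound,
    84 * WhitneyBox.nearBound, WhitneyBox.nearBound, WhitneyBox.cutoff, WhitneyBox.nearestPoint,
    WhitneyBox.isLipschitzPartition_cutoff, WhitneyBox.isNearestPointChoice_nearestPoint,
    exists_coloring_isBiLipschitzOn_embedding⟩
  -- The embedding of the whole plane is the Whitney construction applied to the snowflake map.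
  obtain ⟨L, f, hf⟩ := exists_isBiLipschitzOn_singularLine
  obtain ⟨M, K, C, -, h⟩ := exists_coloring_isBiLipschitzOn_embedding L hf.1
  exact ⟨_, C, _, h f hf⟩
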